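/- Let $d\in\mathbb N$, let $J=\begin{pmatrix}0&-I\\ I&0\end{pmatrix}\in\mathbb R^{2d\times 2d}$, let $\mathrm{Sp}(2d)=\{M\in GL(\mathbb R^{2d}) : M^TJM=J\}$, and for $K>0$ let $E_K$ be the set of continuous maps $B$ from $\mathbb R$ to the real symmetric $2d\times 2d$ matrices with $\|B\|=\sup_{t\in\mathbb R}\|B(t)\|\le K$ (Euclidean operator norm), with the metric of the norm $\|\cdot\|$. For $B\in E_K$ let $\gamma=\gamma_B:\mathbb R\to\mathrm{Sp}(2d)$ be the fundamental solution, $\dot\gamma(t)=JB(t)\gamma(t)$, $\gamma(0)=I$. For a continuous path $\alpha:[0,l]\to\mathrm{Sp}(2d)$ with endpoints off the hypersurface $\Sigma=\{M\in\mathrm{Sp}(2d):\det(M-I)=0\}$, let $[\alpha:\Sigma]\in\mathbb Z$ be the intersection number, where $\Sigma$ is co-oriented at $M$ by the direction $\frac{d}{ds}Me^{sJ}|_{s=0}$: it is the sum, over the finitely many crossings of any $C^1$ path $\beta$ that is homotopic to $\alpha$ in $\mathrm{Sp}(2d)$ with fixed endpoints and has only regular crossings, of the signatures of the crossing forms $v\mapsto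 -v^TJ\dot\beta(t)v$ on $\ker(\beta(t)-I)$ (regular means that this form is nondegenerate). For a continuous path $\gamma:[0,l]\to \mathrm{Sp}(2d)$ with $\gamma(0)=I$ let $i_1(\gamma,[0,l])=[e^{-\epsilon J}\gamma:\Sigma]-d$ for all sufficiently small $\epsilon>0$, and let $i_1(\gamma,[0,-l])$ be the index of the path $t\mapsto\gamma(-t)$, $t\in[0,l]$. Put $$\mathcal I_U(B)=\varlimsup_{l\to+\infty}\frac{i_1(\gamma_B,[0,l])}{l},\qquad \mathcal I_L(B)=\varliminf_{l\to+\infty}\frac{i_1(\gamma_B,[0,l])}{l},$$ $$\mathcal I^-_U(B)=\varlimsup_{l\to+\infty}\frac{i_1(\gamma_B,[0,-l])}{-l},\qquad \mathcal I^-_L(B)=\varliminf_{l\to+\infty}\frac{i_1(\gamma_B,[0,-l])}{-l}.$$ Theorem. For every $K>0$ the four functionals $\mathcal I_U,\mathcal I_L,\mathcal I^-_U,\mathcal I^-_L$ are finite and uniformly continuous on $E_K$. -/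

import Mathlib

open Filter Topology Set
open scoped Matrix Matrix.Norms.L2Operator BoundedContinuousFunction

noncomputable section

/-- Real `2d × 2d` matrices, with the operator norm for the Euclidean norm. -/
abbrev PhaseMatrix (d : ℕ) : Type := Matrix (Fin d ⊕ Fin d) (Fin d ⊕ Fin d) ℝ

/-- The standard symplectic matrix `[[0, -I], [I, 0]]`. -/
abbrev stdJ (d : ℕ) : PhaseMatrix d := Matrix.J (Fin d) ℝ

/-- The set `E_K` of continuous symmetric `B` with `‖B‖ ≤ K`, as a subset of the metric space of
bounded continuous matrix functions on `ℝ` with the `C⁰` (supremum) norm. -/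
def boundedSystems (d : ℕ) (K : ℝ) : Set (ℝ →ᵇ PhaseMatrix d) :=
  {B | (∀ t, (B t).IsSymm) ∧ ‖B‖ ≤ K}

/-- `γ' = J B γ`, `γ 0 = I`. -/
def IsFundamentalSolution {d : ℕ} (B : ℝ → PhaseMatrix d) (γ : ℝ → PhaseMatrix d) : Prop :=
  γ 0 = 1 ∧ ∀ t, HasDerivAt γ (stdJ d * B t * γ t) t

/-- The fundamental solution matrix of `z' = J B(t) z` (it exists and is unique for continuous
`B`). -/
def fundamentalSolution {d : ℕ} (B : ℝ → PhaseMatrix d) : ℝ → PhaseMatrix d :=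
  Classical.epsilon (IsFundamentalSolution B)

/-- The singular hypersurface `{M ∈ Sp(2d) | det (M - I) = 0}`. -/
def singularCycle (d : ℕ) : Set (PhaseMatrix d) :=
  {M | M ∈ Matrix.symplecticGroup (Fin d) ℝ ∧ (M - 1).det = 0}

/-- The crossing form `v ↦ -vᵀ J M' v` on `ker (M - I)`, at a point `M` of the hypersurface and for
a velocity `M'`. If `M' = J S M` it is `v ↦ vᵀ S v`. For the velocity `M J` of `s ↦ M exp (s J)`,
which defines the co-orientation, it is positive definite. If `ker (M - I)` is a line, then the
form is nonzero iff `M'` is transverse to the hypersurface, and its signature is `1` or `-1`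
according to whether `M'` is on the positive or the negative side. -/
def crossingForm {d : ℕ} (M M' : PhaseMatrix d) :
    QuadraticForm ℝ (LinearMap.ker (Matrix.toLin' (M - 1))) :=
  (Matrix.toQuadraticForm' (-(stdJ d * M'))).restrict (LinearMap.ker (Matrix.toLin' (M - 1)))

/-- Signature: number of positive minus number of negative squares. -/
def quadSignature {V : Type*} [AddCommGroup V] [Module ℝ V] (Q : QuadraticForm ℝ V) : ℤ :=
  (sigPos Q : ℤ) - (sigNeg Q : ℤ)

/-- `α` and `β` restrict to continuous paths `[0, l] → Sp(2d)` that are homotopic in `Sp(2d)` with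
fixed endpoints. -/
def HomotopicSymplecticPaths {d : ℕ} (α β : ℝ → PhaseMatrix d) (l : ℝ) : Prop :=
  ∃ f g : C(Icc (0 : ℝ) l, Matrix.symplecticGroup (Fin d) ℝ),
    (∀ t, (f t : PhaseMatrix d) = α t) ∧ (∀ t, (g t : PhaseMatrix d) = β t) ∧
      f.HomotopicRel g {t | (t : ℝ) = 0 ∨ (t : ℝ) = l}

/-- `k` is the intersection number of the path `α : [0, l] → Sp(2d)`, with endpoints off the
co-oriented singular hypersurface, with this hypersurface: `α` is homotopic with fixed endpoints to
a `C¹` path which meets the hypersurface at finitely many times, each time with nondegenerate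
crossing form, and `k` is the sum of the signatures of these crossings. -/
def IsIntersectionNumber {d : ℕ} (α : ℝ → PhaseMatrix d) (l : ℝ) (k : ℤ) : Prop :=
  α 0 ∉ singularCycle d ∧ α l ∉ singularCycle d ∧
    ∃ (β : ℝ → PhaseMatrix d) (C : Finset ℝ),
      HomotopicSymplecticPaths α β l ∧ ContDiffOn ℝ 1 β (Icc 0 l) ∧
      (∀ t, t ∈ C ↔ t ∈ Ioo 0 l ∧ β t ∈ singularCycle d) ∧
      (∀ t ∈ C, (QuadraticMap.associated (R := ℝ)
        (crossingForm (β t) (deriv β t))).SeparatingLeft) ∧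
      k = ∑ t ∈ C, quadSignature (crossingForm (β t) (deriv β t))

/-- `k` is the Maslov-type index `i₁(γ, [0, l])` of a symplectic path with `γ 0 = I`:
for all small `ε > 0`, the intersection number of `exp (-ε J) γ` with the singular hypersurface
is `k + d`. -/
def IsMaslovIndex {d : ℕ} (γ : ℝ → PhaseMatrix d) (l : ℝ) (k : ℤ) : Prop :=
  ∀ᶠ ε : ℝ in 𝓝[>] 0,
    IsIntersectionNumber (fun t => NormedSpace.exp (-(ε • stdJ d)) * γ t) l (k + d)

/-- The Maslov-type index `i₁(γ, [0, l])`. -/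
def maslovIndex {d : ℕ} (γ : ℝ → PhaseMatrix d) (l : ℝ) : ℤ :=
  Classical.epsilon (IsMaslovIndex γ l)

/-- `i₁(γ_B, [0, l]) / l`. -/
def forwardRatio {d : ℕ} (B : ℝ →ᵇ PhaseMatrix d) (l : ℝ) : ℝ :=
  (maslovIndex (fundamentalSolution B) l : ℝ) / l

/-- `i₁(γ_B, [0, -l]) / (-l)`, where `γ_B, [0, -l]` is the path `t ↦ γ_B (-t)`, `t ∈ [0, l]`. -/
def backwardRatio {d : ℕ} (B : ℝ →ᵇ PhaseMatrix d) (l : ℝ) : ℝ :=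
  (maslovIndex (fun t => fundamentalSolution B (-t)) l : ℝ) / (-l)

/-- The upper mean index, as an extended real number. -/
def upperMeanIndex {d : ℕ} (B : ℝ →ᵇ PhaseMatrix d) : EReal :=
  limsup (fun l : ℝ => (forwardRatio B l : EReal)) atTop

/-- The lower mean index, as an extended real number. -/
def lowerMeanIndex {d : ℕ} (B : ℝ →ᵇ PhaseMatrix d) : EReal :=
  liminf (fun l : ℝ => (forwardRatio B l : EReal)) atTop

/-- The negative upper mean index, as an extended real number. -/
def upperMeanIndexNeg {d : ℕ} (B : ℝ →ᵇ PhaseMatrix d) : EReal :=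
  limsup (fun l : ℝ => (backwardRatio B l : EReal)) atTop

/-- The negative lower mean index, as an extended real number. -/
def lowerMeanIndexNeg {d : ℕ} (B : ℝ →ᵇ PhaseMatrix d) : EReal :=
  liminf (fun l : ℝ => (backwardRatio B l : EReal)) atTop

/-- The extended-real functional `I` is finite on `s`, and uniformly continuous there as a
real-valued function. -/
def IsFiniteUniformlyContinuousOn {X : Type*} [UniformSpace X] (I : X → EReal) (s : Set X) :
    Prop :=
  (∀ x ∈ s, I x ≠ ⊥ ∧ I x ≠ ⊤) ∧ UniformContinuousOn (fun x => (I x).toReal) s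

end

noncomputable section

/-! The index is compared with a rotation number: the variation of the argument, along the path, of
a nowhere vanishing function `rotationDet` on Sp(2d). The rotation makes sense for every continuous
symplectic path and does not see crossings.

Let P, Q be the spectral projections of the Hermitian matrix iJ and D(M, Z) = det((MQ - P) + (MP -
Q)Z) (`pencilDet`). A symplectic M preserves |Pv|² - |Qv|², which forces D(M, Z) ≠ 0 for every
strict contraction Z (`pencilDet_ne_zero`). At Z = 1 this is det(M - I), whose zeros form Σ; at Z =
0 it is `rotationDet M`. Passing from Z = 0 to Z = 1 through scalars changes the argument by
`radialVar M`, at most 2dπ, since D(M, z) is a polynomial of degree at most 2d in z. Around a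
regular crossing, on a half circle that avoids Z = 1, D turns by π times the signature
(`crossing_local`). Summing over crossings, π times the intersection number is the rotation plus two
endpoint terms (`IsIntersectionNumber.pi_mul_eq`), so π i₁ and the rotation differ by at most 5dπ
(`maslovIndex_spec`).

Right translation of a path by a constant changes its rotation by at most 4dπ
(`abs_argVar_rotationDet_mul_sub_le`), so the rotation can be computed on time windows of length T,
restarting the solution at I on each. On one window, solutions of close systems stay close by
Grönwall and their rotations differ by at most π. The loss is (8d + 1)π per window; with T = (8d +
1)/η the indices differ by at most ηl + 18d + 1 (`exists_abs_maslovIndex_sub_le`). Division by l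
gives uniform continuity, and a chain of finitely many close systems from 0 to B gives finiteness.
Backward time is forward time for -B(-t). -/

/-! ### Variation of the argument along an interval. -/

/-- The variation of the argument of `g` along `[a, b]`. -/
def argVar (g : ℝ → ℂ) (a b : ℝ) : ℝ :=
  Classical.epsilon fun x : ℝ => ∃ θ : ℝ → ℂ, ContinuousOn θ (Icc a b) ∧
    (∀ t ∈ Icc a b, Complex.exp (θ t) = g t) ∧ x = (θ b).im - (θ a).im

/-- The logarithms of 1 form the discrete set 2πiℤ, so a continuous choice among them is constant.
This makes `argVar` independent of the chosen logarithm. -/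
theorem exp_eq_one_const {X : Type*} [TopologicalSpace X] {s : Set X} (hs : IsPreconnected s)
    {θ : X → ℂ} (hθ : ContinuousOn θ s) (h1 : ∀ t ∈ s, Complex.exp (θ t) = 1) {x y : X}
    (hx : x ∈ s) (hy : y ∈ s) : θ x = θ y := by
  have hc : ContinuousOn (fun t => (θ t / (2 * Real.pi * Complex.I)).re) s := by
    exact Complex.continuous_re.comp_continuousOn (hθ.div_const _)
  have key : ∀ t ∈ s, ∃ n : ℤ, θ t = n * (2 * Real.pi * Complex.I) := fun t ht =>
    Complex.exp_eq_one_iff.1 (h1 t ht)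
  have hne : (2 * Real.pi * Complex.I : ℂ) ≠ 0 := Complex.two_pi_I_ne_zero
  have hm : MapsTo (fun t => (θ t / (2 * Real.pi * Complex.I)).re) s
      (range ((↑) : ℤ → ℝ)) := by
    intro t ht
    obtain ⟨n, hn⟩ := key t ht
    refine ⟨n, ?_⟩
    simp only [hn]
    rw [mul_div_cancel_right₀ _ hne]
    simp
  have hd : IsDiscrete (range ((↑) : ℤ → ℝ)) :=
    ⟨Int.isClosedEmbedding_coe_real.isEmbedding.toHomeomorph.symm.isEmbedding.discreteTopology⟩
  have := hs.constant_of_mapsTo hd hc hm hx hy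
  obtain ⟨n, hn⟩ := key x hx
  obtain ⟨m, hm⟩ := key y hy
  simp only [hn, hm] at this ⊢
  rw [mul_div_cancel_right₀ _ hne, mul_div_cancel_right₀ _ hne] at this
  simp at this
  rw [this]

theorem argVar_eq {g θ : ℝ → ℂ} {a b : ℝ} (hab : a ≤ b) (hθ : ContinuousOn θ (Icc a b))
    (h : ∀ t ∈ Icc a b, Complex.exp (θ t) = g t) : argVar g a b = (θ b).im - (θ a).im := by
  obtain ⟨θ', hθ', h', hx⟩ := Classical.epsilon_spec (p := fun x : ℝ => ∃ θ : ℝ → ℂ,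
    ContinuousOn θ (Icc a b) ∧ (∀ t ∈ Icc a b, Complex.exp (θ t) = g t) ∧
    x = (θ b).im - (θ a).im) ⟨_, θ, hθ, h, rfl⟩
  rw [argVar, hx]
  have := exp_eq_one_const (θ := fun t => θ' t - θ t) isPreconnected_Icc (hθ'.sub hθ)
    (fun t ht => by
      rw [Complex.exp_sub, h' t ht, h t ht, div_self]
      rw [← h t ht]; exact Complex.exp_ne_zero _) (left_mem_Icc.2 hab) (right_mem_Icc.2 hab)
  have := congrArg Complex.im this
  simp at this
  linarith

/-- A nonvanishing continuous function on a compact convex set has a continuous logarithm. -/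
theorem exists_log {E : Type*} [NormedAddCommGroup E] [NormedSpace ℝ E] {s : Set E}
    (hs : IsCompact s) (hc : Convex ℝ s) {F : E → ℂ} (hF : ContinuousOn F s)
    (h0 : ∀ x ∈ s, F x ≠ 0) :
    ∃ θ : E → ℂ, ContinuousOn θ s ∧ ∀ x ∈ s, Complex.exp (θ x) = F x := by
  rcases s.eq_empty_or_nonempty with rfl | ⟨x0, hx0⟩
  · exact ⟨0, by simp, by simp⟩
  obtain ⟨y, hy, hmin⟩ := hs.exists_isMinOn ⟨x0, hx0⟩ hF.norm
  have hm : 0 < ‖F y‖ := norm_pos_iff.2 (h0 y hy)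
  obtain ⟨δ, hδ, hu⟩ := Metric.uniformContinuousOn_iff.1 (hs.uniformContinuousOn_of_continuous hF)
    _ hm
  obtain ⟨R, hR⟩ := hs.isBounded.exists_norm_le
  obtain ⟨N, hN⟩ := exists_nat_gt ((2 * R + 1) / δ)
  have hR0 : 0 ≤ R := (norm_nonneg _).trans (hR _ hx0)
  have hNpos : (0 : ℝ) < N := lt_of_le_of_lt (by positivity) hN
  -- The point moves from `x0` to `x` in `N` equal steps shorter than `δ`. Quotients of consecutive
  -- values of `F` then lie within distance 1 of 1, and their principal logarithms telescope to a
  -- logarithm of `F`.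
  let q : ℕ → E → E := fun j x => x0 + ((j : ℝ) / N) • (x - x0)
  have hq : ∀ j ≤ N, ∀ x ∈ s, q j x ∈ s := fun j hj x hx =>
    hc.add_smul_sub_mem hx0 hx ⟨by positivity, div_le_one_of_le₀ (by exact_mod_cast hj) hNpos.le⟩
  have hqc : ∀ j, Continuous (q j) := fun j => by fun_prop
  have hqd : ∀ j, ∀ x ∈ s, dist (q (j + 1) x) (q j x) < δ := by
    intro j x hx
    have : q (j + 1) x - q j x = ((1 : ℝ) / N) • (x - x0) := by
      simp only [q]; push_cast
      rw [add_div, add_smul]; abel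
    rw [dist_eq_norm, this, norm_smul, Real.norm_of_nonneg (by positivity)]
    have h2 : ‖x - x0‖ ≤ 2 * R := (norm_sub_le _ _).trans (by linarith [hR x hx, hR x0 hx0])
    rw [div_lt_iff₀ hδ] at hN
    rw [div_mul_eq_mul_div, one_mul, div_lt_iff₀ hNpos]
    linarith [mul_comm δ (N : ℝ)]
  have hslit : ∀ j < N, ∀ x ∈ s, F (q (j + 1) x) / F (q j x) ∈ Complex.slitPlane := by
    intro j hj x hx
    apply Complex.mem_slitPlane_of_norm_lt_one (z := F (q (j + 1) x) / F (q j x) - 1) _ |> fun h => by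
      simpa using h
    have hq1 := hq j hj.le x hx
    have hq2 := hq (j + 1) hj x hx
    rw [div_sub_one (h0 _ hq1), norm_div, div_lt_one (norm_pos_iff.2 (h0 _ hq1)), ← dist_eq_norm]
    exact (hu _ hq2 _ hq1 (hqd j x hx)).trans_le (hmin hq1)
  refine ⟨fun x => Complex.log (F x0) + ∑ j ∈ Finset.range N,
    Complex.log (F (q (j + 1) x) / F (q j x)), ?_, ?_⟩
  · refine continuousOn_const.add (continuousOn_finsetSum _ fun j hj => ?_)
    have hj := Finset.mem_range.1 hj
    refine ContinuousOn.clog (ContinuousOn.div ?_ ?_ ?_) (hslit j hj)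
    · exact hF.comp (hqc _).continuousOn (hq (j + 1) hj)
    · exact hF.comp (hqc _).continuousOn (hq j hj.le)
    · exact fun x hx => h0 _ (hq j hj.le x hx)
  · intro x hx
    have : ∀ k ≤ N, Complex.exp (Complex.log (F x0) + ∑ j ∈ Finset.range k,
        Complex.log (F (q (j + 1) x) / F (q j x))) = F (q k x) := by
      intro k
      induction k with
      | zero => intro _; simp [q, Complex.exp_log (h0 _ hx0)]
      | succ k ih =>
        intro hk
        rw [Finset.sum_range_succ, ← add_assoc, Complex.exp_add, ih (by omega), Complex.exp_log]
        · rw [mul_div_cancel₀ _ (h0 _ (hq k (by omega) x hx))]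
        · exact div_ne_zero (h0 _ (hq _ hk x hx)) (h0 _ (hq k (by omega) x hx))
    rw [this N le_rfl]
    simp only [q]
    rw [div_self hNpos.ne', one_smul]
    congr 1; abel

/-- `g` is continuous and does not vanish on `[a, b]`. -/
def NonvanishingOn (g : ℝ → ℂ) (a b : ℝ) : Prop :=
  ContinuousOn g (Icc a b) ∧ ∀ t ∈ Icc a b, g t ≠ 0

theorem NonvanishingOn.exists_log {g : ℝ → ℂ} {a b : ℝ} (h : NonvanishingOn g a b) :
    ∃ θ : ℝ → ℂ, ContinuousOn θ (Icc a b) ∧ ∀ t ∈ Icc a b, Complex.exp (θ t) = g t :=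
  _root_.exists_log isCompact_Icc (convex_Icc a b) h.1 h.2

theorem NonvanishingOn.mono {g : ℝ → ℂ} {a b a' b' : ℝ} (h : NonvanishingOn g a b)
    (ha : a ≤ a') (hb : b' ≤ b) : NonvanishingOn g a' b' :=
  ⟨h.1.mono (Icc_subset_Icc ha hb), fun t ht => h.2 t (Icc_subset_Icc ha hb ht)⟩

theorem argVar_congr {g g' : ℝ → ℂ} {a b : ℝ} (h : ∀ t ∈ Icc a b, g t = g' t) :
    argVar g a b = argVar g' a b := by
  unfold argVar
  congr 1; ext x
  refine exists_congr fun θ => and_congr_right fun _ => and_congr_left fun _ => ?_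
  exact forall₂_congr fun t ht => by rw [h t ht]

theorem argVar_add {g : ℝ → ℂ} {a b c : ℝ} (hab : a ≤ b) (hbc : b ≤ c)
    (h : NonvanishingOn g a c) : argVar g a b + argVar g b c = argVar g a c := by
  obtain ⟨θ, hθ, h'⟩ := h.exists_log
  rw [argVar_eq (hab.trans hbc) hθ h',
    argVar_eq hab (hθ.mono (Icc_subset_Icc_right hbc)) fun t ht => h' t (Icc_subset_Icc_right hbc ht),
    argVar_eq hbc (hθ.mono (Icc_subset_Icc_left hab)) fun t ht => h' t (Icc_subset_Icc_left hab ht)]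
  ring

theorem argVar_mul {g g' : ℝ → ℂ} {a b : ℝ} (hab : a ≤ b) (h : NonvanishingOn g a b)
    (h' : NonvanishingOn g' a b) :
    argVar (fun t => g t * g' t) a b = argVar g a b + argVar g' a b := by
  obtain ⟨θ, hθ, e⟩ := h.exists_log
  obtain ⟨θ', hθ', e'⟩ := h'.exists_log
  rw [argVar_eq hab hθ e, argVar_eq hab hθ' e', argVar_eq (θ := fun t => θ t + θ' t) hab (hθ.add hθ')]
  · simp; ring
  · intro t ht; rw [Complex.exp_add, e t ht, e' t ht]

theorem argVar_const {a b : ℝ} (hab : a ≤ b) {c : ℂ} (hc : c ≠ 0) :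
    argVar (fun _ => c) a b = 0 := by
  rw [argVar_eq (θ := fun _ => Complex.log c) hab continuousOn_const
    fun _ _ => Complex.exp_log hc, sub_self]

theorem argVar_const_mul {g : ℝ → ℂ} {a b : ℝ} (hab : a ≤ b) (h : NonvanishingOn g a b) {c : ℂ}
    (hc : c ≠ 0) : argVar (fun t => c * g t) a b = argVar g a b := by
  rw [argVar_mul hab ⟨continuousOn_const, fun _ _ => hc⟩ h, argVar_const hab hc, zero_add]

theorem argVar_eq_arg_sub_arg {g : ℝ → ℂ} {a b : ℝ} (hab : a ≤ b)
    (hg : ContinuousOn g (Icc a b)) (h : ∀ t ∈ Icc a b, g t ∈ Complex.slitPlane) :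
    argVar g a b = Complex.arg (g b) - Complex.arg (g a) := by
  rw [argVar_eq (θ := fun t => Complex.log (g t)) hab (hg.clog h)
    fun t ht => Complex.exp_log (Complex.slitPlane_ne_zero (h t ht)), Complex.log_im, Complex.log_im]

/-- A nonzero real value has its argument in πℤ, so doubling the imaginary part of the logarithm
gives a logarithm of 1, which is constant. -/
theorem argVar_real {g : ℝ → ℂ} {a b : ℝ} (hab : a ≤ b) (h : NonvanishingOn g a b)
    (hr : ∀ t ∈ Icc a b, (g t).im = 0) : argVar g a b = 0 := by
  obtain ⟨θ, hθ, e⟩ := h.exists_log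
  rw [argVar_eq hab hθ e]
  have := exp_eq_one_const (θ := fun t => ((2 * (θ t).im : ℝ) : ℂ) * Complex.I)
    isPreconnected_Icc ?_ (fun t ht => ?_) (left_mem_Icc.2 hab) (right_mem_Icc.2 hab)
  · have := congrArg Complex.im this
    simp at this; linarith
  · exact (Complex.continuous_ofReal.comp_continuousOn
      (continuousOn_const.mul (Complex.continuous_im.comp_continuousOn hθ))).mul continuousOn_const
  · have h1 := congrArg Complex.im (e t ht)
    rw [hr t ht, Complex.exp_im] at h1
    have h2 : Real.sin (θ t).im = 0 := by
      rcases mul_eq_zero.1 h1 with h | h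
      · exact absurd h (Real.exp_ne_zero _)
      · exact h
    obtain ⟨n, hn⟩ := Real.sin_eq_zero_iff.1 h2
    rw [Complex.exp_eq_one_iff]
    refine ⟨n, ?_⟩
    rw [← hn]; push_cast; ring

/-- `F` has a logarithm on the whole rectangle, so its winding along the boundary is zero. All
homotopy arguments below are instances of this identity. -/
theorem argVar_rectangle {F : ℝ → ℝ → ℂ} {a b c d : ℝ} (hab : a ≤ b) (hcd : c ≤ d)
    (hF : ContinuousOn (Function.uncurry F) (Icc a b ×ˢ Icc c d))
    (h0 : ∀ s ∈ Icc a b, ∀ t ∈ Icc c d, F s t ≠ 0) :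
    argVar (fun s => F s c) a b + argVar (fun t => F b t) c d =
      argVar (fun t => F a t) c d + argVar (fun s => F s d) a b := by
  obtain ⟨θ, hθ, e⟩ := exists_log (isCompact_Icc.prod isCompact_Icc)
    ((convex_Icc a b).prod (convex_Icc c d)) hF (fun x hx => h0 x.1 hx.1 x.2 hx.2)
  have hs : ∀ t ∈ Icc c d, ContinuousOn (fun s => θ (s, t)) (Icc a b) := fun t ht =>
    hθ.comp (by fun_prop) fun s hs => ⟨hs, ht⟩
  have ht : ∀ s ∈ Icc a b, ContinuousOn (fun t => θ (s, t)) (Icc c d) := fun s hs =>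
    hθ.comp (by fun_prop) fun t ht => ⟨hs, ht⟩
  have ha := left_mem_Icc.2 hab
  have hb := right_mem_Icc.2 hab
  have hc := left_mem_Icc.2 hcd
  have hd := right_mem_Icc.2 hcd
  rw [argVar_eq (g := fun s => F s c) hab (hs c hc) fun s h => e (s, c) ⟨h, hc⟩,
    argVar_eq (g := fun s => F s d) hab (hs d hd) fun s h => e (s, d) ⟨h, hd⟩,
    argVar_eq (g := fun t => F a t) hcd (ht a ha) fun s h => e (a, s) ⟨ha, h⟩,
    argVar_eq (g := fun t => F b t) hcd (ht b hb) fun s h => e (b, s) ⟨hb, h⟩]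
  ring

theorem argVar_comp_monotone {g : ℝ → ℂ} {u : ℝ → ℝ} {a b : ℝ} (hab : a ≤ b)
    (hu : ContinuousOn u (Icc a b)) (hm : MonotoneOn u (Icc a b))
    (h : NonvanishingOn g (u a) (u b)) :
    argVar (fun t => g (u t)) a b = argVar g (u a) (u b) := by
  obtain ⟨θ, hθ, e⟩ := h.exists_log
  have ha := left_mem_Icc.2 hab
  have hb := right_mem_Icc.2 hab
  have hmap : MapsTo u (Icc a b) (Icc (u a) (u b)) := fun t ht =>
    ⟨hm ha ht ht.1, hm ht hb ht.2⟩
  rw [argVar_eq (hm ha hb hab) hθ e, argVar_eq (θ := fun t => θ (u t)) hab (hθ.comp hu hmap)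
    fun t ht => e _ (hmap ht)]

/-- The quotient `f / g` stays in the right half plane, so its principal argument moves between two
values in (-π/2, π/2). -/
theorem abs_argVar_sub_le {f g : ℝ → ℂ} {a b : ℝ} (hab : a ≤ b) (hf : ContinuousOn f (Icc a b))
    (hg : NonvanishingOn g a b) (h : ∀ t ∈ Icc a b, ‖f t - g t‖ < ‖g t‖) :
    |argVar f a b - argVar g a b| ≤ Real.pi := by
  have hslit : ∀ t ∈ Icc a b, 0 < (f t / g t).re := by
    intro t ht
    have h1 : ‖f t / g t - 1‖ < 1 := by
      rw [div_sub_one (hg.2 t ht), norm_div, div_lt_one (norm_pos_iff.2 (hg.2 t ht))]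
      exact h t ht
    have := (abs_le.1 (Complex.abs_re_le_norm (f t / g t - 1))).1
    simp at this
    linarith
  have hc : ContinuousOn (fun t => f t / g t) (Icc a b) := hf.div hg.1 hg.2
  have e : argVar f a b = argVar (fun t => f t / g t * g t) a b :=
    argVar_congr fun t ht => by rw [div_mul_cancel₀ _ (hg.2 t ht)]
  rw [e, argVar_mul hab ⟨hc, fun t ht h0 => by have := hslit t ht; simp [h0] at this⟩ hg,
    add_sub_cancel_right, argVar_eq_arg_sub_arg hab hc fun t ht => Or.inl (hslit t ht)]
  have h1 := Complex.abs_arg_lt_pi_div_two_iff.2 (Or.inl (hslit a (left_mem_Icc.2 hab)))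
  have h2 := Complex.abs_arg_lt_pi_div_two_iff.2 (Or.inl (hslit b (right_mem_Icc.2 hab)))
  rw [abs_lt] at h1 h2
  rw [abs_le]; constructor <;> linarith

theorem argVar_finset_prod {ι : Type*} (s : Finset ι) {g : ι → ℝ → ℂ} {a b : ℝ} (hab : a ≤ b)
    (h : ∀ i ∈ s, NonvanishingOn (g i) a b) :
    argVar (fun t => ∏ i ∈ s, g i t) a b = ∑ i ∈ s, argVar (g i) a b := by
  classical
  induction s using Finset.induction_on with
  | empty => simpa using argVar_const hab one_ne_zero
  | insert i s hi ih =>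
    have h' := fun j hj => h j (Finset.mem_insert_of_mem hj)
    simp only [Finset.prod_insert hi, Finset.sum_insert hi]
    rw [argVar_mul hab (h i (Finset.mem_insert_self _ _)) ⟨continuousOn_finsetProd _ fun j hj =>
      (h' j hj).1, fun t ht => Finset.prod_ne_zero_iff.2 fun j hj => (h' j hj).2 t ht⟩, ih h']

/-- Seen from a point outside it, a segment subtends an angle of at most π. Each linear factor of
`p` therefore contributes at most π. -/
theorem abs_argVar_polynomial_le (p : Polynomial ℂ) {a b : ℝ} (hab : a ≤ b)
    (h : ∀ t ∈ Icc a b, p.eval (t : ℂ) ≠ 0) :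
    |argVar (fun t => p.eval (t : ℂ)) a b| ≤ p.natDegree * Real.pi := by
  have hp0 : p ≠ 0 := by
    rintro rfl
    exact h a (left_mem_Icc.2 hab) (by simp)
  have lin : ∀ z : ℂ, (∀ t ∈ Icc a b, (t : ℂ) - z ≠ 0) →
      |argVar (fun t => (t : ℂ) - z) a b| ≤ Real.pi := by
    intro z hz
    have hza := hz a (left_mem_Icc.2 hab)
    have hslit : ∀ t ∈ Icc a b, ((t : ℂ) - z) / (a - z) ∈ Complex.slitPlane := by
      intro t ht
      by_contra hn
      rw [Complex.mem_slitPlane_iff, not_or, not_lt, not_not] at hn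
      obtain ⟨ρ, hρ⟩ : ∃ ρ : ℝ, ((t : ℂ) - z) / (a - z) = ρ :=
        ⟨_, Complex.ext rfl (by simpa using hn.2)⟩
      have hρ0 : ρ ≤ 0 := by simpa [hρ] using hn.1
      rw [div_eq_iff hza] at hρ
      have h1 : (0 : ℝ) < 1 - ρ := by linarith
      -- A ratio `ρ ≤ 0` exhibits `z` as a convex combination of `t` and `a`, hence as a point of
      -- the segment.
      have hz' : z = (((t - ρ * a) / (1 - ρ) : ℝ) : ℂ) := by
        push_cast
        have : (1 : ℂ) - ρ ≠ 0 := by exact_mod_cast h1.ne'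
        field_simp
        linear_combination -hρ
      refine hz ((t - ρ * a) / (1 - ρ)) ⟨?_, ?_⟩ (by rw [← hz', sub_self])
      · rw [le_div_iff₀ h1]; nlinarith [ht.1]
      · rw [div_le_iff₀ h1]; nlinarith [ht.2, ht.1]
    have hc : ContinuousOn (fun t : ℝ => ((t : ℂ) - z) / (a - z)) (Icc a b) := by fun_prop
    have e : argVar (fun t => (t : ℂ) - z) a b =
        argVar (fun t => ((a : ℂ) - z) * (((t : ℂ) - z) / (a - z))) a b :=
      argVar_congr fun t _ => by rw [mul_div_cancel₀ _ hza]
    rw [e, argVar_const_mul hab ⟨hc, fun t ht => Complex.slitPlane_ne_zero (hslit t ht)⟩ hza,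
      argVar_eq_arg_sub_arg hab hc hslit, div_self hza, Complex.arg_one, sub_zero]
    exact Complex.abs_arg_le_pi _
  have gen : ∀ m : Multiset ℂ, (∀ z ∈ m, ∀ t ∈ Icc a b, (t : ℂ) - z ≠ 0) →
      |argVar (fun t => (m.map fun z => (t : ℂ) - z).prod) a b| ≤ m.card * Real.pi := by
    intro m
    induction m using Multiset.induction_on with
    | empty => intro _; simp [argVar_const hab one_ne_zero]
    | cons z m ih =>
      intro hm
      have hm' := fun w hw => hm w (Multiset.mem_cons_of_mem hw)
      simp only [Multiset.map_cons, Multiset.prod_cons, Multiset.card_cons]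
      rw [argVar_mul hab ⟨by fun_prop, hm z (Multiset.mem_cons_self _ _)⟩ ⟨?_, ?_⟩]
      · refine (abs_add_le _ _).trans ?_
        push_cast
        linarith [lin z (hm z (Multiset.mem_cons_self _ _)), ih hm']
      · exact continuousOn_multiset_prod _ fun z _ => by fun_prop
      · intro t ht h0
        obtain ⟨w, hw, hw0⟩ := Multiset.mem_map.1 (Multiset.prod_eq_zero_iff.1 h0)
        exact hm' w hw t ht hw0
  have hsplit := IsAlgClosed.splits p
  have hev : ∀ t : ℝ, p.eval (t : ℂ) =
      p.leadingCoeff * (p.roots.map fun z => (t : ℂ) - z).prod := fun t =>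
    hsplit.eval_eq_prod_roots _
  have hroots : ∀ z ∈ p.roots, ∀ t ∈ Icc a b, (t : ℂ) - z ≠ 0 := by
    intro z hz t ht h0
    rw [sub_eq_zero] at h0
    exact h t ht (by rw [h0]; exact (Polynomial.mem_roots hp0).1 hz)
  simp_rw [hev]
  rw [argVar_const_mul hab ⟨?_, ?_⟩ (by simpa using hp0)]
  · refine (gen _ hroots).trans ?_
    gcongr
    exact p.card_roots'
  · exact continuousOn_multiset_prod _ fun z _ => by fun_prop
  · intro t ht h0
    exact h t ht (by rw [hev, h0, mul_zero])

/-! ### The pencil determinant on the symplectic group. -/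

/-- Complex `2d × 2d` matrices. -/
abbrev ComplexPhaseMatrix (d : ℕ) : Type := Matrix (Fin d ⊕ Fin d) (Fin d ⊕ Fin d) ℂ

/-- Complexification of a real matrix. -/
def complexify {d : ℕ} : PhaseMatrix d →+* ComplexPhaseMatrix d := Complex.ofRealHom.mapMatrix

theorem complexify_apply {d : ℕ} (M : PhaseMatrix d) (i j) : complexify M i j = (M i j : ℂ) := rfl

theorem complexify_smul {d : ℕ} (c : ℝ) (M : PhaseMatrix d) :
    complexify (c • M) = (c : ℂ) • complexify M := by
  ext i j; simp [complexify_apply]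

theorem complexify_transpose {d : ℕ} (M : PhaseMatrix d) :
    complexify Mᵀ = (complexify M)ᴴ := by
  ext i j; simp [complexify_apply]

theorem continuous_complexify {d : ℕ} : Continuous (complexify : PhaseMatrix d → _) :=
  continuous_id.matrix_map Complex.continuous_ofReal

theorem det_complexify {d : ℕ} (M : PhaseMatrix d) : (complexify M).det = (M.det : ℂ) :=
  (Complex.ofRealHom.map_det M).symm

/-- Spectral projections of the Hermitian matrix `i J`. -/
def projPlus (d : ℕ) : ComplexPhaseMatrix d :=
  (1 / 2 : ℂ) • (1 + Complex.I • complexify (stdJ d))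

/-- Complementary spectral projection of `i J`. -/
def projMinus (d : ℕ) : ComplexPhaseMatrix d :=
  (1 / 2 : ℂ) • (1 - Complex.I • complexify (stdJ d))

section proj
variable (d : ℕ)

theorem complexify_J_mul_self : complexify (stdJ d) * complexify (stdJ d) = -1 := by
  rw [← map_mul, Matrix.J_squared, map_neg, map_one]

theorem projPlus_mul_self : projPlus d * projPlus d = projPlus d := by
  simp only [projPlus, smul_mul_smul, mul_add, add_mul, mul_one, one_mul, complexify_J_mul_self]
  rw [Complex.I_mul_I]
  module

theorem projMinus_mul_self : projMinus d * projMinus d = projMinus d := by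
  simp only [projMinus, smul_mul_smul, mul_sub, sub_mul, mul_one, one_mul, complexify_J_mul_self]
  rw [Complex.I_mul_I]
  module

theorem projPlus_mul_projMinus : projPlus d * projMinus d = 0 := by
  simp only [projPlus, projMinus, smul_mul_smul, mul_sub, add_mul, mul_one, one_mul,
    complexify_J_mul_self]
  rw [Complex.I_mul_I]
  module

theorem projMinus_mul_projPlus : projMinus d * projPlus d = 0 := by
  simp only [projPlus, projMinus, smul_mul_smul, mul_add, sub_mul, mul_one, one_mul,
    complexify_J_mul_self]
  rw [Complex.I_mul_I]
  module

theorem projPlus_add_projMinus : projPlus d + projMinus d = 1 := by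
  simp only [projPlus, projMinus]; module

theorem projPlus_sub_projMinus :
    projPlus d - projMinus d = Complex.I • complexify (stdJ d) := by
  simp only [projPlus, projMinus]; module

theorem complexify_J_conjTranspose : (complexify (stdJ d))ᴴ = -complexify (stdJ d) := by
  rw [← complexify_transpose, Matrix.J_transpose, map_neg]

theorem projPlus_conjTranspose : (projPlus d)ᴴ = projPlus d := by
  simp [projPlus, complexify_J_conjTranspose]

theorem projMinus_conjTranspose : (projMinus d)ᴴ = projMinus d := by
  simp [projMinus, complexify_J_conjTranspose, sub_eq_add_neg]

theorem J_mul_projPlus : complexify (stdJ d) * projPlus d = -Complex.I • projPlus d := by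
  simp only [projPlus, mul_smul_comm, mul_add, mul_one, complexify_J_mul_self]
  simp only [smul_smul, smul_add, smul_neg, neg_smul, neg_mul, mul_comm Complex.I, mul_assoc,
    Complex.I_mul_I]
  module

end proj

/-- Matrices that preserve the Hermitian form `i J`. -/
def IsKrein {d : ℕ} (M : ComplexPhaseMatrix d) : Prop :=
  Mᴴ * (projPlus d - projMinus d) * M = projPlus d - projMinus d

theorem isKrein_complexify {d : ℕ} {M : PhaseMatrix d}
    (hM : M ∈ Matrix.symplecticGroup (Fin d) ℝ) : IsKrein (complexify M) := by
  rw [IsKrein, projPlus_sub_projMinus, mul_smul_comm, smul_mul_assoc, ← complexify_transpose,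
    ← map_mul, ← map_mul, SymplecticGroup.mem_iff'.1 hM]

/-- Square of the Euclidean norm of a complex vector. -/
def normSqVec {n : Type*} [Fintype n] (u : n → ℂ) : ℝ := ∑ i, Complex.normSq (u i)

section normSqVec
variable {n : Type*} [Fintype n]

theorem star_dotProduct_self (u : n → ℂ) : star u ⬝ᵥ u = (normSqVec u : ℂ) := by
  simp only [dotProduct, normSqVec, Complex.ofReal_sum, Pi.star_apply]
  exact Finset.sum_congr rfl fun _ _ => (Complex.normSq_eq_conj_mul_self).symm

theorem normSqVec_nonneg (u : n → ℂ) : 0 ≤ normSqVec u :=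
  Finset.sum_nonneg fun _ _ => Complex.normSq_nonneg _

theorem normSqVec_eq_zero {u : n → ℂ} : normSqVec u = 0 ↔ u = 0 := by
  rw [normSqVec, Finset.sum_eq_zero_iff_of_nonneg fun _ _ => Complex.normSq_nonneg _]
  simp [funext_iff]

theorem normSqVec_smul (c : ℝ) (u : n → ℂ) : normSqVec ((c : ℂ) • u) = c ^ 2 * normSqVec u := by
  simp [normSqVec, Finset.mul_sum, sq]

theorem star_mulVec_dotProduct (A : Matrix n n ℂ) (u : n → ℂ) (v : n → ℂ) :
    star (A *ᵥ u) ⬝ᵥ v = star u ⬝ᵥ (Aᴴ *ᵥ v) := by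
  rw [Matrix.star_mulVec, ← Matrix.dotProduct_mulVec]

theorem normSqVec_mulVec (A : Matrix n n ℂ) (u : n → ℂ) :
    (normSqVec (A *ᵥ u) : ℂ) = star u ⬝ᵥ ((Aᴴ * A) *ᵥ u) := by
  rw [← star_dotProduct_self, star_mulVec_dotProduct, Matrix.mulVec_mulVec]

end normSqVec

/-- `‖Z u‖ < ‖u‖` for `u ≠ 0`. -/
def IsStrictContraction {d : ℕ} (Z : ComplexPhaseMatrix d) : Prop :=
  ∀ u, u ≠ 0 → normSqVec (Z *ᵥ u) < normSqVec u

theorem IsStrictContraction.smul {d : ℕ} {Z : ComplexPhaseMatrix d} (hZ : IsStrictContraction Z)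
    {r : ℝ} (hr : r ∈ Icc (0 : ℝ) 1) : IsStrictContraction ((r : ℂ) • Z) := by
  intro u hu
  rw [Matrix.smul_mulVec, normSqVec_smul]
  refine lt_of_le_of_lt ?_ (hZ u hu)
  have := normSqVec_nonneg (Z *ᵥ u)
  have : r ^ 2 ≤ 1 := by nlinarith [hr.1, hr.2]
  nlinarith

theorem isStrictContraction_zero {d : ℕ} : IsStrictContraction (0 : ComplexPhaseMatrix d) := by
  intro u hu
  have h := (normSqVec_nonneg u).lt_of_ne' (mt normSqVec_eq_zero.1 hu)
  simpa [normSqVec] using h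

theorem isStrictContraction_smul_one {d : ℕ} {r : ℝ} (h0 : 0 ≤ r) (h1 : r < 1) :
    IsStrictContraction ((r : ℂ) • (1 : ComplexPhaseMatrix d)) := by
  intro u hu
  rw [Matrix.smul_mulVec, Matrix.one_mulVec, normSqVec_smul]
  have h := (normSqVec_nonneg u).lt_of_ne' (mt normSqVec_eq_zero.1 hu)
  have : r ^ 2 < 1 := by nlinarith
  nlinarith

/-- The determinant of the pencil `(M Q - P) + (M P - Q) Z`. -/
def pencilDet {d : ℕ} (M Z : ComplexPhaseMatrix d) : ℂ :=
  (M * projMinus d - projPlus d + (M * projPlus d - projMinus d) * Z).det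

/-- A kernel vector `u` satisfies M(PZ + Q)u = (P + QZ)u. Invariance of |Pv|² - |Qv|² under M gives
|PZu|² - |Qu|² = |Pu|² - |QZu|², that is |Zu| = |u|, impossible for a strict contraction. -/
theorem pencilDet_ne_zero {d : ℕ} {M Z : ComplexPhaseMatrix d} (hM : IsKrein M)
    (hZ : IsStrictContraction Z) : pencilDet M Z ≠ 0 := by
  unfold IsKrein at hM
  unfold pencilDet
  intro h0
  obtain ⟨u, hu, e⟩ := Matrix.exists_mulVec_eq_zero_iff.2 h0
  have hPP := projPlus_mul_self d
  have hQQ := projMinus_mul_self d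
  have hPQ := projPlus_mul_projMinus d
  have hQP := projMinus_mul_projPlus d
  have hPs := projPlus_conjTranspose d
  have hQs := projMinus_conjTranspose d
  have hadd := projPlus_add_projMinus d
  generalize projPlus d = P at *
  generalize projMinus d = Q at *
  have hPQZ : P * (Q * Z) = 0 := by rw [← mul_assoc, hPQ, zero_mul]
  have hQPZ : Q * (P * Z) = 0 := by rw [← mul_assoc, hQP, zero_mul]
  have hPPZ : P * (P * Z) = P * Z := by rw [← mul_assoc, hPP]
  have hQQZ : Q * (Q * Z) = Q * Z := by rw [← mul_assoc, hQQ]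
  set a := P * Z + Q with ha
  set b := P + Q * Z with hb
  have e1 : (M * a) *ᵥ u = b *ᵥ u := by
    rw [← sub_eq_zero, ← Matrix.sub_mulVec, ← e]
    congr 1
    rw [ha, hb]; noncomm_ring
  have e2 : aᴴ * (P - Q) * a - bᴴ * (P - Q) * b = Zᴴ * Z - 1 := by
    simp only [ha, hb, Matrix.conjTranspose_add, Matrix.conjTranspose_mul, hPs, hQs]
    simp only [mul_add, add_mul, mul_sub, sub_mul, mul_assoc, hPP, hQQ, hPQ, hQP, hPQZ, hQPZ, hPPZ,
      hQQZ, mul_zero, sub_zero, zero_sub, add_zero, zero_add]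
    rw [← hadd]
    have : Zᴴ * Z = Zᴴ * (P * Z) + Zᴴ * (Q * Z) := by
      rw [← mul_add, ← add_mul, hadd, one_mul]
    rw [this]
    abel
  have e3 : star u ⬝ᵥ ((aᴴ * (P - Q) * a) *ᵥ u) = star u ⬝ᵥ ((bᴴ * (P - Q) * b) *ᵥ u) := by
    have h1 : aᴴ * (P - Q) * a = (M * a)ᴴ * (P - Q) * (M * a) := by
      have : (M * a)ᴴ * (P - Q) * (M * a) = aᴴ * (Mᴴ * (P - Q) * M) * a := by
        rw [Matrix.conjTranspose_mul]; noncomm_ring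
      rw [this, hM]
    have h2 : ∀ c : ComplexPhaseMatrix d, star u ⬝ᵥ ((cᴴ * (P - Q) * c) *ᵥ u) =
        star (c *ᵥ u) ⬝ᵥ ((P - Q) *ᵥ (c *ᵥ u)) := fun c => by
      rw [star_mulVec_dotProduct, Matrix.mulVec_mulVec, Matrix.mulVec_mulVec, mul_assoc]
    rw [h1, h2, h2, e1]
  rw [← sub_eq_zero, ← dotProduct_sub, ← Matrix.sub_mulVec, e2, Matrix.sub_mulVec, dotProduct_sub,
    ← normSqVec_mulVec, Matrix.one_mulVec, star_dotProduct_self, sub_eq_zero] at e3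
  exact (hZ u hu).ne (by exact_mod_cast e3)

theorem pencilDet_one {d : ℕ} (M : PhaseMatrix d) :
    pencilDet (complexify M) 1 = ((M - 1).det : ℂ) := by
  rw [← det_complexify, pencilDet, map_sub, map_one]
  congr 1
  rw [mul_one]
  calc _ = complexify M * (projPlus d + projMinus d) - (projPlus d + projMinus d) := by noncomm_ring
    _ = _ := by rw [projPlus_add_projMinus, mul_one]

/-- The nonvanishing function on the symplectic group whose argument is the rotation of a path. -/
def rotationDet {d : ℕ} (M : PhaseMatrix d) : ℂ := pencilDet (complexify M) 0

theorem rotationDet_ne_zero {d : ℕ} {M : PhaseMatrix d}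
    (hM : M ∈ Matrix.symplecticGroup (Fin d) ℝ) : rotationDet M ≠ 0 :=
  pencilDet_ne_zero (isKrein_complexify hM) isStrictContraction_zero

theorem continuous_rotationDet {d : ℕ} : Continuous (rotationDet : PhaseMatrix d → ℂ) :=
  Continuous.matrix_det (((continuous_complexify.matrix_mul continuous_const).sub
    continuous_const).add (((continuous_complexify.matrix_mul continuous_const).sub
    continuous_const).matrix_mul continuous_const))

/-- With g = P + QNQ and w = PNQ one has (MQ - P)g + (MP - Q)w = MNQ - P, which dictates Z = w g⁻¹
and c = det g. Compressing the Krein relation of N by Q gives g*g - w*w = 1; hence |gu|² = |wu|² +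
|u|², so g is invertible and Z is a strict contraction. -/
theorem exists_strictContraction_cocycle {d : ℕ} {N P Q : ComplexPhaseMatrix d}
    (hPP : P * P = P) (hQQ : Q * Q = Q) (hPQ : P * Q = 0) (hQP : Q * P = 0) (hPs : Pᴴ = P)
    (hQs : Qᴴ = Q) (hadd : P + Q = 1) (hN : Nᴴ * (P - Q) * N = P - Q) :
    ∃ (Z : ComplexPhaseMatrix d) (c : ℂ), IsStrictContraction Z ∧ c ≠ 0 ∧
      ∀ M : ComplexPhaseMatrix d,
        (M * N * Q - P).det = c * (M * Q - P + (M * P - Q) * Z).det := by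
  have hPQZ : ∀ Z, P * (Q * Z) = 0 := fun Z => by rw [← mul_assoc, hPQ, zero_mul]
  have hQPZ : ∀ Z, Q * (P * Z) = 0 := fun Z => by rw [← mul_assoc, hQP, zero_mul]
  have hPPZ : ∀ Z, P * (P * Z) = P * Z := fun Z => by rw [← mul_assoc, hPP]
  have hQQZ : ∀ Z, Q * (Q * Z) = Q * Z := fun Z => by rw [← mul_assoc, hQQ]
  obtain ⟨g, hg⟩ : ∃ g, g = P + Q * N * Q := ⟨_, rfl⟩
  obtain ⟨w, hw⟩ : ∃ w, w = P * N * Q := ⟨_, rfl⟩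
  have e1 : gᴴ * g - wᴴ * w = 1 := by
    have h1 : gᴴ * g - wᴴ * w = P - Q * (Nᴴ * (P - Q) * N) * Q := by
      simp only [hg, hw, Matrix.conjTranspose_add, Matrix.conjTranspose_mul, hPs, hQs]
      simp only [mul_add, add_mul, mul_sub, sub_mul, mul_assoc, hPP, hQP, hPQZ,
        hPPZ, hQQZ, mul_zero, add_zero, zero_add]
      abel
    rw [h1, hN, mul_sub, hQP, hQQ, zero_sub, neg_mul, hQQ, sub_neg_eq_add, hadd]
  have e2 : ∀ u, normSqVec (g *ᵥ u) = normSqVec (w *ᵥ u) + normSqVec u := by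
    intro u
    have : (normSqVec (g *ᵥ u) : ℂ) - normSqVec (w *ᵥ u) = normSqVec u := by
      rw [normSqVec_mulVec, normSqVec_mulVec, ← dotProduct_sub, ← Matrix.sub_mulVec, e1,
        Matrix.one_mulVec, star_dotProduct_self]
    rw [← sub_eq_iff_eq_add']
    exact_mod_cast this
  have hdet : g.det ≠ 0 := by
    intro h0
    obtain ⟨u, hu, e⟩ := Matrix.exists_mulVec_eq_zero_iff.2 h0
    have h := (normSqVec_nonneg u).lt_of_ne' (mt normSqVec_eq_zero.1 hu)
    have h2 := e2 u
    rw [e, normSqVec_eq_zero.2 rfl] at h2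
    linarith [normSqVec_nonneg (w *ᵥ u)]
  have hunit : IsUnit g.det := isUnit_iff_ne_zero.2 hdet
  have hwg : w * g⁻¹ * g = w := Matrix.nonsing_inv_mul_cancel_right _ _ hunit
  refine ⟨w * g⁻¹, g.det, ?_, hdet, fun M => ?_⟩
  · intro u hu
    have hgu : g *ᵥ (g⁻¹ *ᵥ u) = u := by
      rw [Matrix.mulVec_mulVec, Matrix.mul_nonsing_inv _ hunit, Matrix.one_mulVec]
    have hv : g⁻¹ *ᵥ u ≠ 0 := by
      intro h; rw [h, Matrix.mulVec_zero] at hgu; exact hu hgu.symm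
    have h := (normSqVec_nonneg _).lt_of_ne' (mt normSqVec_eq_zero.1 hv)
    have h2 := e2 (g⁻¹ *ᵥ u)
    rw [hgu] at h2
    rw [← Matrix.mulVec_mulVec]
    linarith
  · rw [mul_comm, ← Matrix.det_mul]
    congr 1
    rw [add_mul, mul_assoc (M * P - Q), hwg]
    simp only [hg, hw, mul_add, sub_mul, mul_assoc, hPP, hQP, hPQZ,
      hQPZ, hPPZ, hQQZ, mul_zero, sub_zero, zero_sub]
    rw [show -P + M * (Q * (N * Q)) + M * (P * (N * Q)) = M * ((P + Q) * (N * Q)) - P by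
      noncomm_ring, hadd, one_mul]

/-- Right translation by `N` thus amounts to moving the second argument of the pencil from 0 to a
strict contraction that does not depend on `M`. -/
theorem exists_cocycle {d : ℕ} {N : ComplexPhaseMatrix d} (hN : IsKrein N) :
    ∃ (Z : ComplexPhaseMatrix d) (c : ℂ), IsStrictContraction Z ∧ c ≠ 0 ∧
      ∀ M, pencilDet (M * N) 0 = c * pencilDet M Z := by
  simpa only [pencilDet, mul_zero, add_zero] using
    exists_strictContraction_cocycle (projPlus_mul_self d) (projMinus_mul_self d)
      (projPlus_mul_projMinus d) (projMinus_mul_projPlus d) (projPlus_conjTranspose d)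
      (projMinus_conjTranspose d) (projPlus_add_projMinus d) hN

/-! ### The rotations exp(xJ). -/

/-- `cos x + sin x J`. -/
def rot (d : ℕ) (x : ℝ) : PhaseMatrix d := Real.cos x • 1 + Real.sin x • stdJ d

theorem rot_mul {d : ℕ} (x y : ℝ) : rot d x * rot d y = rot d (x + y) := by
  simp only [rot, mul_add, add_mul, smul_mul_smul, mul_one, one_mul, Matrix.J_squared,
    Real.cos_add, Real.sin_add]
  module

theorem rot_zero {d : ℕ} : rot d 0 = 1 := by simp [rot]

theorem rot_transpose {d : ℕ} (x : ℝ) : (rot d x)ᵀ = rot d (-x) := by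
  simp [rot, Matrix.J_transpose]

theorem rot_mul_J {d : ℕ} (x : ℝ) : rot d x * stdJ d = stdJ d * rot d x := by
  simp only [rot, mul_add, add_mul, smul_mul_assoc, mul_smul_comm, one_mul, mul_one]

theorem rot_mem {d : ℕ} (x : ℝ) : rot d x ∈ Matrix.symplecticGroup (Fin d) ℝ := by
  rw [SymplecticGroup.mem_iff', rot_transpose, rot_mul_J, mul_assoc, rot_mul]
  simp [rot_zero]

theorem hasDerivAt_rot {d : ℕ} (x : ℝ) : HasDerivAt (rot d) (stdJ d * rot d x) x := by
  have := ((Real.hasDerivAt_cos x).smul_const (1 : PhaseMatrix d)).add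
    ((Real.hasDerivAt_sin x).smul_const (stdJ d))
  refine HasDerivAt.congr_deriv this ?_
  simp only [rot, mul_add, mul_smul_comm, mul_one, Matrix.J_squared]
  module

theorem contDiff_rot {d : ℕ} : ContDiff ℝ 1 (rot d) :=
  (Real.contDiff_cos.smul contDiff_const).add (Real.contDiff_sin.smul contDiff_const)

theorem exp_smul_J {d : ℕ} (x : ℝ) : NormedSpace.exp (x • stdJ d) = rot d x := by
  have h : ∀ x : ℝ, HasDerivAt (fun x : ℝ => NormedSpace.exp (x • stdJ d) * rot d (-x)) 0 x := by
    intro x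
    have h1 := (hasDerivAt_exp_smul_const (𝕂 := ℝ) (stdJ d) x)
    have h2 := (hasDerivAt_rot (d := d) (-x)).scomp x (hasDerivAt_neg x)
    refine HasDerivAt.congr_deriv (h1.mul h2) ?_
    simp [mul_assoc]
  have h' := is_const_of_deriv_eq_zero (fun x => (h x).differentiableAt) (fun x => (h x).deriv) x 0
  simp only [zero_smul, NormedSpace.exp_zero, neg_zero, rot_zero, mul_one] at h'
  calc _ = NormedSpace.exp (x • stdJ d) * rot d (-x) * rot d x := by
        rw [mul_assoc, rot_mul, neg_add_cancel, rot_zero, mul_one]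
    _ = _ := by rw [h', one_mul]

theorem complexify_rot_mul_projPlus {d : ℕ} (x : ℝ) :
    complexify (rot d x) * projPlus d =
      ((Real.cos x : ℂ) - Real.sin x * Complex.I) • projPlus d := by
  simp only [rot, map_add, complexify_smul, map_one, add_mul, smul_mul_assoc, one_mul,
    J_mul_projPlus]
  module

/-- R = `rot d x` acts as the scalar exp(-ix) on the range of P, so RMQ - P = R(MQ - P)(Q +
exp(ix)P). Left multiplication by R contributes a factor independent of `M`, which the case `M = 1`
identifies. -/
theorem rotationDet_rot_mul {d : ℕ} (x : ℝ) (M : PhaseMatrix d) :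
    rotationDet (1 : PhaseMatrix d) * rotationDet (rot d x * M) = rotationDet (rot d x) * rotationDet M := by
  have key : ∀ M : PhaseMatrix d, rotationDet (rot d x * M) = (complexify (rot d x)).det *
      (projMinus d + ((Real.cos (-x) : ℂ) - Real.sin (-x) * Complex.I) • projPlus d).det *
      rotationDet M := by
    intro M
    rw [rotationDet, rotationDet, pencilDet, pencilDet, mul_zero, mul_zero, add_zero, add_zero,
      mul_assoc, mul_comm (Matrix.det (projMinus d + _)), ← Matrix.det_mul, ← Matrix.det_mul]
    congr 1
    have h1 : (complexify M * projMinus d - projPlus d) *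
        (projMinus d + ((Real.cos (-x) : ℂ) - Real.sin (-x) * Complex.I) • projPlus d) =
        complexify M * projMinus d - complexify (rot d (-x)) * projPlus d := by
      rw [complexify_rot_mul_projPlus]
      simp only [mul_add, sub_mul, mul_assoc, projMinus_mul_self, projPlus_mul_projMinus,
        mul_smul_comm, projMinus_mul_projPlus, projPlus_mul_self, mul_zero, zero_sub,
        smul_neg, sub_zero]
      abel
    rw [h1, mul_sub, ← mul_assoc, ← mul_assoc, ← map_mul, ← map_mul, rot_mul, add_neg_cancel,
      rot_zero, map_one, one_mul]
  have h1 := key 1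
  rw [mul_one] at h1
  rw [key M, h1]; ring

/-! ### The turn of the pencil determinant around a regular crossing. -/

/-- Simultaneous diagonalization of the Euclidean form and of a form that is symmetric on a
subspace. -/
theorem exists_orthonormal_diagonalization {n : Type*} [Fintype n] [DecidableEq n]
    (V : Submodule ℝ (n → ℝ)) (S : Matrix n n ℝ)
    (hS : ∀ v ∈ V, ∀ w ∈ V, v ⬝ᵥ (S *ᵥ w) = w ⬝ᵥ (S *ᵥ v)) :
    ∃ (m : ℕ) (W : Matrix n (Fin m) ℝ) (a : Fin m → ℝ), Wᵀ * W = 1 ∧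
      Wᵀ * S * W = Matrix.diagonal a ∧ (∀ x, W *ᵥ x ∈ V) ∧ ∀ v ∈ V, W *ᵥ (Wᵀ *ᵥ v) = v := by
  let V' : Submodule ℝ (EuclideanSpace ℝ n) := V.comap (WithLp.linearEquiv 2 ℝ (n → ℝ)).toLinearMap
  let b := stdOrthonormalBasis ℝ V'
  let W0 : Matrix n (Fin (Module.finrank ℝ V')) ℝ := fun i j => (b j : EuclideanSpace ℝ n) i
  have hcol : ∀ j, W0.col j ∈ V := fun j => (b j).2
  have hW0 : W0ᵀ * W0 = 1 := by
    ext i j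
    have h1 := orthonormal_iff_ite.1 b.orthonormal i j
    rw [Matrix.mul_apply, Matrix.one_apply, ← h1, Submodule.coe_inner,
      EuclideanSpace.inner_eq_star_dotProduct]
    simp only [dotProduct, W0, star_trivial]
    exact Finset.sum_congr rfl fun k _ => mul_comm _ _
  have hmem0 : ∀ x, W0 *ᵥ x ∈ V := by
    intro x
    rw [Matrix.mulVec_eq_sum]
    exact V.sum_mem fun j _ => by
      rw [op_smul_eq_smul]
      exact V.smul_mem _ (hcol j)
  have hrep0 : ∀ v ∈ V, W0 *ᵥ (W0ᵀ *ᵥ v) = v := by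
    intro v hv
    let v' : V' := ⟨WithLp.toLp 2 v, hv⟩
    have h1 := congrArg (fun w : V' => WithLp.ofLp (w : EuclideanSpace ℝ n)) (b.sum_repr' v')
    rw [Matrix.mulVec_eq_sum]
    simp only [Submodule.coe_sum, Submodule.coe_smul, WithLp.ofLp_sum, WithLp.ofLp_smul] at h1
    rw [show v = WithLp.ofLp (v' : EuclideanSpace ℝ n) from rfl, ← h1]
    refine Finset.sum_congr rfl fun j _ => ?_
    rw [h1]
    have h2 : (W0ᵀ *ᵥ (WithLp.ofLp (v' : EuclideanSpace ℝ n))) j = inner ℝ (b j) v' := by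
      rw [Submodule.coe_inner, EuclideanSpace.inner_eq_star_dotProduct, star_trivial,
        dotProduct_comm]
      rfl
    rw [h2, op_smul_eq_smul]
    rfl
  have hA : (W0ᵀ * S * W0).IsHermitian := by
    ext i j
    have h1 : ∀ i j, (W0ᵀ * S * W0) i j = W0.col i ⬝ᵥ (S *ᵥ W0.col j) := by
      intro i j
      rw [Matrix.mul_assoc, Matrix.mul_apply]
      rfl
    rw [Matrix.conjTranspose_apply, star_trivial, h1, h1]
    exact hS _ (hcol j) _ (hcol i)
  let U : Matrix (Fin (Module.finrank ℝ V')) (Fin (Module.finrank ℝ V')) ℝ :=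
    (hA.eigenvectorUnitary : Matrix _ _ ℝ)
  have hU1 : Uᵀ * U = 1 := Unitary.star_mul_self_of_mem hA.eigenvectorUnitary.2
  have hU2 : U * Uᵀ = 1 := Unitary.mul_star_self_of_mem hA.eigenvectorUnitary.2
  have hsp : W0ᵀ * S * W0 = U * Matrix.diagonal hA.eigenvalues * Uᵀ := by
    have := hA.spectral_theorem
    rw [Unitary.conjStarAlgAut_apply] at this
    exact this
  refine ⟨_, W0 * U, hA.eigenvalues, ?_, ?_, ?_, ?_⟩
  · rw [Matrix.transpose_mul, Matrix.mul_assoc, ← Matrix.mul_assoc W0ᵀ, hW0, Matrix.one_mul, hU1]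
  · calc (W0 * U)ᵀ * S * (W0 * U) = Uᵀ * (W0ᵀ * S * W0) * U := by
          simp only [Matrix.transpose_mul, Matrix.mul_assoc]
      _ = (Uᵀ * U) * Matrix.diagonal hA.eigenvalues * (Uᵀ * U) := by
          refine (congrArg (fun X => Uᵀ * X * U) hsp).trans ?_
          simp only [Matrix.mul_assoc]
      _ = _ := by rw [hU1, Matrix.one_mul, Matrix.mul_one]
  · intro x
    rw [← Matrix.mulVec_mulVec]
    exact hmem0 _
  · intro v hv
    rw [Matrix.transpose_mul, Matrix.mulVec_mulVec, Matrix.mul_assoc, ← Matrix.mul_assoc U, hU2,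
      Matrix.one_mul, ← Matrix.mulVec_mulVec, hrep0 v hv]

theorem toQuadraticForm'_apply {n : Type*} [Fintype n] [DecidableEq n] (S : Matrix n n ℝ)
    (v : n → ℝ) : S.toQuadraticForm' v = v ⬝ᵥ (S *ᵥ v) := by
  rw [Matrix.toQuadraticForm', LinearMap.BilinMap.toQuadraticMap_apply,
    Matrix.toLinearMap₂'_apply']

theorem dotProduct_mulVec_of_diagonal {n : Type*} [Fintype n] {S : Matrix n n ℝ} {m : ℕ}
    {W : Matrix n (Fin m) ℝ} {a : Fin m → ℝ} (hWS : Wᵀ * S * W = Matrix.diagonal a) (x : Fin m → ℝ) :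
    (W *ᵥ x) ⬝ᵥ (S *ᵥ (W *ᵥ x)) = ∑ i, a i * (x i * x i) := by
  have h1 : (W *ᵥ x) ⬝ᵥ (S *ᵥ (W *ᵥ x)) = x ⬝ᵥ ((Wᵀ * S * W) *ᵥ x) := by
    rw [← Matrix.mulVec_mulVec, ← Matrix.mulVec_mulVec, Matrix.dotProduct_mulVec x Wᵀ,
      Matrix.vecMul_transpose]
  rw [h1, hWS, dotProduct]
  refine Finset.sum_congr rfl fun i _ => ?_
  rw [Matrix.mulVec_diagonal]; ring

section diagonalized
variable {n : Type*} [Fintype n] [DecidableEq n] {V : Submodule ℝ (n → ℝ)} {S : Matrix n n ℝ}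
  {m : ℕ} {W : Matrix n (Fin m) ℝ} {a : Fin m → ℝ}

theorem quadSignature_restrict (hW : Wᵀ * W = 1) (hWS : Wᵀ * S * W = Matrix.diagonal a)
    (hmem : ∀ x, W *ᵥ x ∈ V) (hrep : ∀ v ∈ V, W *ᵥ (Wᵀ *ᵥ v) = v) :
    quadSignature (S.toQuadraticForm'.restrict V) = ∑ i, (SignType.sign (a i) : ℤ) := by
  have heq : (S.toQuadraticForm'.restrict V).Equivalent (QuadraticMap.weightedSumSquares ℝ a) := by
    refine ⟨⟨LinearEquiv.ofLinearMap ((Matrix.toLin' Wᵀ).comp V.subtype)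
      ((Matrix.toLin' W).codRestrict V hmem) ?_ ?_, ?_⟩⟩
    · refine LinearMap.ext fun x => ?_
      change Wᵀ *ᵥ (W *ᵥ x) = x
      rw [Matrix.mulVec_mulVec, hW, Matrix.one_mulVec]
    · refine LinearMap.ext fun x => Subtype.ext ?_
      exact hrep x x.2
    · intro v
      rw [QuadraticMap.weightedSumSquares_apply, QuadraticMap.restrict_apply,
        toQuadraticForm'_apply]
      simp only [smul_eq_mul]
      rw [← dotProduct_mulVec_of_diagonal hWS]
      change (W *ᵥ (Wᵀ *ᵥ (v : n → ℝ))) ⬝ᵥ (S *ᵥ (W *ᵥ (Wᵀ *ᵥ (v : n → ℝ)))) = _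
      rw [hrep _ v.2]
  rw [quadSignature, QuadraticForm.sigPos_of_equiv_weightedSumSquares heq,
    QuadraticForm.sigNeg_of_equiv_weightedSumSquares heq, Set.ncard_eq_toFinset_card',
    Set.ncard_eq_toFinset_card', Finset.card_eq_sum_ones, Finset.card_eq_sum_ones]
  simp only [Set.toFinset_ofPred, Finset.sum_filter]
  push_cast
  rw [← Finset.sum_sub_distrib]
  refine Finset.sum_congr rfl fun i _ => ?_
  rcases lt_trichotomy (a i) 0 with h | h | h
  · simp [h, h.not_gt]
  · simp [h]
  · simp [h, h.not_gt]

theorem diagonal_ne_zero_of_separatingLeft (hW : Wᵀ * W = 1)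
    (hWS : Wᵀ * S * W = Matrix.diagonal a)
    (hmem : ∀ x, W *ᵥ x ∈ V) (hrep : ∀ v ∈ V, W *ᵥ (Wᵀ *ᵥ v) = v)
    (hreg : (QuadraticMap.associated (R := ℝ) (S.toQuadraticForm'.restrict V)).SeparatingLeft)
    (i : Fin m) : a i ≠ 0 := by
  intro hi
  let v : V := ⟨W *ᵥ Pi.single i 1, hmem _⟩
  have hv : v = 0 := by
    refine hreg v fun w => ?_
    obtain ⟨x, hx⟩ : ∃ x, (w : n → ℝ) = W *ᵥ x := ⟨_, (hrep w w.2).symm⟩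
    rw [QuadraticMap.associated_apply]
    have : (S.toQuadraticForm'.restrict V) (v + w) - (S.toQuadraticForm'.restrict V) v -
        (S.toQuadraticForm'.restrict V) w = 0 := by
      simp only [QuadraticMap.restrict_apply, toQuadraticForm'_apply, Submodule.coe_add, hx, v,
        ← Matrix.mulVec_add]
      simp only [dotProduct_mulVec_of_diagonal hWS, ← Finset.sum_sub_distrib]
      refine Finset.sum_eq_zero fun j _ => ?_
      by_cases hj : j = i
      · subst hj; simp [hi]
      · simp [hj]
    rw [this, smul_zero]
  have h1 : W *ᵥ Pi.single i 1 = 0 := congrArg Subtype.val hv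
  have h2 : Wᵀ *ᵥ (W *ᵥ Pi.single i 1) = Pi.single i 1 := by
    rw [Matrix.mulVec_mulVec, hW, Matrix.one_mulVec]
  rw [h1, Matrix.mulVec_zero] at h2
  have := congrFun h2 i
  simp at this

end diagonalized

theorem HasDerivAt.matrixTranspose {n : Type*} [Fintype n] [DecidableEq n] {β : ℝ → Matrix n n ℝ}
    {β' : Matrix n n ℝ} {t : ℝ} (h : HasDerivAt β β' t) :
    HasDerivAt (fun t => (β t)ᵀ) β'ᵀ t :=
  (LinearMap.toContinuousLinearMap
    (Matrix.transposeLinearEquiv n n ℝ ℝ).toLinearMap).hasFDerivAt.comp_hasDerivAt t h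

/-- The crossing form matrix `-J M'` is symmetric on `ker (M - 1)`. -/
theorem crossing_symmetric {d : ℕ} {β : ℝ → PhaseMatrix d} {β' : PhaseMatrix d} {t : ℝ}
    (hβ : HasDerivAt β β' t) (hs : ∀ᶠ u in 𝓝 t, β u ∈ Matrix.symplecticGroup (Fin d) ℝ)
    {v w : Fin d ⊕ Fin d → ℝ} (hv : β t *ᵥ v = v) (hw : β t *ᵥ w = w) :
    v ⬝ᵥ (-(stdJ d * β') *ᵥ w) = w ⬝ᵥ (-(stdJ d * β') *ᵥ v) := by
  -- The symmetry comes from differentiating βᵀJβ = J; tested on vectors fixed by `β t`, the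
  -- undifferentiated factors drop out.
  have h1 := (hβ.matrixTranspose.mul (hasDerivAt_const t (stdJ d))).mul hβ
  have h2 : HasDerivAt (fun u => (β u)ᵀ * stdJ d * β u) 0 t :=
    (hasDerivAt_const t (stdJ d)).congr_of_eventuallyEq
      (hs.mono fun u hu => SymplecticGroup.mem_iff'.1 hu)
  have h3 := h1.unique h2
  rw [mul_zero, add_zero] at h3
  change β'ᵀ * stdJ d * β t + (β t)ᵀ * stdJ d * β' = 0 at h3
  have h4 := congrArg (fun A => v ⬝ᵥ (A *ᵥ w)) h3
  simp only [Matrix.add_mulVec, dotProduct_add, Matrix.zero_mulVec, dotProduct_zero] at h4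
  rw [← Matrix.mulVec_mulVec, hw, mul_assoc, ← Matrix.mulVec_mulVec (v := w) (M := (β t)ᵀ),
    Matrix.dotProduct_mulVec v (β t)ᵀ, Matrix.vecMul_transpose, hv, ← Matrix.mulVec_mulVec,
    Matrix.dotProduct_mulVec v β'ᵀ, Matrix.vecMul_transpose, Matrix.dotProduct_mulVec,
    ← Matrix.mulVec_transpose, Matrix.J_transpose, Matrix.neg_mulVec, neg_dotProduct,
    Matrix.mulVec_mulVec, dotProduct_comm _ w] at h4
  rw [Matrix.neg_mulVec, Matrix.neg_mulVec, dotProduct_neg, dotProduct_neg]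
  linarith

/-- Once the matrix is written as 1 + (XW - W)Wᵀ, the identity det(1 + AB) = det(1 + BA) reduces it
to the small block. -/
theorem det_compression {n m R : Type*} [Fintype n] [DecidableEq n] [Fintype m] [DecidableEq m]
    [CommRing R] {W : Matrix n m R} (hW : Wᵀ * W = 1) (X : Matrix n n R) :
    (1 - W * Wᵀ + X * (W * Wᵀ)).det = (Wᵀ * X * W).det := by
  have h1 : 1 - W * Wᵀ + X * (W * Wᵀ) = 1 + (X * W - W) * Wᵀ := by
    rw [Matrix.sub_mul, Matrix.mul_assoc]; abel
  rw [h1, Matrix.det_one_add_mul_comm]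
  congr 1
  rw [Matrix.mul_sub, hW, Matrix.mul_assoc]
  abel

/-- Factorization of the singular matrix `M - 1` through the projection off its kernel. -/
theorem exists_kernel_factorization {d m : ℕ} {M : PhaseMatrix d}
    (hM : M ∈ Matrix.symplecticGroup (Fin d) ℝ) {W : Matrix (Fin d ⊕ Fin d) (Fin m) ℝ}
    (hW : Wᵀ * W = 1) (hMW : M * W = W) (hrep : ∀ v, M *ᵥ v = v → W *ᵥ (Wᵀ *ᵥ v) = v) :
    ∃ T : PhaseMatrix d, T.det ≠ 0 ∧ T * (1 - W * Wᵀ) = M - 1 ∧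
      Wᵀ * T⁻¹ = -(Wᵀ * stdJ d) ∧ Wᵀ * stdJ d * M = Wᵀ * stdJ d := by
  have hleft : Wᵀ * stdJ d * M = Wᵀ * stdJ d := by
    have h1 : Mᵀ * (stdJ d * W) = stdJ d * W := by
      have h0 := congrArg (fun A => A * W) (SymplecticGroup.mem_iff'.1 hM)
      simpa only [Matrix.mul_assoc, hMW] using h0
    have h2 := congrArg Matrix.transpose h1
    rw [Matrix.transpose_mul, Matrix.transpose_transpose, Matrix.transpose_mul,
      Matrix.J_transpose] at h2
    simpa using h2
  -- The columns of `W` span ker(M - 1), and `J` maps this kernel onto the orthogonal complement of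
  -- the range of M - 1; the added term repairs the rank.
  obtain ⟨T, hTdef⟩ : ∃ T, T = M - 1 + stdJ d * (W * Wᵀ) := ⟨_, rfl⟩
  have hWJT : -(Wᵀ * stdJ d) * T = Wᵀ := by
    rw [hTdef, Matrix.mul_add, Matrix.mul_sub, Matrix.neg_mul, hleft, Matrix.mul_one, sub_self, zero_add,
      Matrix.neg_mul, Matrix.mul_assoc, ← Matrix.mul_assoc (stdJ d), Matrix.J_squared,
      Matrix.neg_mul, Matrix.mul_neg, neg_neg, Matrix.one_mul, ← Matrix.mul_assoc, hW,
      Matrix.one_mul]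
  have hdet : T.det ≠ 0 := by
    intro h0
    obtain ⟨v, hv, e⟩ := Matrix.exists_mulVec_eq_zero_iff.2 h0
    have h1 : Wᵀ *ᵥ v = 0 := by
      rw [← hWJT, ← Matrix.mulVec_mulVec, e, Matrix.mulVec_zero]
    rw [hTdef, Matrix.add_mulVec, ← Matrix.mulVec_mulVec, ← Matrix.mulVec_mulVec, h1, Matrix.mulVec_zero,
      Matrix.mulVec_zero, add_zero, Matrix.sub_mulVec, Matrix.one_mulVec, sub_eq_zero] at e
    have := hrep v e
    rw [h1, Matrix.mulVec_zero] at this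
    exact hv this.symm
  refine ⟨T, hdet, ?_, ?_, hleft⟩
  · have h1 : W * Wᵀ * (W * Wᵀ) = W * Wᵀ := by
      rw [Matrix.mul_assoc, ← Matrix.mul_assoc Wᵀ, hW, Matrix.one_mul]
    have h2 : M * (W * Wᵀ) = W * Wᵀ := by rw [← Matrix.mul_assoc, hMW]
    rw [hTdef, Matrix.add_mul, Matrix.mul_sub (stdJ d * _), Matrix.mul_one, Matrix.mul_assoc, h1, sub_self,
      add_zero, Matrix.mul_sub, Matrix.mul_one, Matrix.sub_mul, h2, Matrix.one_mul, sub_self,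
      sub_zero]
  · have h1 := Matrix.mul_nonsing_inv_cancel_right T (-(Wᵀ * stdJ d)) (isUnit_iff_ne_zero.2 hdet)
    rwa [hWJT] at h1

theorem ContinuousOn.complexMatrixMul {d : ℕ} {X : Type*} [TopologicalSpace X] {s : Set X}
    {f g : X → ComplexPhaseMatrix d} (hf : ContinuousOn f s) (hg : ContinuousOn g s) :
    ContinuousOn (fun x => f x * g x) s :=
  (Continuous.matrix_mul continuous_fst continuous_snd).comp_continuousOn (hf.prodMk hg)

theorem ContinuousOn.pencilDet {d : ℕ} {X : Type*} [TopologicalSpace X] {s : Set X}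
    {f g : X → ComplexPhaseMatrix d} (hf : ContinuousOn f s) (hg : ContinuousOn g s) :
    ContinuousOn (fun x => _root_.pencilDet (f x) (g x)) s := by
  have hdet : Continuous (Matrix.det : ComplexPhaseMatrix d → ℂ) :=
    Continuous.matrix_det continuous_id
  exact hdet.comp_continuousOn (((hf.complexMatrixMul continuousOn_const).sub
    continuousOn_const).add (((hf.complexMatrixMul continuousOn_const).sub
      continuousOn_const).complexMatrixMul hg))

/-- The pencil determinant on the half circle of radius `r` around a crossing at time `t`. -/
def halfCircleDet {d : ℕ} (β : ℝ → PhaseMatrix d) (t r φ : ℝ) : ℂ :=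
  pencilDet (complexify (β (t - r * Real.cos φ))) (((1 - r * Real.sin φ : ℝ) : ℂ) • 1)

/-- At a crossing with m-dimensional kernel the determinant vanishes like r^m; dividing by r^m
leaves a function `g` continuous up to r = 0. If E projects onto the kernel, the pencil is T(1 - E +
re), and 1 - E + re = G(1 - E + rE) with det(1 - E + rE) = r^m. At r = 0 only the kernel block of e
remains; in a basis diagonalizing the crossing form each of its entries runs through half an ellipse
about 0. -/
theorem exists_halfCircleDet_factorization {d : ℕ} {β : ℝ → PhaseMatrix d} {β' : PhaseMatrix d}
    {t δ : ℝ} (hδ : 0 < δ) (hc : ContinuousOn β (Icc (t - δ) (t + δ)))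
    (hs : ∀ u ∈ Icc (t - δ) (t + δ), β u ∈ Matrix.symplecticGroup (Fin d) ℝ)
    (hβ : HasDerivAt β β' t)
    (hreg : (QuadraticMap.associated (R := ℝ) (crossingForm (β t) β')).SeparatingLeft) :
    ∃ (m : ℕ) (a : Fin m → ℝ) (κ : ℝ) (g : ℝ → ℝ → ℂ), κ ≠ 0 ∧ (∀ i, a i ≠ 0) ∧
      quadSignature (crossingForm (β t) β') = ∑ i, (SignType.sign (a i) : ℤ) ∧
      ContinuousOn (Function.uncurry g) (Icc 0 δ ×ˢ univ) ∧
      (∀ r φ, halfCircleDet β t r φ = κ * g r φ * (r : ℂ) ^ m) ∧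
      ∀ φ, g 0 φ = ∏ i, -(a i * Real.cos φ + Real.sin φ * Complex.I : ℂ) := by
  have hnhds : Icc (t - δ) (t + δ) ∈ 𝓝 t := Icc_mem_nhds (by linarith) (by linarith)
  have hker : ∀ v, v ∈ LinearMap.ker (Matrix.toLin' (β t - 1)) ↔ β t *ᵥ v = v := fun v => by
    rw [LinearMap.mem_ker, Matrix.toLin'_apply, Matrix.sub_mulVec, Matrix.one_mulVec, sub_eq_zero]
  obtain ⟨m, W, a, hW, hWS, hmem, hrep⟩ := exists_orthonormal_diagonalization
    (LinearMap.ker (Matrix.toLin' (β t - 1))) (-(stdJ d * β')) fun v hv w hw =>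
      crossing_symmetric hβ (Filter.mem_of_superset hnhds hs) ((hker v).1 hv) ((hker w).1 hw)
  have hMt := hs t ⟨by linarith, by linarith⟩
  have hMW : β t * W = W := by
    ext i j
    have h1 := (hker _).1 (hmem (Pi.single j 1))
    have h2 := congrFun h1 i
    rw [Matrix.mulVec_mulVec] at h2
    simpa using h2
  obtain ⟨T, hT, hTf, hWT, hWJ⟩ := exists_kernel_factorization hMt hW hMW
    fun v hv => hrep v ((hker v).2 hv)
  let Wc : Matrix (Fin d ⊕ Fin d) (Fin m) ℂ := W.map Complex.ofRealHom
  have hWc : Wcᵀ * Wc = 1 := by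
    rw [← Matrix.transpose_map, ← Matrix.map_mul, hW]
    exact Matrix.map_one _ (map_zero _) (map_one _)
  have hE : complexify (W * Wᵀ) = Wc * Wcᵀ := by
    rw [← Matrix.transpose_map]; exact Matrix.map_mul
  let E : ComplexPhaseMatrix d := Wc * Wcᵀ
  have hEE : E * E = E := by
    change Wc * Wcᵀ * (Wc * Wcᵀ) = Wc * Wcᵀ
    rw [Matrix.mul_assoc, ← Matrix.mul_assoc Wcᵀ, hWc, Matrix.one_mul]
  let M : ℝ → ℝ → ComplexPhaseMatrix d := fun r φ => complexify (β (t - r * Real.cos φ))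
  -- This is (pencil - (β t - 1)) / r. Using `dslope` makes it continuous up to r = 0, although `β`
  -- is only known to be differentiable at `t`.
  let e0 : ℝ → ℝ → ComplexPhaseMatrix d := fun r φ =>
    (-Real.cos φ : ℂ) • complexify (dslope β t (t - r * Real.cos φ)) -
      (Real.sin φ : ℂ) • (M r φ * projPlus d - projMinus d)
  let e : ℝ → ℝ → ComplexPhaseMatrix d := fun r φ => complexify T⁻¹ * e0 r φ
  let G : ℝ → ℝ → ComplexPhaseMatrix d := fun r φ =>
    1 - E + (r : ℂ) • (e r φ * (1 - E)) + e r φ * E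
  refine ⟨m, a, T.det, fun r φ => (G r φ).det, hT,
    diagonal_ne_zero_of_separatingLeft hW hWS hmem hrep hreg,
    quadSignature_restrict hW hWS hmem hrep, ?_, ?_, ?_⟩
  · have hmap : MapsTo (fun p : ℝ × ℝ => t - p.1 * Real.cos p.2) (Icc 0 δ ×ˢ univ)
        (Icc (t - δ) (t + δ)) := by
      rintro ⟨r, φ⟩ ⟨hr, -⟩
      have := abs_le.1 (Real.abs_cos_le_one φ)
      simp only at hr
      constructor <;> dsimp only <;> nlinarith [hr.1, hr.2]
    have h1 : ContinuousOn (fun p : ℝ × ℝ => M p.1 p.2) (Icc 0 δ ×ˢ univ) :=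
      continuous_complexify.comp_continuousOn (hc.comp (by fun_prop) hmap)
    have h2 : ContinuousOn (fun p : ℝ × ℝ => complexify (dslope β t (t - p.1 * Real.cos p.2)))
        (Icc 0 δ ×ˢ univ) :=
      continuous_complexify.comp_continuousOn
        (((continuousOn_dslope hnhds).2 ⟨hc, hβ.differentiableAt⟩).comp (by fun_prop) hmap)
    have hcos : ContinuousOn (fun p : ℝ × ℝ => (-Real.cos p.2 : ℂ)) (Icc 0 δ ×ˢ univ) := by fun_prop
    have hsin : ContinuousOn (fun p : ℝ × ℝ => (Real.sin p.2 : ℂ)) (Icc 0 δ ×ˢ univ) := by fun_prop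
    have hr : ContinuousOn (fun p : ℝ × ℝ => (p.1 : ℂ)) (Icc 0 δ ×ˢ univ) := by fun_prop
    have h3 : ContinuousOn (fun p : ℝ × ℝ => e p.1 p.2) (Icc 0 δ ×ˢ univ) :=
      continuousOn_const.complexMatrixMul ((hcos.smul h2).sub
        (hsin.smul ((h1.complexMatrixMul continuousOn_const).sub continuousOn_const)))
    have h4 : ContinuousOn (fun p : ℝ × ℝ => G p.1 p.2) (Icc 0 δ ×ˢ univ) :=
      (continuousOn_const.add (hr.smul (h3.complexMatrixMul continuousOn_const))).add
        (h3.complexMatrixMul continuousOn_const)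
    have hdet : Continuous (Matrix.det : ComplexPhaseMatrix d → ℂ) :=
      Continuous.matrix_det continuous_id
    exact hdet.comp_continuousOn h4
  · intro r φ
    have hTT : complexify T * complexify T⁻¹ = 1 := by
      rw [← map_mul, Matrix.mul_nonsing_inv _ (isUnit_iff_ne_zero.2 hT), map_one]
    have hslope : M r φ = complexify (β t) +
        (-(r * Real.cos φ) : ℂ) • complexify (dslope β t (t - r * Real.cos φ)) := by
      have h1 := sub_smul_dslope β t (t - r * Real.cos φ)
      rw [show t - r * Real.cos φ - t = -(r * Real.cos φ) by ring] at h1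
      have h2 := congrArg complexify h1
      rw [complexify_smul, map_sub] at h2
      simp only [Complex.ofReal_neg, Complex.ofReal_mul] at h2
      rw [h2]
      simp [M]
    have hfac : M r φ * projMinus d - projPlus d + (M r φ * projPlus d - projMinus d) *
        (((1 - r * Real.sin φ : ℝ) : ℂ) • 1) =
        complexify T * (G r φ * (1 - E + (r : ℂ) • E)) := by
      have hG : G r φ * (1 - E + (r : ℂ) • E) = 1 - E + (r : ℂ) • e r φ := by
        simp only [G, mul_add, add_mul, mul_sub, sub_mul, mul_one, one_mul, smul_mul_assoc,
          mul_smul_comm, smul_sub, mul_assoc, hEE]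
        abel_nf
      have hTc : complexify T * (1 - E) = complexify (β t) - 1 := by
        change complexify T * (1 - Wc * Wcᵀ) = _
        rw [← map_one complexify, ← hE, ← map_sub, ← map_mul, hTf, map_sub]
      have hTe : complexify T * ((r : ℂ) • e r φ) = (r : ℂ) • e0 r φ := by
        simp only [e]
        rw [Matrix.mul_smul, ← mul_assoc, hTT, one_mul]
      rw [hG, mul_add, hTc, hTe, Matrix.mul_smul, mul_one]
      have h5 : M r φ * projMinus d - projPlus d = M r φ - 1 - (M r φ * projPlus d - projMinus d) := by
        have := projPlus_add_projMinus d
        rw [← this]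
        have h6 : M r φ = M r φ * projPlus d + M r φ * projMinus d := by
          rw [← mul_add, this, mul_one]
        nth_rewrite 2 [h6]
        abel
      rw [h5]
      simp only [e0]
      nth_rewrite 1 [hslope]
      push_cast
      simp only [smul_sub, smul_smul]
      module
    have hdet : (1 - E + (r : ℂ) • E).det = (r : ℂ) ^ m := by
      have h1 := det_compression hWc ((r : ℂ) • 1)
      rw [smul_mul_assoc, one_mul, Matrix.mul_smul, Matrix.mul_one, Matrix.smul_mul, hWc,
        Matrix.det_smul, Matrix.det_one, mul_one, Fintype.card_fin] at h1
      exact h1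
    rw [halfCircleDet, pencilDet]
    change (M r φ * projMinus d - projPlus d + (M r φ * projPlus d - projMinus d) *
        (((1 - r * Real.sin φ : ℝ) : ℂ) • 1)).det = _
    rw [hfac, Matrix.det_mul, Matrix.det_mul, hdet, det_complexify]
    ring
  · intro φ
    have hWTc : Wcᵀ * complexify T⁻¹ = -(Wcᵀ * complexify (stdJ d)) := by
      have := congrArg (fun A => A.map Complex.ofRealHom) hWT
      simp only [Matrix.map_mul, Matrix.transpose_map] at this
      rw [Matrix.map_neg] at this
      · simp only [Matrix.map_mul, Matrix.transpose_map] at this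
        exact this
      · exact map_neg _
    have hWJc : Wcᵀ * complexify (stdJ d) * complexify (β t) = Wcᵀ * complexify (stdJ d) := by
      have := congrArg (fun A => A.map Complex.ofRealHom) hWJ
      simp only [Matrix.map_mul, Matrix.transpose_map] at this
      exact this
    have hWSc : Wcᵀ * (complexify (stdJ d) * complexify β') * Wc =
        -Matrix.diagonal fun i => (a i : ℂ) := by
      have := congrArg (fun A => A.map Complex.ofRealHom) hWS
      simp only [Matrix.mul_neg, Matrix.neg_mul] at this
      rw [Matrix.map_neg _ (map_neg _), Matrix.diagonal_map (map_zero _), neg_eq_iff_eq_neg] at this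
      simp only [Matrix.map_mul, Matrix.transpose_map] at this
      exact this
    have hG0 : G 0 φ = 1 - E + e 0 φ * E := by simp [G]
    have he : Wcᵀ * e 0 φ * Wc =
        Matrix.diagonal fun i => -(a i * Real.cos φ + Real.sin φ * Complex.I : ℂ) := by
      have h1 : Wcᵀ * e 0 φ * Wc = -(Wcᵀ * complexify (stdJ d) * e0 0 φ * Wc) := by
        simp only [e]
        rw [← Matrix.mul_assoc, hWTc, Matrix.neg_mul, Matrix.neg_mul]
      have h2 : e0 0 φ = (-Real.cos φ : ℂ) • complexify β' -
          (Real.sin φ : ℂ) • (complexify (β t) * projPlus d - projMinus d) := by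
        simp only [e0, M, zero_mul, sub_zero, dslope_same, hβ.deriv]
      have h3 : Wcᵀ * complexify (stdJ d) * (complexify (β t) * projPlus d - projMinus d) * Wc =
          (-Complex.I) • (1 : Matrix (Fin m) (Fin m) ℂ) := by
        rw [Matrix.mul_sub, ← Matrix.mul_assoc, hWJc, ← Matrix.mul_sub, projPlus_sub_projMinus,
          Matrix.mul_smul, Matrix.mul_assoc Wcᵀ, complexify_J_mul_self, Matrix.mul_neg,
          Matrix.mul_one, Matrix.smul_mul, Matrix.neg_mul, hWc]
        module
      rw [h1, h2, Matrix.mul_sub, Matrix.sub_mul, Matrix.mul_smul, Matrix.mul_smul, Matrix.smul_mul,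
        Matrix.smul_mul, h3, Matrix.mul_assoc Wcᵀ, hWSc]
      ext i j
      by_cases hij : i = j
      · subst hij; simp; ring
      · simp [hij]
    change (G 0 φ).det = _
    rw [hG0, det_compression hWc, he, Matrix.det_diagonal]

/-- The determinant is a polynomial in `z` of degree at most the size of the matrices. -/
theorem abs_argVar_det_le {n : Type*} [Fintype n] [DecidableEq n] (A B : Matrix n n ℂ)
    (h : ∀ z ∈ Icc (0 : ℝ) 1, (A + (z : ℂ) • B).det ≠ 0) :
    |argVar (fun z : ℝ => (A + (z : ℂ) • B).det) 0 1| ≤ Fintype.card n * Real.pi := by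
  set p : Polynomial ℂ :=
    ((Polynomial.X : Polynomial ℂ) • B.map Polynomial.C + A.map Polynomial.C).det with hp
  have hev : ∀ z : ℂ, p.eval z = (A + z • B).det := by
    intro z
    rw [hp, ← Polynomial.coe_evalRingHom, RingHom.map_det]
    congr 1
    ext i j
    simp
    ring
  simp_rw [← hev] at h ⊢
  refine (abs_argVar_polynomial_le p zero_le_one h).trans ?_
  gcongr
  exact Polynomial.natDegree_det_X_add_C_le B A

/-- The variation of the argument of the pencil determinant between the rotation determinant and
`det (M - 1)`. -/
def radialVar {d : ℕ} (M : PhaseMatrix d) : ℝ :=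
  argVar (fun z => pencilDet (complexify M) ((z : ℂ) • 1)) 0 1

theorem pencilDet_smul_one_ne_zero {d : ℕ} {M : PhaseMatrix d}
    (hM : M ∈ Matrix.symplecticGroup (Fin d) ℝ) {z : ℝ} (hz0 : 0 ≤ z) (hz1 : z ≤ 1)
    (h : z = 1 → (M - 1).det ≠ 0) : pencilDet (complexify M) ((z : ℂ) • 1) ≠ 0 := by
  rcases hz1.eq_or_lt with rfl | hz
  · rw [Complex.ofReal_one, one_smul, pencilDet_one]
    exact_mod_cast h rfl
  · exact pencilDet_ne_zero (isKrein_complexify hM) (isStrictContraction_smul_one hz0 hz)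

theorem abs_radialVar_le {d : ℕ} {M : PhaseMatrix d}
    (hM : M ∈ Matrix.symplecticGroup (Fin d) ℝ) (h : (M - 1).det ≠ 0) :
    |radialVar M| ≤ 2 * d * Real.pi := by
  have h1 := abs_argVar_det_le (complexify M * projMinus d - projPlus d)
    (complexify M * projPlus d - projMinus d) fun z hz => by
      have := pencilDet_smul_one_ne_zero hM hz.1 hz.2 fun _ => h
      rwa [pencilDet, Matrix.mul_smul, mul_one] at this
  simp only [Fintype.card_sum, Fintype.card_fin] at h1
  push_cast at h1
  rw [← two_mul] at h1
  simpa only [radialVar, pencilDet, Matrix.mul_smul, mul_one] using h1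

/-- The linear homotopy from `a` to its sign keeps the half ellipse off 0 and its endpoints on the
real axis, so only the half circle has to be computed. -/
theorem argVar_semicircle {a : ℝ} (ha : a ≠ 0) :
    argVar (fun φ => -(a * Real.cos φ + Real.sin φ * Complex.I : ℂ)) 0 Real.pi =
      Real.pi * (SignType.sign a : ℤ) := by
  have hσ : ∀ σ : ℝ, σ = 1 ∨ σ = -1 →
      argVar (fun φ => -(σ * Real.cos φ + Real.sin φ * Complex.I : ℂ)) 0 Real.pi =
        Real.pi * σ := by
    intro σ hσ
    rw [argVar_eq (θ := fun φ => Complex.log (-σ) + σ * φ * Complex.I) Real.pi_pos.le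
      (by fun_prop)]
    · simp; ring
    · intro φ _
      rw [Complex.exp_add, Complex.exp_log]
      · rcases hσ with rfl | rfl
        · have := Complex.exp_mul_I (φ : ℂ)
          push_cast
          rw [one_mul, this]; ring
        · have := Complex.exp_mul_I (-φ : ℂ)
          push_cast
          rw [neg_one_mul, this, Complex.cos_neg, Complex.sin_neg]; ring
      · rcases hσ with rfl | rfl <;> simp
  obtain ⟨σ, hσ', hs, hpos⟩ : ∃ σ : ℝ, (σ = 1 ∨ σ = -1) ∧ ((SignType.sign a : ℤ) : ℝ) = σ ∧
      0 < σ * a := by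
    rcases ha.lt_or_gt with h | h
    · exact ⟨-1, Or.inr rfl, by simp [h], by linarith⟩
    · exact ⟨1, Or.inl rfl, by simp [h], by linarith⟩
  have hne : ∀ s ∈ Icc (0 : ℝ) 1, (1 - s) * a + s * σ ≠ 0 := by
    intro s hs h0
    have h1 : (1 - s) * (σ * a) + s * (σ * σ) = 0 := by linear_combination σ * h0
    have h2 : σ * σ = 1 := by rcases hσ' with rfl | rfl <;> norm_num
    rw [h2] at h1
    rcases hs.1.eq_or_lt with rfl | h
    · simp at h1; rcases h1 with h1 | h1 <;> simp [h1] at hpos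
    · nlinarith [hs.2, mul_nonneg (sub_nonneg.2 hs.2) hpos.le]
  have key := argVar_rectangle (F := fun s φ : ℝ =>
    -((((1 - s) * a + s * σ : ℝ) : ℂ) * Real.cos φ + Real.sin φ * Complex.I : ℂ))
    zero_le_one Real.pi_pos.le (by unfold Function.uncurry; fun_prop) (by
      intro s hs φ hφ h0
      rw [neg_eq_zero] at h0
      have him := congrArg Complex.im h0
      have hre := congrArg Complex.re h0
      simp only [← Complex.ofReal_mul, Complex.add_im, Complex.add_re, Complex.ofReal_im,
        Complex.ofReal_re, Complex.mul_im, Complex.mul_re, Complex.I_re, Complex.I_im,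
        Complex.zero_im, Complex.zero_re] at him hre
      simp only [mul_zero, mul_one, zero_add, add_zero, sub_zero] at him hre
      rcases mul_eq_zero.1 hre with h | h
      · exact hne s hs h
      · have := Real.sin_sq_add_cos_sq φ
        rw [him, h] at this
        norm_num at this)
  have real : ∀ φ, Real.sin φ = 0 → Real.cos φ ≠ 0 → argVar (fun s : ℝ =>
      -((((1 - s) * a + s * σ : ℝ) : ℂ) * Real.cos φ + Real.sin φ * Complex.I : ℂ)) 0 1 = 0 := by
    intro φ h hc
    refine argVar_real zero_le_one ⟨by fun_prop, fun s hs h0 => ?_⟩ fun s _ => ?_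
    · beta_reduce at h0
      rw [h, Complex.ofReal_zero, zero_mul, add_zero, neg_eq_zero] at h0
      rcases mul_eq_zero.1 h0 with h1 | h1
      · exact hne s hs (by exact_mod_cast h1)
      · exact hc (by exact_mod_cast h1)
    · rw [h, ← Complex.ofReal_mul]; simp
  rw [real 0 (by simp) (by simp), real Real.pi (by simp) (by simp)] at key
  simp only [sub_zero, one_mul, zero_mul, add_zero, zero_add, sub_self] at key
  rw [← key, hσ σ hσ', hs]

theorem det_ofReal_im {d : ℕ} {β : ℝ → PhaseMatrix d} {t r φ : ℝ} (h : Real.sin φ = 0) :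
    halfCircleDet β t r φ = ((β (t - r * Real.cos φ) - 1).det : ℝ) := by
  rw [halfCircleDet, h, mul_zero, sub_zero, Complex.ofReal_one, one_smul, pencilDet_one]

/-- Near a regular crossing there is no other crossing, and the rotation of the path across it is
determined by the signature of the crossing form. -/
theorem crossing_local {d : ℕ} {β : ℝ → PhaseMatrix d} {β' : PhaseMatrix d}
    {t δ : ℝ} (hδ : 0 < δ) (hc : ContinuousOn β (Icc (t - δ) (t + δ)))
    (hs : ∀ u ∈ Icc (t - δ) (t + δ), β u ∈ Matrix.symplecticGroup (Fin d) ℝ)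
    (hβ : HasDerivAt β β' t)
    (hreg : (QuadraticMap.associated (R := ℝ) (crossingForm (β t) β')).SeparatingLeft) :
    ∃ r0 > 0, ∀ r, 0 < r → r ≤ r0 → (β (t - r) - 1).det ≠ 0 ∧ (β (t + r) - 1).det ≠ 0 ∧
      argVar (fun u => rotationDet (β u)) (t - r) (t + r) = radialVar (β (t - r)) -
        radialVar (β (t + r)) + Real.pi * quadSignature (crossingForm (β t) β') := by
  obtain ⟨m, a, κ, g, hκ, ha, hsig, hg, hF, hg0⟩ :=
    exists_halfCircleDet_factorization hδ hc hs hβ hreg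
  have hκ' : (κ : ℂ) ≠ 0 := by exact_mod_cast hκ
  have hg0ne : ∀ φ, g 0 φ ≠ 0 := by
    intro φ
    rw [hg0, Finset.prod_ne_zero_iff]
    intro i _ h0
    rw [neg_eq_zero] at h0
    have him := congrArg Complex.im h0
    have hre := congrArg Complex.re h0
    simp only [← Complex.ofReal_mul, Complex.add_im, Complex.add_re, Complex.ofReal_im,
      Complex.ofReal_re, Complex.mul_im, Complex.mul_re, Complex.I_re, Complex.I_im,
      Complex.zero_im, Complex.zero_re] at him hre
    simp only [mul_zero, mul_one, zero_add, add_zero, sub_zero] at him hre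
    rcases mul_eq_zero.1 hre with h | h
    · exact ha i h
    · have := Real.sin_sq_add_cos_sq φ
      rw [him, h] at this
      norm_num at this
  have hgφ : ∀ φ, ContinuousOn (fun r => g r φ) (Icc 0 δ) := fun φ =>
    hg.comp (f := fun r => (r, φ)) (by fun_prop) fun r hr => ⟨hr, mem_univ _⟩
  have hev : ∀ φ, ∀ᶠ r in 𝓝[≥] (0 : ℝ), g r φ ≠ 0 := fun φ =>
    (((hgφ φ) 0 (left_mem_Icc.2 hδ.le)).mono_left
      (nhdsWithin_le_of_mem (Icc_mem_nhdsGE hδ))).eventually_ne (hg0ne φ)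
  -- A small radius is needed only for the angles 0 and π, where Z = 1; at the angles between them Z
  -- is a strict contraction and the determinant cannot vanish.
  obtain ⟨r1, hr1, hr1'⟩ := mem_nhdsGE_iff_exists_Icc_subset.1
    (((hev 0).and (hev Real.pi)).and (Icc_mem_nhdsGE hδ))
  have hr1δ : r1 ≤ δ := (hr1' (right_mem_Icc.2 (le_of_lt hr1))).2.2
  have hends : ∀ φ, (φ = 0 ∨ φ = Real.pi) → ∀ r, 0 ≤ r → r ≤ r1 → g r φ ≠ 0 := by
    rintro φ (rfl | rfl) r h0 h1
    · exact (hr1' ⟨h0, h1⟩).1.1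
    · exact (hr1' ⟨h0, h1⟩).1.2
  have hF0 : ∀ φ, (φ = 0 ∨ φ = Real.pi) → ∀ r, 0 < r → r ≤ r1 → halfCircleDet β t r φ ≠ 0 := by
    intro φ hφ r h0 h1
    rw [hF]
    exact mul_ne_zero (mul_ne_zero hκ' (hends φ hφ r h0.le h1))
      (pow_ne_zero _ (by exact_mod_cast h0.ne'))
  have hm : ∀ r, 0 < r → r ≤ r1 → (β (t - r) - 1).det ≠ 0 := by
    intro r h0 h1
    have := hF0 0 (Or.inl rfl) r h0 h1
    rw [det_ofReal_im Real.sin_zero, Real.cos_zero, mul_one] at this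
    exact_mod_cast this
  have hp : ∀ r, 0 < r → r ≤ r1 → (β (t + r) - 1).det ≠ 0 := by
    intro r h0 h1
    have := hF0 Real.pi (Or.inr rfl) r h0 h1
    rw [det_ofReal_im Real.sin_pi, Real.cos_pi, mul_neg_one, sub_neg_eq_add] at this
    exact_mod_cast this
  -- The bound `r ≤ 1` keeps the scalar 1 - r sin φ nonnegative.
  refine ⟨min r1 1, lt_min hr1 one_pos, fun r h0 h1 => ?_⟩
  have h11 : r ≤ 1 := h1.trans (min_le_right _ _)
  replace h1 := h1.trans (min_le_left _ _)
  refine ⟨hm r h0 h1, hp r h0 h1, ?_⟩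
  have hmem : ∀ ρ φ, 0 ≤ ρ → ρ ≤ r → t - ρ * Real.cos φ ∈ Icc (t - δ) (t + δ) := by
    intro ρ φ hρ0 hρ1
    have := abs_le.1 (Real.abs_cos_le_one φ)
    constructor <;> nlinarith
  have hsin : ∀ φ ∈ Icc 0 Real.pi, φ = 0 ∨ φ = Real.pi ∨ 0 < Real.sin φ := by
    intro φ hφ
    rcases hφ.1.eq_or_lt with h | h
    · exact Or.inl h.symm
    rcases hφ.2.eq_or_lt with h' | h'
    · exact Or.inr (Or.inl h')
    · exact Or.inr (Or.inr (Real.sin_pos_of_pos_of_lt_pi h h'))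
  have hFne : ∀ ρ, 0 < ρ → ρ ≤ r → ∀ φ ∈ Icc 0 Real.pi, halfCircleDet β t ρ φ ≠ 0 := by
    intro ρ hρ0 hρ1 φ hφ
    rcases hsin φ hφ with h | h | h
    · exact hF0 φ (Or.inl h) ρ hρ0 (hρ1.trans h1)
    · exact hF0 φ (Or.inr h) ρ hρ0 (hρ1.trans h1)
    · have hle := Real.sin_le_one φ
      refine pencilDet_smul_one_ne_zero (hs _ (hmem ρ φ hρ0.le hρ1)) ?_ ?_ fun h' => ?_
      · nlinarith
      · nlinarith
      · nlinarith
  have hgne : ∀ ρ ∈ Icc 0 r, ∀ φ ∈ Icc 0 Real.pi, g ρ φ ≠ 0 := by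
    intro ρ hρ φ hφ
    rcases hρ.1.eq_or_lt with rfl | h
    · exact hg0ne φ
    · intro h'
      refine hFne ρ h hρ.2 φ hφ ?_
      rw [hF, h']; ring
  have hrδ : r ≤ δ := h1.trans hr1δ
  -- First homotopy: the radius shrinks to 0. Along the edges φ = 0 and φ = π the function `g` is
  -- real, so the turn at radius `r` equals the explicit turn at radius 0.
  have key1 := argVar_rectangle (F := g) h0.le Real.pi_pos.le
    (hg.mono (prod_mono (Icc_subset_Icc_right hrδ) (subset_univ _))) hgne
  have hreal : ∀ φ, (φ = 0 ∨ φ = Real.pi) → argVar (fun ρ => g ρ φ) 0 r = 0 := by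
    intro φ hφ
    have hsφ : Real.sin φ = 0 := by rcases hφ with rfl | rfl <;> simp
    refine argVar_real h0.le ⟨(hgφ φ).mono (Icc_subset_Icc_right hrδ), fun ρ hρ =>
      hends φ hφ ρ hρ.1 (hρ.2.trans h1)⟩ fun ρ hρ => ?_
    rcases hρ.1.eq_or_lt with rfl | h
    · rw [hg0, hsφ]
      have : (∏ i, -((a i : ℂ) * Real.cos φ + (0 : ℝ) * Complex.I)) =
          ((∏ i, -(a i * Real.cos φ) : ℝ) : ℂ) := by
        push_cast; simp
      rw [this, Complex.ofReal_im]
    · have h2 := hF ρ φ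
      rw [det_ofReal_im hsφ, ← Complex.ofReal_pow] at h2
      have h3 : g ρ φ = (((β (t - ρ * Real.cos φ) - 1).det / (κ * ρ ^ m) : ℝ) : ℂ) := by
        have hρm : ((ρ ^ m : ℝ) : ℂ) ≠ 0 := by exact_mod_cast (pow_pos h m).ne'
        rw [Complex.ofReal_div, h2, Complex.ofReal_mul]
        field_simp
      rw [h3, Complex.ofReal_im]
  rw [hreal 0 (Or.inl rfl), hreal Real.pi (Or.inr rfl), zero_add, add_zero] at key1
  have hvar0 : argVar (fun φ => g 0 φ) 0 Real.pi =
      Real.pi * quadSignature (crossingForm (β t) β') := by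
    simp_rw [hg0]
    rw [argVar_finset_prod _ Real.pi_pos.le, hsig]
    · push_cast
      rw [Finset.mul_sum]
      exact Finset.sum_congr rfl fun i _ => by exact_mod_cast argVar_semicircle (ha i)
    · intro i _
      refine ⟨by fun_prop, fun φ _ h => hg0ne φ ?_⟩
      rw [hg0]
      exact Finset.prod_eq_zero (Finset.mem_univ i) h
  have hgr : NonvanishingOn (fun φ => g r φ) 0 Real.pi :=
    ⟨hg.comp (f := fun φ => (r, φ)) (by fun_prop) fun φ _ => ⟨⟨h0.le, hrδ⟩, mem_univ _⟩,
      hgne r (right_mem_Icc.2 h0.le)⟩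
  have hhalf : argVar (fun φ => halfCircleDet β t r φ) 0 Real.pi =
      Real.pi * quadSignature (crossingForm (β t) β') := by
    rw [← hvar0, ← key1, ← argVar_const_mul Real.pi_pos.le hgr
      (mul_ne_zero hκ' (pow_ne_zero m (by exact_mod_cast h0.ne' : (r : ℂ) ≠ 0)))]
    exact argVar_congr fun φ _ => by rw [hF]; ring
  have hmaps : MapsTo (fun p : ℝ × ℝ => t - r * Real.cos p.2) (Icc (0 : ℝ) 1 ×ˢ Icc 0 Real.pi)
      (Icc (t - δ) (t + δ)) := fun p _ => hmem r p.2 h0.le le_rfl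
  -- Second homotopy: Z is scaled down from the half circle to 0. The edge Z = 0 carries the
  -- rotation of `β` across the crossing, and the edges φ = 0 and φ = π carry the radial variations.
  have key2 := argVar_rectangle (F := fun s φ : ℝ => pencilDet
      (complexify (β (t - r * Real.cos φ))) (((s * (1 - r * Real.sin φ) : ℝ) : ℂ) • 1))
    zero_le_one Real.pi_pos.le (by
      have h2 : ContinuousOn (fun p : ℝ × ℝ => complexify (β (t - r * Real.cos p.2)))
          (Icc (0 : ℝ) 1 ×ˢ Icc 0 Real.pi) :=
        continuous_complexify.comp_continuousOn (hc.comp (by fun_prop) hmaps)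
      have h3 : ContinuousOn (fun p : ℝ × ℝ => (((p.1 * (1 - r * Real.sin p.2) : ℝ) : ℂ) •
          (1 : ComplexPhaseMatrix d))) (Icc (0 : ℝ) 1 ×ˢ Icc 0 Real.pi) :=
        (Continuous.continuousOn (f := fun p : ℝ × ℝ => ((p.1 * (1 - r * Real.sin p.2) : ℝ) : ℂ))
          (by fun_prop)).smul continuousOn_const
      exact h2.pencilDet h3) (by
      intro s hs' φ hφ
      have hsn := Real.sin_le_one φ
      have hsn0 := Real.sin_nonneg_of_mem_Icc hφ
      rcases hs'.2.eq_or_lt with rfl | hlt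
      · have := hFne r h0 le_rfl φ hφ
        rw [halfCircleDet] at this
        rwa [one_mul]
      · have hlt1 : s * (1 - r * Real.sin φ) < 1 := by
          nlinarith [mul_nonneg hs'.1 (mul_nonneg h0.le hsn0)]
        exact pencilDet_smul_one_ne_zero (hs _ (hmem r φ h0.le le_rfl))
          (mul_nonneg hs'.1 (by nlinarith)) hlt1.le fun h' => absurd h' hlt1.ne)
  have hcosπ : t - r * Real.cos Real.pi = t + r := by rw [Real.cos_pi]; ring
  simp only [Real.sin_zero, Real.sin_pi, mul_zero, sub_zero, mul_one, Real.cos_zero, hcosπ,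
    one_mul, zero_mul, Complex.ofReal_zero, zero_smul] at key2
  have hrep : argVar (fun φ => rotationDet (β (t - r * Real.cos φ))) 0 Real.pi =
      argVar (fun u => rotationDet (β u)) (t - r) (t + r) := by
    have := argVar_comp_monotone (g := fun u => rotationDet (β u))
      (u := fun φ => t - r * Real.cos φ) Real.pi_pos.le (by fun_prop)
      (fun x hx y hy hxy => by
        have := Real.strictAntiOn_cos.antitoneOn hx hy hxy
        dsimp only
        nlinarith) (by
        simp only [Real.cos_zero, mul_one, hcosπ]
        have hsub : Icc (t - r) (t + r) ⊆ Icc (t - δ) (t + δ) :=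
          Icc_subset_Icc (by linarith) (by linarith)
        exact ⟨continuous_rotationDet.comp_continuousOn (hc.mono hsub),
          fun u hu => rotationDet_ne_zero (hs u (hsub hu))⟩)
    simpa only [Real.cos_zero, mul_one, hcosπ] using this
  change radialVar (β (t - r)) + argVar (fun φ => halfCircleDet β t r φ) 0 Real.pi =
    argVar (fun φ => rotationDet (β (t - r * Real.cos φ))) 0 Real.pi + radialVar (β (t + r)) at key2
  rw [hhalf, hrep] at key2
  linarith

/-! ### The intersection number in terms of the rotation. -/

theorem nonvanishingOn_rotationDet {d : ℕ} {β : ℝ → PhaseMatrix d} {a b : ℝ}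
    (hc : ContinuousOn β (Icc a b))
    (hs : ∀ u ∈ Icc a b, β u ∈ Matrix.symplecticGroup (Fin d) ℝ) :
    NonvanishingOn (fun t => rotationDet (β t)) a b :=
  ⟨continuous_rotationDet.comp_continuousOn hc, fun t ht => rotationDet_ne_zero (hs t ht)⟩

theorem continuous_det_sub_one {d : ℕ} : Continuous fun M : PhaseMatrix d => (M - 1).det :=
  Continuous.matrix_det (continuous_id.sub continuous_const)

/-- On the rectangle with Z = s ∈ [0, 1], the edge Z = 1 carries the real nonvanishing function
det(β - 1) and contributes nothing. -/
theorem argVar_rotationDet_of_forall_det_ne_zero {d : ℕ} {β : ℝ → PhaseMatrix d} {a b : ℝ}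
    (hab : a ≤ b) (hc : ContinuousOn β (Icc a b))
    (hs : ∀ u ∈ Icc a b, β u ∈ Matrix.symplecticGroup (Fin d) ℝ)
    (h0 : ∀ u ∈ Icc a b, (β u - 1).det ≠ 0) :
    argVar (fun t => rotationDet (β t)) a b = radialVar (β a) - radialVar (β b) := by
  have key := argVar_rectangle (F := fun s t : ℝ => pencilDet (complexify (β t)) ((s : ℂ) • 1))
    zero_le_one hab (by
      have h2 : ContinuousOn (fun p : ℝ × ℝ => complexify (β p.2)) (Icc (0 : ℝ) 1 ×ˢ Icc a b) :=
        continuous_complexify.comp_continuousOn (hc.comp (by fun_prop) fun p hp => hp.2)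
      have h3 : ContinuousOn (fun p : ℝ × ℝ => ((p.1 : ℂ) • (1 : ComplexPhaseMatrix d)))
          (Icc (0 : ℝ) 1 ×ˢ Icc a b) :=
        (Continuous.continuousOn (f := fun p : ℝ × ℝ => (p.1 : ℂ))
          (by fun_prop)).smul continuousOn_const
      exact h2.pencilDet h3)
    fun s hs' t ht => pencilDet_smul_one_ne_zero (hs t ht) hs'.1 hs'.2 fun _ => h0 t ht
  have hreal : argVar (fun t => pencilDet (complexify (β t)) (((1 : ℝ) : ℂ) • 1)) a b = 0 := by
    simp only [Complex.ofReal_one, one_smul, pencilDet_one]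
    refine argVar_real hab ⟨Complex.continuous_ofReal.comp_continuousOn
      (continuous_det_sub_one.comp_continuousOn hc), fun t ht => ?_⟩ fun t _ => Complex.ofReal_im _
    exact Complex.ofReal_ne_zero.2 (h0 t ht)
  rw [hreal, add_zero] at key
  simp only [Complex.ofReal_zero, zero_smul] at key
  change radialVar (β a) = argVar (fun t => rotationDet (β t)) a b + radialVar (β b) at key
  linarith

/-- The rotation of a path with regular crossings. -/
theorem argVar_rotationDet_eq_sum {d : ℕ} {β : ℝ → PhaseMatrix d} (C : Finset ℝ) {a b : ℝ}
    (hab : a ≤ b) (hc : ContinuousOn β (Icc a b))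
    (hs : ∀ u ∈ Icc a b, β u ∈ Matrix.symplecticGroup (Fin d) ℝ)
    (ha : (β a - 1).det ≠ 0) (hb : (β b - 1).det ≠ 0)
    (hC : ∀ t, t ∈ C ↔ t ∈ Ioo a b ∧ (β t - 1).det = 0)
    (hd : ∀ t ∈ C, DifferentiableAt ℝ β t)
    (hreg : ∀ t ∈ C, (QuadraticMap.associated (R := ℝ)
      (crossingForm (β t) (deriv β t))).SeparatingLeft) :
    argVar (fun t => rotationDet (β t)) a b = radialVar (β a) - radialVar (β b) +
      Real.pi * (∑ t ∈ C, quadSignature (crossingForm (β t) (deriv β t)) : ℤ) := by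
  classical
  -- The largest crossing `t` is split off: the induction hypothesis applies up to t - r,
  -- `crossing_local` on [t - r, t + r], and no crossing is left after that.
  induction C using Finset.induction_on_max generalizing b with
  | empty =>
    rw [argVar_rotationDet_of_forall_det_ne_zero hab hc hs fun u hu h0 => ?_]
    · simp
    · rcases hu.1.eq_or_lt with rfl | h1
      · exact ha h0
      rcases hu.2.eq_or_lt with rfl | h2
      · exact hb h0
      · exact absurd ((hC u).2 ⟨⟨h1, h2⟩, h0⟩) (Finset.notMem_empty u)
  | insert t s hts ih =>
    have htC := Finset.mem_insert_self t s
    obtain ⟨⟨hat, htb⟩, ht0⟩ := (hC t).1 htC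
    have hδ : 0 < min (t - a) (b - t) := lt_min (by linarith) (by linarith)
    have hsub : Icc (t - min (t - a) (b - t)) (t + min (t - a) (b - t)) ⊆ Icc a b :=
      Icc_subset_Icc (by linarith [min_le_left (t - a) (b - t)])
        (by linarith [min_le_right (t - a) (b - t)])
    obtain ⟨r0, hr0, hloc⟩ := crossing_local hδ (hc.mono hsub) (fun u hu => hs u (hsub hu))
      (hd t htC).hasDerivAt (hreg t htC)
    set r := min r0 (min (t - a) (b - t)) with hr
    have hrpos : 0 < r := lt_min hr0 hδ
    have hrr0 : r ≤ r0 := min_le_left _ _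
    have hra : a ≤ t - r := by
      linarith [(min_le_right r0 (min (t - a) (b - t))).trans (min_le_left _ _)]
    have hrb : t + r ≤ b := by
      linarith [(min_le_right r0 (min (t - a) (b - t))).trans (min_le_right _ _)]
    obtain ⟨hm, hp, hval⟩ := hloc r hrpos hrr0
    have hsub1 : Icc a (t - r) ⊆ Icc a b := Icc_subset_Icc_right (by linarith)
    have hsub3 : Icc (t + r) b ⊆ Icc a b := Icc_subset_Icc_left (by linarith)
    have hnts : ∀ u ∈ s, u < t - r := by
      intro u hu
      by_contra hlt
      have := (hloc (t - u) (by linarith [hts u hu]) (by linarith)).1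
      rw [sub_sub_cancel] at this
      exact this ((hC u).1 (Finset.mem_insert_of_mem hu)).2
    have h1 := ih hra (hc.mono hsub1) (fun u hu => hs u (hsub1 hu)) hm (fun u => by
      constructor
      · intro hu
        have := (hC u).1 (Finset.mem_insert_of_mem hu)
        exact ⟨⟨this.1.1, hnts u hu⟩, this.2⟩
      · rintro ⟨⟨hu1, hu2⟩, hu0⟩
        have := (hC u).2 ⟨⟨hu1, by linarith⟩, hu0⟩
        rcases Finset.mem_insert.1 this with rfl | h
        · linarith
        · exact h) (fun u hu => hd u (Finset.mem_insert_of_mem hu))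
        (fun u hu => hreg u (Finset.mem_insert_of_mem hu))
    have h3 := argVar_rotationDet_of_forall_det_ne_zero hrb (hc.mono hsub3)
      (fun u hu => hs u (hsub3 hu)) fun u hu hu0 => by
        rcases hu.2.eq_or_lt with rfl | h2
        · exact hb hu0
        have := (hC u).2 ⟨⟨by linarith [hu.1], h2⟩, hu0⟩
        rcases Finset.mem_insert.1 this with rfl | h
        · linarith [hu.1]
        · linarith [hu.1, hts u h]
    have hnv := nonvanishingOn_rotationDet hc hs
    rw [← argVar_add (by linarith : a ≤ t + r) hrb hnv,
      ← argVar_add hra (by linarith : t - r ≤ t + r) (hnv.mono le_rfl hrb), h1, hval, h3,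
      Finset.sum_insert fun h => lt_irrefl _ (hts t h)]
    push_cast
    ring

theorem argVar_rotationDet_eq_of_homotopic {d : ℕ} {α β : ℝ → PhaseMatrix d} {l : ℝ} (hl : 0 ≤ l)
    (h : HomotopicSymplecticPaths α β l) :
    argVar (fun t => rotationDet (α t)) 0 l = argVar (fun t => rotationDet (β t)) 0 l := by
  obtain ⟨f, g, hf, hg, ⟨H⟩⟩ := h
  let P : ℝ → ℝ → PhaseMatrix d := fun s t =>
    (H (projIcc 0 1 zero_le_one s, projIcc 0 l hl t) : PhaseMatrix d)
  have hP : Continuous fun p : ℝ × ℝ => P p.1 p.2 :=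
    continuous_subtype_val.comp (H.continuous.comp
      ((continuous_projIcc.comp continuous_fst).prodMk (continuous_projIcc.comp continuous_snd)))
  have hne : ∀ s t, rotationDet (P s t) ≠ 0 := fun s t => rotationDet_ne_zero (Subtype.prop _)
  have key := argVar_rectangle (F := fun s t => rotationDet (P s t)) zero_le_one hl
    (continuous_rotationDet.comp hP).continuousOn fun s _ t _ => hne s t
  have h0 : ∀ s, P s 0 = α 0 := by
    intro s
    have := H.eq_fst (projIcc 0 1 zero_le_one s) (x := projIcc 0 l hl 0)
      (Or.inl (by rw [projIcc_left]))
    simp only [P]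
    rw [this, projIcc_left, hf]
  have hl' : ∀ s, P s l = α l := by
    intro s
    have := H.eq_fst (projIcc 0 1 zero_le_one s) (x := projIcc 0 l hl l)
      (Or.inr (by rw [projIcc_right]))
    simp only [P]
    rw [this, projIcc_right, hf]
  have e0 : argVar (fun s => rotationDet (P s 0)) 0 1 = 0 := by
    simp only [h0]
    exact argVar_const zero_le_one (by rw [← h0 0]; exact hne _ _)
  have e1 : argVar (fun s => rotationDet (P s l)) 0 1 = 0 := by
    simp only [hl']
    exact argVar_const zero_le_one (by rw [← hl' 0]; exact hne _ _)
  rw [e0, e1, zero_add, add_zero] at key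
  have ea : argVar (fun t => rotationDet (P 0 t)) 0 l = argVar (fun t => rotationDet (α t)) 0 l :=
    argVar_congr fun t ht => by
      simp only [P, projIcc_left, projIcc_of_mem hl ht]
      have := H.apply_zero ⟨t, ht⟩
      rw [show ((⟨0, left_mem_Icc.2 zero_le_one⟩ : Icc (0 : ℝ) 1)) = 0 from rfl, this, hf]
  have eb : argVar (fun t => rotationDet (P 1 t)) 0 l = argVar (fun t => rotationDet (β t)) 0 l :=
    argVar_congr fun t ht => by
      simp only [P, projIcc_right, projIcc_of_mem hl ht]
      have := H.apply_one ⟨t, ht⟩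
      rw [show ((⟨1, right_mem_Icc.2 zero_le_one⟩ : Icc (0 : ℝ) 1)) = 1 from rfl, this, hg]
  rw [← ea, ← eb, key]

theorem HomotopicSymplecticPaths.endpoints {d : ℕ} {α β : ℝ → PhaseMatrix d} {l : ℝ} (hl : 0 ≤ l)
    (h : HomotopicSymplecticPaths α β l) : β 0 = α 0 ∧ β l = α l := by
  obtain ⟨f, g, hf, hg, ⟨H⟩⟩ := h
  have key : ∀ x : Icc (0 : ℝ) l, ((x : ℝ) = 0 ∨ (x : ℝ) = l) → β x = α x := by
    intro x hx
    rw [← hf, ← hg, ← H.apply_one, H.eq_fst 1 hx]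
  exact ⟨key ⟨0, left_mem_Icc.2 hl⟩ (Or.inl rfl), key ⟨l, right_mem_Icc.2 hl⟩ (Or.inr rfl)⟩

/-- Rotation is invariant under homotopy with fixed endpoints, so the count for the regular
representative is expressed through `α` alone. In particular the intersection number is unique. -/
theorem IsIntersectionNumber.pi_mul_eq {d : ℕ} {α : ℝ → PhaseMatrix d} {l : ℝ} {k : ℤ} (hl : 0 < l)
    (h : IsIntersectionNumber α l k) :
    Real.pi * k = argVar (fun t => rotationDet (α t)) 0 l - radialVar (α 0) + radialVar (α l) := by
  obtain ⟨ha0, hal, β, C, hhom, hcd, hC, hreg, rfl⟩ := h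
  obtain ⟨e0, el⟩ := hhom.endpoints hl.le
  have hmem : ∀ u ∈ Icc 0 l, β u ∈ Matrix.symplecticGroup (Fin d) ℝ := by
    obtain ⟨f, g, hf, hg, -⟩ := hhom
    intro u hu
    rw [← hg ⟨u, hu⟩]
    exact (g ⟨u, hu⟩).2
  have hns : ∀ u ∈ Icc 0 l, β u ∉ singularCycle d → (β u - 1).det ≠ 0 := fun u hu h h0 =>
    h ⟨hmem u hu, h0⟩
  have hC' : ∀ t, t ∈ C ↔ t ∈ Ioo 0 l ∧ (β t - 1).det = 0 := fun t => by
    rw [hC]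
    exact and_congr_right fun ht => ⟨fun h => h.2, fun h => ⟨hmem t (Ioo_subset_Icc_self ht), h⟩⟩
  rw [argVar_rotationDet_eq_of_homotopic hl.le hhom,
    argVar_rotationDet_eq_sum C hl.le hcd.continuousOn hmem
      (hns 0 (left_mem_Icc.2 hl.le) (by rwa [e0])) (hns l (right_mem_Icc.2 hl.le) (by rwa [el])) hC'
      (fun t ht => (hcd.differentiableOn one_ne_zero).differentiableAt
        (Icc_mem_nhds ((hC t).1 ht).1.1 ((hC t).1 ht).1.2)) hreg, e0, el]
  ring

/-! ### Isolation and finiteness of regular crossings. -/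

theorem crossing_isolated {d : ℕ} {β : ℝ → PhaseMatrix d} (hc : Continuous β)
    (hs : ∀ u, β u ∈ Matrix.symplecticGroup (Fin d) ℝ) {t : ℝ} {β' : PhaseMatrix d}
    (hβ : HasDerivAt β β' t)
    (hreg : (QuadraticMap.associated (R := ℝ) (crossingForm (β t) β')).SeparatingLeft) :
    ∀ᶠ u in 𝓝[≠] t, (β u - 1).det ≠ 0 := by
  obtain ⟨r0, hr0, h⟩ := crossing_local one_pos hc.continuousOn (fun u _ => hs u) hβ hreg
  rw [eventually_nhdsWithin_iff]
  filter_upwards [Icc_mem_nhds (show t - r0 < t by linarith) (show t < t + r0 by linarith)]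
    with u hu hne
  rcases lt_or_gt_of_ne hne with hlt | hgt
  · have := (h (t - u) (by linarith) (by linarith [hu.1])).1
    rwa [sub_sub_cancel] at this
  · have := (h (u - t) (by linarith) (by linarith [hu.2])).2.1
    rwa [add_sub_cancel] at this

theorem finite_crossings {d : ℕ} {β : ℝ → PhaseMatrix d} (hc : Continuous β)
    (hd : Differentiable ℝ β) (hs : ∀ u, β u ∈ Matrix.symplecticGroup (Fin d) ℝ) {a b : ℝ}
    (hreg : ∀ t ∈ Icc a b, (β t - 1).det = 0 → (QuadraticMap.associated (R := ℝ)
      (crossingForm (β t) (deriv β t))).SeparatingLeft) :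
    {t | t ∈ Icc a b ∧ (β t - 1).det = 0}.Finite := by
  by_contra hinf
  obtain ⟨x, hx, hacc⟩ := Set.Infinite.exists_accPt_of_subset_isCompact hinf isCompact_Icc
    fun t ht => ht.1
  rw [accPt_iff_frequently_nhdsNE] at hacc
  have hcd : Continuous fun t => (β t - 1).det := continuous_det_sub_one.comp hc
  have hev : ∀ᶠ u in 𝓝[≠] x, (β u - 1).det ≠ 0 := by
    by_cases h0 : (β x - 1).det = 0
    · exact crossing_isolated hc hs (hd x).hasDerivAt (hreg x hx h0)
    · exact (hcd.continuousAt.eventually_ne h0).filter_mono nhdsWithin_le_nhds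
  obtain ⟨u, hu, hu'⟩ := (hacc.and_eventually hev).exists
  exact hu' hu.2

theorem abs_dotProduct_mulVec_le {n : Type*} [Fintype n] [DecidableEq n] (A : Matrix n n ℝ)
    (x : n → ℝ) : |x ⬝ᵥ (A *ᵥ x)| ≤ ‖A‖ * (x ⬝ᵥ x) := by
  have h1 : x ⬝ᵥ (A *ᵥ x) = inner ℝ (WithLp.toLp 2 (A *ᵥ x)) (WithLp.toLp 2 x) := by
    rw [EuclideanSpace.inner_eq_star_dotProduct]; simp
  have h2 : x ⬝ᵥ x = ‖WithLp.toLp 2 x‖ * ‖WithLp.toLp 2 x‖ := by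
    rw [← real_inner_self_eq_norm_mul_norm, EuclideanSpace.inner_eq_star_dotProduct]; simp
  rw [h1, h2]
  refine (abs_real_inner_le_norm _ _).trans ?_
  have := A.l2_opNorm_mulVec (WithLp.toLp 2 x)
  rw [← mul_assoc]
  exact mul_le_mul_of_nonneg_right this (norm_nonneg _)

theorem crossingForm_separatingLeft {d : ℕ} {M M' S : PhaseMatrix d} (hM' : M' = stdJ d * S * M)
    (hS : ∀ v, v ≠ 0 → v ⬝ᵥ (S *ᵥ v) ≠ 0) :
    (QuadraticMap.associated (R := ℝ) (crossingForm M M')).SeparatingLeft := by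
  refine QuadraticMap.separatingLeft_of_anisotropic (Q := crossingForm M M') ?_
  rintro ⟨v, hv⟩ h0
  rw [LinearMap.mem_ker, Matrix.toLin'_apply, Matrix.sub_mulVec, Matrix.one_mulVec,
    sub_eq_zero] at hv
  have h1 : v ⬝ᵥ (S *ᵥ v) = 0 := by
    have h2 : -(stdJ d * M') = S * M := by
      rw [hM', ← mul_assoc, ← mul_assoc, Matrix.J_squared]; simp
    rw [crossingForm, QuadraticMap.restrict_apply, toQuadraticForm'_apply, h2,
      ← Matrix.mulVec_mulVec] at h0
    simpa only [hv] using h0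
  by_contra hne
  exact hS v (fun h => hne (Subtype.ext h)) h1

theorem dotProduct_self_pos {n : Type*} [Fintype n] {v : n → ℝ} (hv : v ≠ 0) : 0 < v ⬝ᵥ v := by
  have := Matrix.dotProduct_star_self_pos_iff.2 hv
  simpa using this

/-- The path u ↦ exp(uJ)N has crossing form vᵀv, so all its crossings are regular and hence
isolated. -/
theorem eventually_det_rot_mul_ne_zero {d : ℕ} {N : PhaseMatrix d}
    (hN : N ∈ Matrix.symplecticGroup (Fin d) ℝ) (x : ℝ) :
    ∀ᶠ u in 𝓝[≠] x, (rot d u * N - 1).det ≠ 0 := by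
  refine crossing_isolated (β := fun u => rot d u * N) ?_ (fun u => mul_mem (rot_mem u) hN)
    ((hasDerivAt_rot x).mul_const N) (crossingForm_separatingLeft (S := 1) ?_ ?_)
  · exact contDiff_rot.continuous.mul continuous_const
  · rw [mul_one, mul_assoc]
  · intro v hv
    rw [Matrix.one_mulVec]
    exact (dotProduct_self_pos hv).ne'

/-! ### Linear differential equations and the fundamental solution. -/

/-- Terms of the Picard (Dyson) series of `u' = A u`, `u 0 = 1`. -/
def picardTerm {E : Type*} [NormedRing E] [NormedAlgebra ℝ E] (A : ℝ → E) : ℕ → ℝ → E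
  | 0 => fun _ => 1
  | n + 1 => fun t => ∫ s in (0 : ℝ)..t, A s * picardTerm A n s

section picard
variable {E : Type*} [NormedRing E] [NormedAlgebra ℝ E] {A : ℝ → E}

theorem continuous_picardTerm (hA : Continuous A) (n : ℕ) : Continuous (picardTerm A n) := by
  induction n with
  | zero => exact continuous_const
  | succ n ih =>
    exact intervalIntegral.continuous_primitive (fun a b => (hA.mul ih).intervalIntegrable a b) 0

theorem norm_picardTerm_le (hA : Continuous A) {L : ℝ} (hL : ∀ t, ‖A t‖ ≤ L) (n : ℕ) (t : ℝ) :
    ‖picardTerm A n t‖ ≤ ‖(1 : E)‖ * ((L * |t|) ^ n / n.factorial) := by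
  have hL0 : 0 ≤ L := (norm_nonneg _).trans (hL 0)
  induction n generalizing t with
  | zero => simp [picardTerm]
  | succ n ih =>
    have hc : Continuous fun s : ℝ => ‖(1 : E)‖ * L ^ (n + 1) / n.factorial * |s - 0| ^ n := by
      fun_prop
    calc ‖picardTerm A (n + 1) t‖ ≤ ∫ s in uIoc 0 t, ‖A s * picardTerm A n s‖ :=
          intervalIntegral.norm_integral_le_integral_norm_uIoc
      _ ≤ ∫ s in uIoc 0 t, ‖(1 : E)‖ * L ^ (n + 1) / n.factorial * |s - 0| ^ n := by
          refine MeasureTheory.setIntegral_mono ?_ ?_ fun s => ?_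
          · exact intervalIntegrable_iff.1
              ((hA.mul (continuous_picardTerm hA n)).norm.intervalIntegrable 0 t)
          · exact intervalIntegrable_iff.1 (hc.intervalIntegrable 0 t)
          · refine (norm_mul_le _ _).trans ?_
            refine (mul_le_mul (hL s) (ih s) (norm_nonneg _) hL0).trans (le_of_eq ?_)
            rw [sub_zero, mul_pow]; ring
      _ = _ := by
          rw [MeasureTheory.integral_const_mul, integral_pow_abs_sub_uIoc, sub_zero,
            Nat.factorial_succ, mul_pow]
          push_cast
          field_simp

theorem exists_linear_ode_solution [CompleteSpace E] (hA : Continuous A) {L : ℝ} (hL : ∀ t, ‖A t‖ ≤ L) :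
    ∃ u : ℝ → E, u 0 = 1 ∧ ∀ t, HasDerivAt u (A t * u t) t := by
  have hL0 : 0 ≤ L := (norm_nonneg _).trans (hL 0)
  have hsum : ∀ t, Summable fun n => picardTerm A n t := fun t =>
    Summable.of_norm_bounded ((Real.summable_pow_div_factorial (L * |t|)).mul_left _)
      fun n => norm_picardTerm_le hA hL n t
  have hder : ∀ n t, HasDerivAt (picardTerm A (n + 1)) (A t * picardTerm A n t) t := fun n t =>
    (hA.mul (continuous_picardTerm hA n)).integral_hasStrictDerivAt 0 t |>.hasDerivAt
  have hzero : ∀ n, picardTerm A (n + 1) 0 = 0 := fun n => intervalIntegral.integral_same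
  refine ⟨fun t => 1 + ∑' n, picardTerm A (n + 1) t, by simp [hzero], fun t => ?_⟩
  set R := |t| + 1 with hR
  have hb : ∀ n, ∀ y ∈ Metric.ball (0 : ℝ) R, ‖A y * picardTerm A n y‖ ≤
      L * (‖(1 : E)‖ * ((L * R) ^ n / n.factorial)) := by
    intro n y hy
    have hyR : |y| ≤ R := by simpa using (mem_ball_zero_iff.1 hy).le
    refine (norm_mul_le _ _).trans (mul_le_mul (hL y) ?_ (norm_nonneg _) hL0)
    refine (norm_picardTerm_le hA hL n y).trans ?_
    gcongr
  have ht : t ∈ Metric.ball (0 : ℝ) R := by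
    rw [mem_ball_zero_iff, Real.norm_eq_abs, hR]; linarith
  have h1 := hasDerivAt_tsum_of_isPreconnected
    (((Real.summable_pow_div_factorial (L * R)).mul_left ‖(1 : E)‖).mul_left L) Metric.isOpen_ball
    (convex_ball (0 : ℝ) R).isPreconnected (fun n y _ => hder n y) hb ht
    ((summable_nat_add_iff (f := fun n => picardTerm A n t) 1).2 (hsum t)) ht
  refine (h1.const_add 1).congr_deriv ?_
  rw [(hsum t).tsum_mul_left, (hsum t).tsum_eq_zero_add]
  rfl

theorem norm_linear_ode_le {A u : ℝ → E} {L T : ℝ} (hL : 0 ≤ L) (hA : ∀ t, ‖A t‖ ≤ L)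
    (h0 : u 0 = 1) (hu : ∀ t, HasDerivAt u (A t * u t) t) {t : ℝ} (ht : t ∈ Icc 0 T) :
    ‖u t‖ ≤ ‖(1 : E)‖ * Real.exp (L * T) := by
  have h1 := norm_le_gronwallBound_of_norm_deriv_right_le (δ := ‖(1 : E)‖) (K := L) (ε := 0)
    (continuous_iff_continuousAt.2 fun t => (hu t).continuousAt).continuousOn
    (fun x _ => (hu x).hasDerivWithinAt) (by rw [h0])
    (fun x _ => by
      rw [add_zero]
      exact (norm_mul_le _ _).trans (mul_le_mul_of_nonneg_right (hA x) (norm_nonneg _))) t ht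
  rw [gronwallBound_ε0, sub_zero] at h1
  refine h1.trans ?_
  gcongr
  exact ht.2

/-- The difference u - u' has derivative A'(u - u') + (A - A')u, whose forcing term is at most εR;
Grönwall bounds the difference by εR exp(LT)/L. The choice of `ε` depends on the systems only
through `L`, which is the source of uniformity. -/
theorem exists_linear_ode_close {L : ℝ} (T : ℝ) (hL : 0 < L) {ρ : ℝ} (hρ : 0 < ρ) :
    ∃ ε > 0, ∀ A A' u u' : ℝ → E, (∀ t, ‖A t‖ ≤ L) → (∀ t, ‖A' t‖ ≤ L) →
      (∀ t, ‖A t - A' t‖ ≤ ε) → u 0 = 1 → u' 0 = 1 → (∀ t, HasDerivAt u (A t * u t) t) →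
      (∀ t, HasDerivAt u' (A' t * u' t) t) →
      (∀ t ∈ Icc 0 T, ‖u t‖ ≤ ‖(1 : E)‖ * Real.exp (L * T)) ∧
        ∀ t ∈ Icc 0 T, ‖u t - u' t‖ < ρ := by
  obtain ⟨R, hR⟩ : ∃ R, R = ‖(1 : E)‖ * Real.exp (L * T) := ⟨_, rfl⟩
  have hR0 : 0 ≤ R := by rw [hR]; positivity
  refine ⟨ρ * L / (2 * (R + 1) * Real.exp (L * T)), by positivity,
    fun A A' u u' hA hA' hAA h0 h0' hu hu' =>
      ⟨fun t ht => norm_linear_ode_le hL.le hA h0 hu ht, fun t ht => ?_⟩⟩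
  obtain ⟨ε, hε⟩ : ∃ ε, ε = ρ * L / (2 * (R + 1) * Real.exp (L * T)) := ⟨_, rfl⟩
  rw [← hε] at hAA
  have hε0 : 0 < ε := by rw [hε]; positivity
  have hd : ∀ x, HasDerivAt (fun t => u t - u' t) (A x * u x - A' x * u' x) x :=
    fun x => (hu x).sub (hu' x)
  have h1 := norm_le_gronwallBound_of_norm_deriv_right_le (f := fun t => u t - u' t)
    (f' := fun t => A t * u t - A' t * u' t) (δ := 0) (K := L) (ε := ε * R)
    (continuous_iff_continuousAt.2 fun t => (hd t).continuousAt).continuousOn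
    (fun x _ => (hd x).hasDerivWithinAt) (by simp [h0, h0'])
    (fun x hx => by
      have e1 : A x * u x - A' x * u' x = A' x * (u x - u' x) + (A x - A' x) * u x := by
        noncomm_ring
      have h2 := norm_linear_ode_le hL.le hA h0 hu (T := T) ⟨hx.1, hx.2.le⟩
      rw [← hR] at h2
      rw [e1]
      refine (norm_add_le _ _).trans (add_le_add ?_ ?_)
      · exact (norm_mul_le _ _).trans (mul_le_mul_of_nonneg_right (hA' x) (norm_nonneg _))
      · exact (norm_mul_le _ _).trans (mul_le_mul (hAA x) h2 (norm_nonneg _) hε0.le)) t ht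
  rw [gronwallBound_of_K_ne_0 hL.ne'] at h1
  simp only [zero_mul, zero_add, sub_zero] at h1
  refine h1.trans_lt ?_
  have h3 : Real.exp (L * t) ≤ Real.exp (L * T) :=
    Real.exp_le_exp.2 (mul_le_mul_of_nonneg_left ht.2 hL.le)
  have h4 := Real.exp_pos (L * T)
  calc ε * R / L * (Real.exp (L * t) - 1) ≤ ε * R / L * Real.exp (L * T) := by
        refine mul_le_mul_of_nonneg_left ?_ (by positivity)
        linarith
    _ = ρ * (R / (2 * (R + 1))) := by rw [hε]; field_simp
    _ < ρ := by
        have : R / (2 * (R + 1)) < 1 := by rw [div_lt_one (by positivity)]; linarith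
        nlinarith

end picard

theorem exists_isFundamentalSolution {d : ℕ} {B : ℝ → PhaseMatrix d} (hB : Continuous B) {K : ℝ}
    (hK : ∀ t, ‖B t‖ ≤ K) : ∃ γ, IsFundamentalSolution B γ :=
  exists_linear_ode_solution (A := fun t => stdJ d * B t) (continuous_const.mul hB)
    (L := ‖stdJ d‖ * K) fun t => (norm_mul_le _ _).trans (by gcongr; exact hK t)

theorem IsFundamentalSolution.continuous {d : ℕ} {B γ : ℝ → PhaseMatrix d}
    (h : IsFundamentalSolution B γ) : Continuous γ :=
  continuous_iff_continuousAt.2 fun t => (h.2 t).continuousAt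

theorem IsFundamentalSolution.mem_symplecticGroup {d : ℕ} {B γ : ℝ → PhaseMatrix d}
    (hB : ∀ t, (B t).IsSymm) (h : IsFundamentalSolution B γ) (t : ℝ) :
    γ t ∈ Matrix.symplecticGroup (Fin d) ℝ := by
  have hd : ∀ t, HasDerivAt (fun u => (γ u)ᵀ * stdJ d * γ u) 0 t := by
    intro t
    refine HasDerivAt.congr_deriv (((h.2 t).matrixTranspose.mul_const (stdJ d)).mul (h.2 t)) ?_
    rw [Matrix.transpose_mul, Matrix.transpose_mul, (hB t).eq, Matrix.J_transpose]
    have : stdJ d * stdJ d = -1 := Matrix.J_squared _ _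
    calc (γ t)ᵀ * (B t * -stdJ d) * stdJ d * γ t + (γ t)ᵀ * stdJ d * (stdJ d * B t * γ t)
        = -((γ t)ᵀ * B t * (stdJ d * stdJ d) * γ t) + (γ t)ᵀ * (stdJ d * stdJ d) * B t * γ t := by
          noncomm_ring
      _ = 0 := by rw [this]; noncomm_ring
  have := is_const_of_deriv_eq_zero (fun u => (hd u).differentiableAt) (fun u => (hd u).deriv) t 0
  rw [SymplecticGroup.mem_iff']
  simpa [h.1] using this

/-- Translation in time. -/
theorem IsFundamentalSolution.shift {d : ℕ} {B γ : ℝ → PhaseMatrix d}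
    (hB : ∀ t, (B t).IsSymm) (h : IsFundamentalSolution B γ) (a : ℝ) :
    IsFundamentalSolution (fun t => B (a + t)) (fun t => γ (a + t) * (γ a)⁻¹) := by
  have hu := SymplecticGroup.symplectic_det (h.mem_symplecticGroup hB a)
  refine ⟨by simp [Matrix.mul_nonsing_inv _ hu], fun t => ?_⟩
  refine HasDerivAt.congr_deriv
    (((h.2 (a + t)).comp_const_add a t).mul_const ((γ a)⁻¹)) ?_
  rw [mul_assoc (stdJ d * B (a + t))]

theorem norm_sub_fundamentalSolution_lt {d : ℕ} (K T : ℝ) (hK : 0 ≤ K) :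
    ∃ R, ∀ ρ > 0, ∃ δ > 0, ∀ B B' γ γ' : ℝ → PhaseMatrix d, (∀ t, ‖B t‖ ≤ K) → (∀ t, ‖B' t‖ ≤ K) →
      (∀ t, ‖B t - B' t‖ ≤ δ) → IsFundamentalSolution B γ → IsFundamentalSolution B' γ' →
      ∀ t ∈ Icc 0 T, ‖γ t‖ ≤ R ∧ ‖γ t - γ' t‖ < ρ := by
  -- The summand 1 keeps the growth constant positive even when `K` or `d` is zero.
  have hL : 0 < ‖stdJ d‖ * K + 1 := by positivity
  refine ⟨‖(1 : PhaseMatrix d)‖ * Real.exp ((‖stdJ d‖ * K + 1) * T), fun ρ hρ => ?_⟩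
  obtain ⟨ε, hε, h⟩ := exists_linear_ode_close (E := PhaseMatrix d) T hL hρ
  have hJ : 0 < ‖stdJ d‖ + 1 := by positivity
  have hbd : ∀ B : ℝ → PhaseMatrix d, (∀ t, ‖B t‖ ≤ K) → ∀ t,
      ‖stdJ d * B t‖ ≤ ‖stdJ d‖ * K + 1 := by
    intro B hB t
    have : ‖stdJ d‖ * ‖B t‖ ≤ ‖stdJ d‖ * K := mul_le_mul_of_nonneg_left (hB t) (norm_nonneg _)
    linarith [norm_mul_le (stdJ d) (B t)]
  refine ⟨ε / (‖stdJ d‖ + 1), by positivity, fun B B' γ γ' hB hB' hBB hγ hγ' t ht => ?_⟩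
  have key := h (fun t => stdJ d * B t) (fun t => stdJ d * B' t) γ γ' (hbd B hB) (hbd B' hB')
    (fun t => by
      rw [← mul_sub]
      have h1 := norm_mul_le (stdJ d) (B t - B' t)
      have h2 : ‖stdJ d‖ * ‖B t - B' t‖ ≤ ‖stdJ d‖ * (ε / (‖stdJ d‖ + 1)) :=
        mul_le_mul_of_nonneg_left (hBB t) (norm_nonneg _)
      have h3 : ‖stdJ d‖ * (ε / (‖stdJ d‖ + 1)) ≤ (‖stdJ d‖ + 1) * (ε / (‖stdJ d‖ + 1)) :=
        mul_le_mul_of_nonneg_right (by linarith) (by positivity)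
      rw [mul_div_cancel₀ _ hJ.ne'] at h3
      linarith) hγ.1 hγ'.1 hγ.2 hγ'.2
  exact ⟨key.1 t ht, key.2 t ht⟩

/-! ### Comparing the rotations of nearby systems over long times. -/

/-- Up to time `T` all solutions stay in a compact part of Sp(2d), where |`rotationDet`| has a
positive lower bound and `rotationDet` is uniformly continuous. Close solutions thus satisfy the
hypothesis of `abs_argVar_sub_le`. -/
theorem exists_abs_argVar_rotationDet_sub_le {d : ℕ} (K T : ℝ) (hK : 0 ≤ K) :
    ∃ δ > 0, ∀ B B' γ γ' : ℝ → PhaseMatrix d, (∀ t, (B t).IsSymm) → (∀ t, (B' t).IsSymm) →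
      (∀ t, ‖B t‖ ≤ K) → (∀ t, ‖B' t‖ ≤ K) →
      (∀ t, ‖B t - B' t‖ ≤ δ) → IsFundamentalSolution B γ → IsFundamentalSolution B' γ' →
      ∀ h ∈ Icc 0 T, |argVar (fun t => rotationDet (γ t)) 0 h -
        argVar (fun t => rotationDet (γ' t)) 0 h| ≤ Real.pi := by
  obtain ⟨R, hR⟩ := norm_sub_fundamentalSolution_lt (d := d) K T hK
  have hcomp : IsCompact {M : PhaseMatrix d | M ∈ Matrix.symplecticGroup (Fin d) ℝ ∧ ‖M‖ ≤ R} := by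
    have : ProperSpace (PhaseMatrix d) := FiniteDimensional.proper ℝ _
    have h1 : IsClosed {M : PhaseMatrix d | Mᵀ * stdJ d * M = stdJ d} :=
      isClosed_eq (((continuous_id.matrix_transpose).mul continuous_const).mul continuous_id)
        continuous_const
    have h2 := (isCompact_closedBall (0 : PhaseMatrix d) R).inter_left h1
    have h3 : {M : PhaseMatrix d | M ∈ Matrix.symplecticGroup (Fin d) ℝ ∧ ‖M‖ ≤ R} =
        {M | Mᵀ * stdJ d * M = stdJ d} ∩ Metric.closedBall 0 R := by
      ext M
      exact and_congr SymplecticGroup.mem_iff' (mem_closedBall_zero_iff).symm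
    rw [h3]
    exact h2
  have hcont : ContinuousOn (rotationDet : PhaseMatrix d → ℂ)
    {M : PhaseMatrix d | M ∈ Matrix.symplecticGroup (Fin d) ℝ ∧ ‖M‖ ≤ R} :=
    continuous_rotationDet.continuousOn
  obtain ⟨c, hc, hcle⟩ : ∃ c > 0, ∀ M ∈ {M : PhaseMatrix d |
      M ∈ Matrix.symplecticGroup (Fin d) ℝ ∧ ‖M‖ ≤ R}, c ≤ ‖rotationDet M‖ := by
    rcases Set.eq_empty_or_nonempty {M : PhaseMatrix d |
      M ∈ Matrix.symplecticGroup (Fin d) ℝ ∧ ‖M‖ ≤ R} with h | h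
    · exact ⟨1, one_pos, by rw [h]; simp⟩
    · obtain ⟨M, hM, hmin⟩ := hcomp.exists_isMinOn h hcont.norm
      exact ⟨_, norm_pos_iff.2 (rotationDet_ne_zero hM.1), fun N hN => hmin hN⟩
  obtain ⟨ρ, hρ, hu⟩ := Metric.uniformContinuousOn_iff.1
    (hcomp.uniformContinuousOn_of_continuous hcont) c hc
  obtain ⟨δ, hδ, hδ'⟩ := hR ρ hρ
  refine ⟨δ, hδ, fun B B' γ γ' hs hs' hB hB' hBB h h' a ha => ?_⟩
  have hBB' : ∀ t, ‖B' t - B t‖ ≤ δ := fun t => by rw [norm_sub_rev]; exact hBB t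
  have hmem : ∀ t ∈ Icc 0 a, t ∈ Icc 0 T := fun t ht => ⟨ht.1, ht.2.trans ha.2⟩
  refine abs_argVar_sub_le ha.1
    (continuous_rotationDet.comp h.continuous).continuousOn
    (nonvanishingOn_rotationDet h'.continuous.continuousOn fun u _ => h'.mem_symplecticGroup hs' u)
    fun t ht => ?_
  have h1 := hδ' B B' γ γ' hB hB' hBB h h' t (hmem t ht)
  have h2 := hδ' B' B γ' γ hB' hB hBB' h' h t (hmem t ht)
  have m1 : γ t ∈ {M : PhaseMatrix d | M ∈ Matrix.symplecticGroup (Fin d) ℝ ∧ ‖M‖ ≤ R} :=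
    ⟨h.mem_symplecticGroup hs t, h1.1⟩
  have m2 : γ' t ∈ {M : PhaseMatrix d | M ∈ Matrix.symplecticGroup (Fin d) ℝ ∧ ‖M‖ ≤ R} :=
    ⟨h'.mem_symplecticGroup hs' t, h2.1⟩
  rw [← dist_eq_norm]
  exact (hu _ m1 _ m2 (by rw [dist_eq_norm]; exact h1.2)).trans_le (hcle _ m2)

/-- Right translation changes the rotation of a path by a bounded amount. -/
theorem abs_argVar_rotationDet_mul_sub_le {d : ℕ} {β : ℝ → PhaseMatrix d} {a b : ℝ} (hab : a ≤ b)
    (hc : ContinuousOn β (Icc a b))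
    (hs : ∀ u ∈ Icc a b, β u ∈ Matrix.symplecticGroup (Fin d) ℝ) {N : PhaseMatrix d}
    (hN : N ∈ Matrix.symplecticGroup (Fin d) ℝ) :
    |argVar (fun t => rotationDet (β t * N)) a b - argVar (fun t => rotationDet (β t)) a b| ≤
      4 * d * Real.pi := by
  obtain ⟨Z, c, hZ, hc0, hcoc⟩ := exists_cocycle (isKrein_complexify hN)
  have hF : ContinuousOn (fun p : ℝ × ℝ => pencilDet (complexify (β p.2)) ((p.1 : ℂ) • Z))
      (Icc (0 : ℝ) 1 ×ˢ Icc a b) := by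
    have h2 : ContinuousOn (fun p : ℝ × ℝ => complexify (β p.2)) (Icc (0 : ℝ) 1 ×ˢ Icc a b) :=
      continuous_complexify.comp_continuousOn (hc.comp (by fun_prop) fun p hp => hp.2)
    have h3 : ContinuousOn (fun p : ℝ × ℝ => ((p.1 : ℂ) • Z)) (Icc (0 : ℝ) 1 ×ˢ Icc a b) :=
      (Continuous.continuousOn (f := fun p : ℝ × ℝ => (p.1 : ℂ))
        (by fun_prop)).smul continuousOn_const
    exact h2.pencilDet h3
  have hF0 : ∀ s ∈ Icc (0 : ℝ) 1, ∀ t ∈ Icc a b,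
      pencilDet (complexify (β t)) ((s : ℂ) • Z) ≠ 0 := fun s hs' t ht =>
    pencilDet_ne_zero (isKrein_complexify (hs t ht)) (hZ.smul hs')
  -- The edge s = 1 carries the translated path and the edge s = 0 the original one. On each of the
  -- other two edges the function is a polynomial in `s` of degree at most 2d and costs at most 2dπ.
  have key := argVar_rectangle (F := fun s t : ℝ => pencilDet (complexify (β t)) ((s : ℂ) • Z))
    zero_le_one hab hF hF0
  have hrad : ∀ t ∈ Icc a b,
      |argVar (fun s : ℝ => pencilDet (complexify (β t)) ((s : ℂ) • Z)) 0 1| ≤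
        2 * d * Real.pi := by
    intro t ht
    have h1 := abs_argVar_det_le (complexify (β t) * projMinus d - projPlus d)
      ((complexify (β t) * projPlus d - projMinus d) * Z) fun z hz => by
        have := hF0 z hz t ht
        rwa [pencilDet, Matrix.mul_smul] at this
    simp only [Fintype.card_sum, Fintype.card_fin] at h1
    push_cast at h1
    rw [← two_mul] at h1
    simpa only [pencilDet, Matrix.mul_smul] using h1
  have e1 : argVar (fun t => rotationDet (β t * N)) a b =
      argVar (fun t => pencilDet (complexify (β t)) (((1 : ℝ) : ℂ) • Z)) a b := by
    refine (argVar_congr fun t _ => ?_).trans (argVar_const_mul hab ⟨hF.comp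
      (f := fun t => ((1 : ℝ), t)) (by fun_prop) fun t ht => ⟨right_mem_Icc.2 zero_le_one, ht⟩,
      hF0 1 (right_mem_Icc.2 zero_le_one)⟩ hc0)
    simp only [Function.comp_apply]
    rw [rotationDet, map_mul, hcoc, Complex.ofReal_one, one_smul]
  have e0 : argVar (fun t => rotationDet (β t)) a b =
      argVar (fun t => pencilDet (complexify (β t)) (((0 : ℝ) : ℂ) • Z)) a b := by
    simp only [Complex.ofReal_zero, zero_smul, rotationDet]
  have ha := abs_le.1 (hrad a (left_mem_Icc.2 hab))
  have hb := abs_le.1 (hrad b (right_mem_Icc.2 hab))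
  rw [e1, e0, abs_le]
  constructor <;> linarith

/-- On [a, a + u] the path is the solution restarted at I, right translated by the constant `γ a`.
-/
theorem abs_argVar_rotationDet_shift_sub_le {d : ℕ} {B γ : ℝ → PhaseMatrix d}
    (hB : ∀ t, (B t).IsSymm) (h : IsFundamentalSolution B γ) (a : ℝ) {u : ℝ} (hu : 0 ≤ u) :
    |argVar (fun t => rotationDet (γ t)) a (a + u) -
      argVar (fun t => rotationDet (γ (a + t) * (γ a)⁻¹)) 0 u| ≤ 4 * d * Real.pi := by
  have hsh := h.shift hB a
  have hsym := hsh.mem_symplecticGroup fun t => hB (a + t)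
  have h1 := abs_argVar_rotationDet_mul_sub_le hu hsh.continuous.continuousOn (fun t _ => hsym t)
    (h.mem_symplecticGroup hB a)
  have h2 := argVar_comp_monotone (g := fun t => rotationDet (γ t)) (u := fun t => a + t) hu
    (by fun_prop) (fun x _ y _ hxy => by simpa using hxy)
    (nonvanishingOn_rotationDet h.continuous.continuousOn fun t _ => h.mem_symplecticGroup hB t)
  have h3 : argVar (fun t => rotationDet (γ (a + t) * (γ a)⁻¹ * γ a)) 0 u =
      argVar (fun t => rotationDet (γ (a + t))) 0 u := argVar_congr fun t _ => by
    rw [Matrix.nonsing_inv_mul_cancel_right _ _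
      (SymplecticGroup.symplectic_det (h.mem_symplecticGroup hB a))]
  rw [h3, h2, add_zero] at h1
  exact h1

/-- Nearby systems have nearby mean rotation, up to bounded errors on time windows of length
`T`. -/
theorem exists_abs_rotation_sub_le {d : ℕ} (K T : ℝ) (hK : 0 ≤ K) (hT : 0 < T) :
    ∃ δ > 0, ∀ B B' γ γ' : ℝ → PhaseMatrix d, (∀ t, (B t).IsSymm) → (∀ t, (B' t).IsSymm) →
      (∀ t, ‖B t‖ ≤ K) → (∀ t, ‖B' t‖ ≤ K) →
      (∀ t, ‖B t - B' t‖ ≤ δ) → IsFundamentalSolution B γ → IsFundamentalSolution B' γ' →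
      ∀ l, 0 ≤ l → |argVar (fun t => rotationDet (γ t)) 0 l -
        argVar (fun t => rotationDet (γ' t)) 0 l| ≤ (l / T + 1) * ((8 * d + 1) * Real.pi) := by
  obtain ⟨δ, hδ, hwin⟩ := exists_abs_argVar_rotationDet_sub_le (d := d) K T hK
  refine ⟨δ, hδ, fun B B' γ γ' hs hs' hB hB' hBB h h' => ?_⟩
  -- Restarting costs 4dπ for each of the two systems, and comparing the restarted solutions costs
  -- π.
  have window : ∀ a u, u ∈ Icc 0 T → |argVar (fun t => rotationDet (γ t)) a (a + u) -
      argVar (fun t => rotationDet (γ' t)) a (a + u)| ≤ (8 * d + 1) * Real.pi := by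
    intro a u hu
    have h1 := abs_le.1 (abs_argVar_rotationDet_shift_sub_le hs h a hu.1)
    have h2 := abs_le.1 (abs_argVar_rotationDet_shift_sub_le hs' h' a hu.1)
    have h3 := abs_le.1 (hwin _ _ _ _ (fun t => hs (a + t)) (fun t => hs' (a + t))
      (fun t => hB (a + t)) (fun t => hB' (a + t)) (fun t => hBB (a + t)) (h.shift hs a)
      (h'.shift hs' a) u hu)
    rw [abs_le]
    constructor <;> linarith
  have hc0 : 0 ≤ (8 * d + 1) * Real.pi := by positivity
  have hnv := fun a b => nonvanishingOn_rotationDet (a := a) (b := b) h.continuous.continuousOn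
    fun t _ => h.mem_symplecticGroup hs t
  have hnv' := fun a b => nonvanishingOn_rotationDet (a := a) (b := b) h'.continuous.continuousOn
    fun t _ => h'.mem_symplecticGroup hs' t
  have iter : ∀ n : ℕ, ∀ l ∈ Icc 0 (n * T), |argVar (fun t => rotationDet (γ t)) 0 l -
      argVar (fun t => rotationDet (γ' t)) 0 l| ≤ n * ((8 * d + 1) * Real.pi) := by
    intro n
    induction n with
    | zero =>
      intro l hl
      have hl0 : l = 0 := le_antisymm (by simpa using hl.2) hl.1
      have := window 0 0 ⟨le_rfl, hT.le⟩
      have z := argVar_add le_rfl le_rfl (hnv 0 0)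
      have z' := argVar_add le_rfl le_rfl (hnv' 0 0)
      rw [hl0, add_eq_left.1 z, add_eq_left.1 z']
      simp
    | succ n ih =>
      intro l hl
      push_cast at hl ⊢
      -- The last window starts at this point; the maximum handles the case l < T.
      have ha0 : 0 ≤ max (l - T) 0 := le_max_right _ _
      have hal : max (l - T) 0 ≤ l := max_le (by linarith) hl.1
      have h1 := abs_le.1 (ih (max (l - T) 0)
        ⟨ha0, max_le (by linarith [hl.2]) (by positivity)⟩)
      have h2 := abs_le.1 (window (max (l - T) 0) (l - max (l - T) 0)
        ⟨by linarith, by linarith [le_max_left (l - T) 0]⟩)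
      rw [add_sub_cancel] at h2
      rw [← argVar_add ha0 hal (hnv 0 l), ← argVar_add ha0 hal (hnv' 0 l), abs_le]
      constructor <;> linarith
  intro l hl
  have h1 := iter ⌈l / T⌉₊ l ⟨hl, by
    rw [← div_le_iff₀ hT]; exact Nat.le_ceil _⟩
  refine h1.trans ?_
  gcongr
  exact (Nat.ceil_lt_add_one (by positivity)).le

/-! ### Existence of the index and its distance to the rotation. -/

theorem exp_neg_smul_J {d : ℕ} (ε : ℝ) : NormedSpace.exp (-(ε • stdJ d)) = rot d (-ε) := by
  rw [← neg_smul, exp_smul_J]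

theorem rotationDet_one_ne_zero {d : ℕ} : rotationDet (1 : PhaseMatrix d) ≠ 0 :=
  rotationDet_ne_zero (one_mem _)

theorem argVar_rotationDet_rot_mul {d : ℕ} {γ : ℝ → PhaseMatrix d} {a b : ℝ} (hab : a ≤ b)
    (hc : ContinuousOn γ (Icc a b))
    (hs : ∀ u ∈ Icc a b, γ u ∈ Matrix.symplecticGroup (Fin d) ℝ) (x : ℝ) :
    argVar (fun t => rotationDet (rot d x * γ t)) a b =
      argVar (fun t => rotationDet (γ t)) a b := by
  have h1 := argVar_const_mul hab (nonvanishingOn_rotationDet (β := fun t => rot d x * γ t)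
    (continuousOn_const.mul hc) fun u hu => mul_mem (rot_mem x) (hs u hu))
    (rotationDet_one_ne_zero (d := d))
  have h2 := argVar_const_mul hab (nonvanishingOn_rotationDet hc hs)
    (rotationDet_ne_zero (rot_mem (d := d) x))
  rw [← h1, ← h2]
  exact argVar_congr fun t _ => rotationDet_rot_mul x (γ t)

/-- The factor exp(-εJ) does not change the rotation. Each endpoint contributes at most 2dπ, and the
normalization by `d` in the index another dπ. -/
theorem IsMaslovIndex.abs_pi_mul_sub_le {d : ℕ} {γ : ℝ → PhaseMatrix d} {l : ℝ} {k : ℤ}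
    (hl : 0 < l) (hc : Continuous γ) (hs : ∀ u, γ u ∈ Matrix.symplecticGroup (Fin d) ℝ)
    (h : IsMaslovIndex γ l k) :
    |Real.pi * k - argVar (fun t => rotationDet (γ t)) 0 l| ≤ 5 * d * Real.pi := by
  obtain ⟨ε, hε⟩ := h.exists
  have h1 := hε.pi_mul_eq hl
  have hrad : ∀ t, NormedSpace.exp (-(ε • stdJ d)) * γ t ∉ singularCycle d →
      |radialVar (NormedSpace.exp (-(ε • stdJ d)) * γ t)| ≤ 2 * d * Real.pi := by
    intro t ht
    have hm : NormedSpace.exp (-(ε • stdJ d)) * γ t ∈ Matrix.symplecticGroup (Fin d) ℝ := by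
      rw [exp_neg_smul_J]
      exact mul_mem (rot_mem _) (hs t)
    exact abs_radialVar_le hm fun h0 => ht ⟨hm, h0⟩
  have h2 := abs_le.1 (hrad 0 hε.1)
  have h3 := abs_le.1 (hrad l hε.2.1)
  simp only [exp_neg_smul_J] at h1 h2 h3
  rw [argVar_rotationDet_rot_mul hl.le hc.continuousOn fun u _ => hs u] at h1
  push_cast at h1
  have h4 : 0 ≤ d * Real.pi := by positivity
  rw [abs_le]
  constructor <;> nlinarith

theorem rot_mulVec_dotProduct_self {d : ℕ} (x : ℝ) (v : Fin d ⊕ Fin d → ℝ) :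
    (rot d x *ᵥ v) ⬝ᵥ (rot d x *ᵥ v) = v ⬝ᵥ v := by
  rw [Matrix.dotProduct_mulVec, ← Matrix.mulVec_transpose, rot_transpose, Matrix.mulVec_mulVec,
    rot_mul, neg_add_cancel, rot_zero, Matrix.one_mulVec]

theorem dotProduct_rot_conj {d : ℕ} (x : ℝ) (B : PhaseMatrix d) (v : Fin d ⊕ Fin d → ℝ) :
    v ⬝ᵥ ((rot d x * B * rot d (-x)) *ᵥ v) =
      (rot d (-x) *ᵥ v) ⬝ᵥ (B *ᵥ (rot d (-x) *ᵥ v)) := by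
  rw [mul_assoc, ← Matrix.mulVec_mulVec, Matrix.dotProduct_mulVec, ← Matrix.mulVec_transpose,
    rot_transpose, Matrix.mulVec_mulVec]

/-- The path `exp (x J) γ` along curves `x = p t`, `q t`. -/
theorem hasDerivAt_rot_mul {d : ℕ} {B γ : ℝ → PhaseMatrix d} (h : IsFundamentalSolution B γ)
    {p q : ℝ → ℝ} {p' q' t : ℝ} (hp : HasDerivAt p p' t) (hq : HasDerivAt q q' t) :
    HasDerivAt (fun t => rot d (p t) * γ (q t))
      (stdJ d * (p' • 1 + q' • (rot d (p t) * B (q t) * rot d (-p t))) *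
        (rot d (p t) * γ (q t))) t := by
  have h1 := (hasDerivAt_rot (d := d) (p t)).scomp t hp
  have h2 := (h.2 (q t)).scomp t hq
  refine HasDerivAt.congr_deriv (h1.mul h2) ?_
  have e1 : rot d (-p t) * rot d (p t) = 1 := by rw [rot_mul, neg_add_cancel, rot_zero]
  have e2 := rot_mul_J (d := d) (p t)
  have e3 : stdJ d * (rot d (p t) * B (q t) * rot d (-p t)) * (rot d (p t) * γ (q t)) =
      rot d (p t) * (stdJ d * B (q t) * γ (q t)) := by
    calc _ = stdJ d * rot d (p t) * B (q t) * (rot d (-p t) * rot d (p t)) * γ (q t) := by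
          simp only [mul_assoc]
      _ = _ := by rw [e1, ← e2]; simp only [mul_assoc, one_mul]
  simp only [Function.comp_apply, smul_mul_assoc, mul_smul_comm, mul_add, add_mul, mul_one, e3]
  simp only [mul_assoc]

theorem IsFundamentalSolution.contDiff {d : ℕ} {B γ : ℝ → PhaseMatrix d} (hB : Continuous B)
    (h : IsFundamentalSolution B γ) : ContDiff ℝ 1 γ := by
  rw [contDiff_one_iff_deriv]
  refine ⟨fun t => (h.2 t).differentiableAt, ?_⟩
  have : deriv γ = fun t => stdJ d * B t * γ t := funext fun t => (h.2 t).deriv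
  rw [this]
  exact (continuous_const.mul hB).mul h.continuous

/-- The path may have degenerate crossings, so it is deformed to exp(pJ)γ(q). With w running from 1
to -1, p' is proportional to w and q' to w², so the crossing form is w(4c/l + 3wB̃), where B̃ is a
rotated copy of B. For w ≠ 0 it is definite because c exceeds Kl; at the midpoint, where w = 0, the
path is kept off Σ. -/
theorem exists_isIntersectionNumber {d : ℕ} {B γ : ℝ → PhaseMatrix d} {K l : ℝ} (hl : 0 < l)
    (hB : Continuous B) (hsymm : ∀ t, (B t).IsSymm) (hK : ∀ t, ‖B t‖ ≤ K)
    (h : IsFundamentalSolution B γ) {ε : ℝ} (h0 : (rot d (-ε) * γ 0 - 1).det ≠ 0)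
    (h1 : (rot d (-ε) * γ l - 1).det ≠ 0) :
    ∃ k : ℤ, IsIntersectionNumber (fun t => rot d (-ε) * γ t) l k := by
  have hs := h.mem_symplecticGroup hsymm
  have hK0 : 0 ≤ K := (norm_nonneg _).trans (hK 0)
  -- `y` is the rotation angle at the midpoint: generic enough to avoid Σ there, and large enough
  -- for c = y + ε to dominate K l.
  obtain ⟨y, hy, hyK⟩ : ∃ y, (rot d y * γ (l / 2) - 1).det ≠ 0 ∧ K * l + 1 - ε < y := by
    have hy : ∀ᶠ u in 𝓝[>] (K * l + 1 - ε), (rot d u * γ (l / 2) - 1).det ≠ 0 :=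
      (eventually_det_rot_mul_ne_zero (hs (l / 2)) (K * l + 1 - ε)).filter_mono
        (nhdsWithin_mono _ fun x (hx : K * l + 1 - ε < x) => hx.ne')
    exact (hy.and (eventually_mem_nhdsWithin (s := Ioi (K * l + 1 - ε)))).exists
  obtain ⟨c, hc⟩ : ∃ c, c = y + ε := ⟨_, rfl⟩
  have hcK : K * l + 1 < c := by rw [hc]; linarith
  let w : ℝ → ℝ := fun t => 1 - 2 * t / l
  let p : ℝ → ℝ := fun t => c * (1 - w t ^ 2) - ε
  let q : ℝ → ℝ := fun t => l * (1 - w t ^ 3) / 2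
  let β : ℝ → PhaseMatrix d := fun t => rot d (p t) * γ (q t)
  have hw : ∀ t, HasDerivAt w (-(2 / l)) t := fun t => by
    have := (((hasDerivAt_id t).const_mul 2).div_const l).const_sub 1
    simpa using this
  have hp : ∀ t, HasDerivAt p (4 * c / l * w t) t := fun t => by
    have := ((((hw t).pow 2).const_sub 1).const_mul c).sub_const ε
    refine this.congr_deriv ?_
    field_simp
    simp
    ring
  have hq : ∀ t, HasDerivAt q (3 * w t ^ 2) t := fun t => by
    have := ((((hw t).pow 3).const_sub 1).const_mul l).div_const 2
    refine this.congr_deriv ?_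
    field_simp
    simp
  have hw0 : w 0 = 1 := by simp [w]
  have hwl : w l = -1 := by simp only [w]; field_simp; norm_num
  have hp0 : p 0 = -ε := by simp only [p, hw0]; ring
  have hpl : p l = -ε := by simp only [p, hwl]; ring
  have hq0 : q 0 = 0 := by simp only [q, hw0]; ring
  have hql : q l = l := by simp only [q, hwl]; ring
  have hwc : ContDiff ℝ 1 w := by
    exact contDiff_const.sub ((contDiff_const.mul contDiff_id).div_const l)
  have hβd := fun t => hasDerivAt_rot_mul h (hp t) (hq t)
  have hβc : ContDiff ℝ 1 β := by
    refine ContDiff.mul (contDiff_rot.comp ?_) ((h.contDiff hB).comp ?_)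
    · exact (contDiff_const.mul (contDiff_const.sub (hwc.pow 2))).sub contDiff_const
    · exact (contDiff_const.mul (contDiff_const.sub (hwc.pow 3))).div_const 2
  have hβs : ∀ t, β t ∈ Matrix.symplecticGroup (Fin d) ℝ := fun t => mul_mem (rot_mem _) (hs _)
  have hreg : ∀ t ∈ Icc 0 l, (β t - 1).det = 0 → (QuadraticMap.associated (R := ℝ)
      (crossingForm (β t) (deriv β t))).SeparatingLeft := by
    intro t ht hdet
    refine crossingForm_separatingLeft (hβd t).deriv fun v hv => ?_
    have hvv := dotProduct_self_pos hv
    have hwt : w t ≠ 0 := by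
      intro hwt
      have htl : t = l / 2 := by
        simp only [w] at hwt
        field_simp at hwt
        linarith
      have e1 : p t = y := by simp only [p, hwt, hc]; ring
      have e2 : q t = l / 2 := by simp only [q, hwt]; ring
      simp only [β, e1, e2] at hdet
      exact hy hdet
    have hw1 : |w t| ≤ 1 := by
      rw [abs_le]
      simp only [w]
      have h2 : 2 * t / l ≤ 2 := by rw [div_le_iff₀ hl]; linarith [ht.2]
      have h3 : 0 ≤ 2 * t / l := by have := ht.1; positivity
      constructor <;> linarith
    have hBt : |(rot d (-p t) *ᵥ v) ⬝ᵥ (B (q t) *ᵥ (rot d (-p t) *ᵥ v))| ≤ K * (v ⬝ᵥ v) := by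
      refine (abs_dotProduct_mulVec_le _ _).trans ?_
      rw [rot_mulVec_dotProduct_self]
      exact mul_le_mul_of_nonneg_right (hK _) hvv.le
    rw [Matrix.add_mulVec, dotProduct_add, Matrix.smul_mulVec, Matrix.smul_mulVec,
      dotProduct_smul, dotProduct_smul, Matrix.one_mulVec, dotProduct_rot_conj, smul_eq_mul,
      smul_eq_mul]
    intro hzero
    set b := (rot d (-p t) *ᵥ v) ⬝ᵥ (B (q t) *ᵥ (rot d (-p t) *ᵥ v)) with hb
    have hz1 : w t * (4 * c / l * (v ⬝ᵥ v) + 3 * w t * b) = 0 := by linear_combination hzero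
    have hz2 := (mul_eq_zero.1 hz1).resolve_left hwt
    have hz3 : |3 * w t * b| ≤ 3 * K * (v ⬝ᵥ v) := by
      rw [abs_mul, abs_mul, abs_of_pos (by norm_num : (0 : ℝ) < 3)]
      nlinarith [abs_nonneg b, abs_nonneg (w t)]
    have hz4 : 3 * K < 4 * c / l := by
      rw [lt_div_iff₀ hl]
      nlinarith [mul_nonneg hK0 hl.le]
    have := (abs_le.1 hz3).1
    nlinarith
  have hfin := finite_crossings hβc.continuous (hβc.differentiable one_ne_zero) hβs hreg
  have hends : ∀ t, (t = 0 ∨ t = l) → β t = rot d (-ε) * γ t := by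
    rintro t (rfl | rfl)
    · simp only [β, hp0, hq0]
    · simp only [β, hpl, hql]
  refine ⟨_, fun hmem => h0 hmem.2, fun hmem => h1 hmem.2, β, hfin.toFinset, ?_, hβc.contDiffOn,
    fun t => ?_, fun t ht => ?_, rfl⟩
  -- The homotopy interpolates angle and time linearly; both are already correct at t = 0 and t = l.
  · let P : ℝ → ℝ → PhaseMatrix d := fun s t =>
      rot d (s * (p t + ε) - ε) * γ ((1 - s) * t + s * q t)
    have hpc : Continuous p := continuous_iff_continuousAt.2 fun t => (hp t).continuousAt
    have hqc : Continuous q := continuous_iff_continuousAt.2 fun t => (hq t).continuousAt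
    have hP : Continuous fun x : ℝ × ℝ => P x.1 x.2 := by
      refine Continuous.mul (contDiff_rot.continuous.comp ?_) (h.continuous.comp ?_) <;> fun_prop
    have hPs : ∀ s t, P s t ∈ Matrix.symplecticGroup (Fin d) ℝ := fun s t =>
      mul_mem (rot_mem _) (hs _)
    have hP0 : ∀ t, P 0 t = rot d (-ε) * γ t := fun t => by simp [P]
    have hP1 : ∀ t, P 1 t = β t := fun t => by simp [P, β]
    let H : C(unitInterval × Icc (0 : ℝ) l, Matrix.symplecticGroup (Fin d) ℝ) :=
      ⟨fun x => ⟨P x.1 x.2, hPs _ _⟩, Continuous.subtype_mk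
        (hP.comp ((continuous_subtype_val.comp continuous_fst).prodMk
          (continuous_subtype_val.comp continuous_snd))) _⟩
    refine ⟨H.comp ⟨fun t => (0, t), by fun_prop⟩, H.comp ⟨fun t => (1, t), by fun_prop⟩,
      fun t => ?_, fun t => ?_, ⟨⟨⟨H, fun t => rfl, fun t => rfl⟩, fun s t ht => ?_⟩⟩⟩
    · exact hP0 t
    · exact hP1 t
    · refine Subtype.ext ?_
      change P s t = P ((0 : unitInterval) : ℝ) t
      rw [show ((0 : unitInterval) : ℝ) = 0 from rfl, hP0]
      rcases ht with ht | ht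
      · simp [P, ht, hp0, hq0]
      · simp [P, ht, hpl, hql]
        ring_nf
  · rw [Set.Finite.mem_toFinset]
    constructor
    · rintro ⟨ht, hdet⟩
      refine ⟨⟨lt_of_le_of_ne ht.1 ?_, lt_of_le_of_ne ht.2 ?_⟩, hβs t, hdet⟩
      · rintro rfl
        rw [hends 0 (Or.inl rfl)] at hdet
        exact h0 hdet
      · rintro rfl
        rw [hends t (Or.inr rfl)] at hdet
        exact h1 hdet
    · rintro ⟨ht, hdet⟩
      exact ⟨Ioo_subset_Icc_self ht, hdet.2⟩
  · have ht' := (Set.Finite.mem_toFinset hfin).1 ht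
    exact hreg t ht'.1 ht'.2

/-- The change under rotation does not involve `M`, because `rotationDet` of a rotated matrix splits
into two factors. It therefore cancels between the two endpoints of a path. -/
theorem radialVar_rot_sub {d : ℕ} {M : PhaseMatrix d} (hM : M ∈ Matrix.symplecticGroup (Fin d) ℝ)
    {a b : ℝ} (hab : a ≤ b) (h : ∀ ε ∈ Icc a b, (rot d (-ε) * M - 1).det ≠ 0) :
    radialVar (rot d (-a) * M) - radialVar (rot d (-b) * M) =
      argVar (fun ε => rotationDet (rot d (-ε))) a b := by
  have hrot : Continuous fun ε => rot d (-ε) := contDiff_rot.continuous.comp continuous_neg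
  rw [← argVar_rotationDet_of_forall_det_ne_zero (β := fun ε => rot d (-ε) * M) hab
    (hrot.mul continuous_const).continuousOn (fun ε _ => mul_mem (rot_mem _) hM) h]
  have h1 := argVar_const_mul hab (nonvanishingOn_rotationDet (β := fun ε => rot d (-ε) * M)
    (hrot.mul continuous_const).continuousOn fun ε _ => mul_mem (rot_mem _) hM)
    (rotationDet_one_ne_zero (d := d))
  have h2 := argVar_const_mul hab (nonvanishingOn_rotationDet (β := fun ε => rot d (-ε))
    hrot.continuousOn fun ε _ => rot_mem _) (rotationDet_ne_zero hM)
  rw [← h1, ← h2]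
  refine argVar_congr fun ε _ => ?_
  rw [rotationDet_rot_mul, mul_comm]

/-- For small ε > 0 both endpoints of the rotated path avoid Σ. By `IsIntersectionNumber.pi_mul_eq`
the intersection number depends on ε only through a difference of endpoint terms, and this
difference is constant, so one integer serves all small ε. -/
theorem exists_isMaslovIndex {d : ℕ} {B γ : ℝ → PhaseMatrix d} {K l : ℝ} (hl : 0 < l)
    (hB : Continuous B) (hsymm : ∀ t, (B t).IsSymm) (hK : ∀ t, ‖B t‖ ≤ K)
    (h : IsFundamentalSolution B γ) : ∃ k : ℤ, IsMaslovIndex γ l k := by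
  have hs := h.mem_symplecticGroup hsymm
  have hev : ∀ t, ∀ᶠ ε in 𝓝[>] (0 : ℝ), (rot d (-ε) * γ t - 1).det ≠ 0 := by
    intro t
    have h1 := eventually_det_rot_mul_ne_zero (hs t) 0
    have h2 : Tendsto (fun ε : ℝ => -ε) (𝓝[>] 0) (𝓝[≠] 0) := by
      refine tendsto_nhdsWithin_iff.2 ⟨?_, ?_⟩
      · have : Tendsto (fun ε : ℝ => -ε) (𝓝 0) (𝓝 (-0)) := tendsto_id.neg
        rw [neg_zero] at this
        exact this.mono_left nhdsWithin_le_nhds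
      · filter_upwards [self_mem_nhdsWithin] with ε hε
        exact neg_ne_zero.2 (ne_of_gt hε)
    exact h2.eventually h1
  obtain ⟨ε0, hε0, hsub⟩ := mem_nhdsGT_iff_exists_Ioo_subset.1 ((hev 0).and (hev l))
  have hex : ∀ ε ∈ Ioo 0 ε0, ∃ k : ℤ, IsIntersectionNumber (fun t => rot d (-ε) * γ t) l k :=
    fun ε hε => exists_isIntersectionNumber hl hB hsymm hK h (hsub hε).1 (hsub hε).2
  have hval : ∀ ε ∈ Ioo 0 ε0, ∀ k : ℤ, IsIntersectionNumber (fun t => rot d (-ε) * γ t) l k →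
      Real.pi * k = argVar (fun t => rotationDet (γ t)) 0 l - radialVar (rot d (-ε) * γ 0) +
        radialVar (rot d (-ε) * γ l) := by
    intro ε _ k hk
    have := hk.pi_mul_eq hl
    rwa [argVar_rotationDet_rot_mul hl.le h.continuous.continuousOn fun u _ => hs u] at this
  have hconst : ∀ a b, a ∈ Ioo 0 ε0 → b ∈ Ioo 0 ε0 → a ≤ b →
      radialVar (rot d (-a) * γ l) - radialVar (rot d (-a) * γ 0) =
        radialVar (rot d (-b) * γ l) - radialVar (rot d (-b) * γ 0) := by
    intro a b ha hb hab
    have hmem : ∀ ε ∈ Icc a b, ε ∈ Ioo 0 ε0 := fun ε hε =>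
      ⟨ha.1.trans_le hε.1, hε.2.trans_lt hb.2⟩
    have e1 := radialVar_rot_sub (hs l) hab fun ε hε => (hsub (hmem ε hε)).2
    have e2 := radialVar_rot_sub (hs 0) hab fun ε hε => (hsub (hmem ε hε)).1
    linarith
  have hmid : ε0 / 2 ∈ Ioo 0 ε0 := by
    have : 0 < ε0 := hε0
    constructor <;> linarith
  obtain ⟨k, hk⟩ := hex _ hmid
  refine ⟨k - d, ?_⟩
  filter_upwards [Ioo_mem_nhdsGT hε0] with ε hε
  obtain ⟨k', hk'⟩ := hex ε hε
  have e1 := hval _ hmid k hk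
  have e2 := hval ε hε k' hk'
  have e3 : radialVar (rot d (-ε) * γ l) - radialVar (rot d (-ε) * γ 0) =
      radialVar (rot d (-(ε0 / 2)) * γ l) - radialVar (rot d (-(ε0 / 2)) * γ 0) := by
    rcases le_total ε (ε0 / 2) with hle | hle
    · exact hconst _ _ hε hmid hle
    · exact (hconst _ _ hmid hε hle).symm
  have e4 : Real.pi * k = Real.pi * k' := by linarith
  have e5 : k = k' := by exact_mod_cast mul_left_cancel₀ Real.pi_ne_zero e4
  rw [sub_add_cancel, e5]
  simpa only [exp_neg_smul_J] using hk'

theorem maslovIndex_spec {d : ℕ} {B γ : ℝ → PhaseMatrix d} {K l : ℝ} (hl : 0 < l)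
    (hB : Continuous B) (hsymm : ∀ t, (B t).IsSymm) (hK : ∀ t, ‖B t‖ ≤ K)
    (h : IsFundamentalSolution B γ) :
    |Real.pi * maslovIndex γ l - argVar (fun t => rotationDet (γ t)) 0 l| ≤
      5 * d * Real.pi :=
  IsMaslovIndex.abs_pi_mul_sub_le hl h.continuous (h.mem_symplecticGroup hsymm)
    (Classical.epsilon_spec (exists_isMaslovIndex hl hB hsymm hK h))

theorem fundamentalSolution_spec {d : ℕ} {B : ℝ → PhaseMatrix d} {K : ℝ} (hB : Continuous B)
    (hK : ∀ t, ‖B t‖ ≤ K) : IsFundamentalSolution B (fundamentalSolution B) :=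
  Classical.epsilon_spec (exists_isFundamentalSolution hB hK)

/-! ### Index estimates. -/

/-- The window length (8d + 1)/η turns the loss per window into ηπ per unit of time. The constant
collects 8d + 1 for the extra window and 5d twice for passing from index to rotation. -/
theorem exists_abs_maslovIndex_sub_le (d : ℕ) {K η : ℝ} (hK : 0 ≤ K) (hη : 0 < η) :
    ∃ δ > 0, ∀ B B' γ γ' : ℝ → PhaseMatrix d, Continuous B → Continuous B' →
      (∀ t, (B t).IsSymm) → (∀ t, (B' t).IsSymm) → (∀ t, ‖B t‖ ≤ K) → (∀ t, ‖B' t‖ ≤ K) →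
      (∀ t, ‖B t - B' t‖ ≤ δ) → IsFundamentalSolution B γ → IsFundamentalSolution B' γ' →
      ∀ l, 0 < l → |(maslovIndex γ l : ℝ) - maslovIndex γ' l| ≤ η * l + (18 * d + 1) := by
  have hD : (0 : ℝ) < 8 * d + 1 := by positivity
  obtain ⟨δ, hδ, H⟩ := exists_abs_rotation_sub_le (d := d) K ((8 * d + 1) / η) hK
    (div_pos hD hη)
  refine ⟨δ, hδ, fun B B' γ γ' hB hB' hs hs' hb hb' hd hγ hγ' l hl => ?_⟩
  have h1 := maslovIndex_spec hl hB hs hb hγ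
  have h2 := maslovIndex_spec hl hB' hs' hb' hγ'
  have h3 := H B B' γ γ' hs hs' hb hb' hd hγ hγ' l hl.le
  have h4 : (l / ((8 * d + 1) / η) + 1) * ((8 * d + 1) * Real.pi) =
      Real.pi * (η * l + (8 * d + 1)) := by
    field_simp
  rw [h4] at h3
  refine le_of_mul_le_mul_left ?_ Real.pi_pos
  rw [← abs_of_pos Real.pi_pos, ← abs_mul, abs_of_pos Real.pi_pos]
  rw [abs_le] at *
  constructor <;> linarith [h1.1, h1.2, h2.1, h2.2, h3.1, h3.2]

theorem abs_maslovIndex_le_of_zero {d : ℕ} {γ : ℝ → PhaseMatrix d}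
    (h : IsFundamentalSolution 0 γ) {l : ℝ} (hl : 0 < l) : |(maslovIndex γ l : ℝ)| ≤ 5 * d := by
  have hγ : ∀ t, γ t = 1 := fun t => by
    rw [← h.1]
    refine is_const_of_deriv_eq_zero (𝕜 := ℝ) (fun t => (h.2 t).differentiableAt) (fun t => ?_) _ _
    rw [(h.2 t).deriv]
    simp
  have h1 := maslovIndex_spec (K := 0) hl continuous_zero
    (fun t => Matrix.isSymm_zero) (fun t => by simp) h
  simp only [hγ] at h1
  rw [argVar_const hl.le rotationDet_one_ne_zero, sub_zero, abs_mul, abs_of_pos Real.pi_pos] at h1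
  exact le_of_mul_le_mul_left (by linarith) Real.pi_pos

/-- The systems (j/n)B join 0 to B inside the ball of radius `K`, and n > K/δ makes neighbours
δ-close. Each step costs at most l + 18d + 1, and the zero system has index at most 5d in absolute
value. -/
theorem exists_abs_maslovIndex_le (d : ℕ) {K : ℝ} (hK : 0 ≤ K) :
    ∃ C, ∀ B γ : ℝ → PhaseMatrix d, Continuous B → (∀ t, (B t).IsSymm) → (∀ t, ‖B t‖ ≤ K) →
      IsFundamentalSolution B γ → ∀ l, 1 ≤ l → |(maslovIndex γ l : ℝ)| ≤ C * l := by
  obtain ⟨δ, hδ, H⟩ := exists_abs_maslovIndex_sub_le d hK one_pos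
  obtain ⟨n, hn⟩ := exists_nat_gt (K / δ)
  have hn0 : (0 : ℝ) < n := (div_nonneg hK hδ.le).trans_lt hn
  rw [div_lt_iff₀ hδ] at hn
  refine ⟨n * (18 * d + 2) + 5 * d, fun B γ hB hs hb hγ l hl => ?_⟩
  have hl0 : 0 < l := one_pos.trans_le hl
  have hj : ∀ j : ℕ, j ≤ n → ∀ γ, IsFundamentalSolution (fun t => ((j : ℝ) / n) • B t) γ →
      |(maslovIndex γ l : ℝ)| ≤ j * (l + (18 * d + 1)) + 5 * d := by
    have hnorm : ∀ j : ℕ, j ≤ n → ∀ t, ‖((j : ℝ) / n) • B t‖ ≤ K := fun j hjn t => by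
      rw [norm_smul, Real.norm_of_nonneg (by positivity)]
      have : (j : ℝ) / n ≤ 1 := (div_le_one hn0).2 (by exact_mod_cast hjn)
      exact (mul_le_of_le_one_left (norm_nonneg _) this).trans (hb t)
    intro j
    induction j with
    | zero =>
      intro _ γ hγ
      simpa using abs_maslovIndex_le_of_zero
        (show IsFundamentalSolution 0 γ by
          convert hγ using 1
          funext t
          simp) hl0
    | succ j ih =>
      intro hjn γ hγ
      have hjn' : j ≤ n := j.le_succ.trans hjn
      have hc : ∀ c : ℝ, Continuous fun t => c • B t := fun c => hB.const_smul c
      obtain ⟨γ', hγ'⟩ := exists_isFundamentalSolution (hc _) (hnorm j hjn')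
      have h1 := ih hjn' γ' hγ'
      have h2 := H _ _ γ γ' (hc _) (hc _) (fun t => (hs t).smul _) (fun t => (hs t).smul _)
        (hnorm _ hjn) (hnorm _ hjn') (fun t => ?_) hγ hγ' l hl0
      · push_cast
        rw [abs_le] at *
        constructor <;> linarith [h1.1, h1.2, h2.1, h2.2]
      · rw [← sub_smul, ← sub_div, norm_smul, Nat.cast_succ, add_sub_cancel_left,
          Real.norm_of_nonneg (by positivity), one_div, inv_mul_le_iff₀ hn0]
        exact (hb t).trans (by linarith)
  refine (hj n le_rfl γ (by simpa [div_self hn0.ne'] using hγ)).trans ?_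
  have hd : (0 : ℝ) ≤ d := d.cast_nonneg
  have h5 : (18 * d + 1 : ℝ) ≤ (18 * d + 1) * l := le_mul_of_one_le_right (by positivity) hl
  have h6 : (5 * d : ℝ) ≤ 5 * d * l := le_mul_of_one_le_right (by positivity) hl
  have h7 := mul_le_mul_of_nonneg_left h5 hn0.le
  linarith

theorem IsFundamentalSolution.comp_neg {d : ℕ} {B γ : ℝ → PhaseMatrix d}
    (h : IsFundamentalSolution B γ) :
    IsFundamentalSolution (fun t => -B (-t)) (fun t => γ (-t)) := by
  refine ⟨by simpa using h.1, fun t => ?_⟩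
  refine ((h.2 (-t)).scomp t (hasDerivAt_neg t)).congr_deriv ?_
  simp

/-! ### Upper and lower limits in the extended reals. -/

theorem limsup_coe_le_add {f g : ℝ → ℝ} {η : ℝ} (h : ∀ᶠ l in atTop, |f l - g l| ≤ η) :
    limsup (fun l => (f l : EReal)) atTop ≤ limsup (fun l => (g l : EReal)) atTop + η := by
  have hη : limsup (fun _ : ℝ => (η : EReal)) atTop = η := limsup_const _
  refine le_trans ?_ ((EReal.limsup_add_le (f := atTop) (u := fun l => (g l : EReal))
    (v := fun _ => (η : EReal)) ?_ ?_).trans_eq (by rw [hη]))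
  · refine limsup_le_limsup (h.mono fun l hl => ?_)
    simp only [Pi.add_apply]
    rw [← EReal.coe_add, EReal.coe_le_coe_iff]
    linarith [(abs_le.1 hl).2]
  · rw [hη]
    exact Or.inr (EReal.coe_ne_top _)
  · rw [hη]
    exact Or.inr (EReal.coe_ne_bot _)

theorem isFiniteUniformlyContinuousOn_limsup {X : Type*} [PseudoMetricSpace X] {s : Set X}
    {f : X → ℝ → ℝ} (hb : ∀ x ∈ s, ∃ C, ∀ᶠ l in atTop, |f x l| ≤ C)
    (hc : ∀ η > 0, ∃ δ > 0, ∀ x ∈ s, ∀ y ∈ s, dist x y ≤ δ →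
      ∀ᶠ l in atTop, |f x l - f y l| ≤ η) :
    IsFiniteUniformlyContinuousOn (fun x => limsup (fun l => (f x l : EReal)) atTop) s := by
  have hfin : ∀ x ∈ s, limsup (fun l => (f x l : EReal)) atTop ≠ ⊥ ∧
      limsup (fun l => (f x l : EReal)) atTop ≠ ⊤ := by
    intro x hx
    obtain ⟨C, hC⟩ := hb x hx
    constructor
    · refine ne_bot_of_le_ne_bot (EReal.coe_ne_bot (-C)) (le_limsup_of_frequently_le
        (hC.mono fun l hl => ?_).frequently)
      exact EReal.coe_le_coe_iff.2 (abs_le.1 hl).1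
    · refine ne_top_of_le_ne_top (EReal.coe_ne_top C) (limsup_le_of_le (h := hC.mono fun l hl => ?_))
      exact EReal.coe_le_coe_iff.2 (abs_le.1 hl).2
  refine ⟨hfin, Metric.uniformContinuousOn_iff_le.2 fun η hη => ?_⟩
  obtain ⟨δ, hδ, H⟩ := hc η hη
  have hle : ∀ x ∈ s, ∀ y ∈ s, dist x y ≤ δ →
      (limsup (fun l => (f x l : EReal)) atTop).toReal ≤
        (limsup (fun l => (f y l : EReal)) atTop).toReal + η := by
    intro x hx y hy hxy
    have h := limsup_coe_le_add (H x hx y hy hxy)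
    rwa [← EReal.coe_toReal (hfin x hx).2 (hfin x hx).1,
      ← EReal.coe_toReal (hfin y hy).2 (hfin y hy).1, ← EReal.coe_add,
      EReal.coe_le_coe_iff] at h
  refine ⟨δ, hδ, fun x hx y hy hxy => ?_⟩
  rw [Real.dist_eq, abs_sub_le_iff]
  constructor
  · linarith [hle x hx y hy hxy]
  · linarith [hle y hy x hx (by rwa [dist_comm])]

theorem isFiniteUniformlyContinuousOn_liminf {X : Type*} [PseudoMetricSpace X] {s : Set X}
    {f : X → ℝ → ℝ} (hb : ∀ x ∈ s, ∃ C, ∀ᶠ l in atTop, |f x l| ≤ C)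
    (hc : ∀ η > 0, ∃ δ > 0, ∀ x ∈ s, ∀ y ∈ s, dist x y ≤ δ →
      ∀ᶠ l in atTop, |f x l - f y l| ≤ η) :
    IsFiniteUniformlyContinuousOn (fun x => liminf (fun l => (f x l : EReal)) atTop) s := by
  have h := isFiniteUniformlyContinuousOn_limsup (s := s) (f := fun x l => -f x l)
    (by simpa only [abs_neg] using hb) fun η hη => by
      obtain ⟨δ, hδ, H⟩ := hc η hη
      refine ⟨δ, hδ, fun x hx y hy hxy => (H x hx y hy hxy).mono fun l hl => ?_⟩
      rwa [neg_sub_neg, abs_sub_comm]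
  have e : ∀ x, limsup (fun l => ((-f x l : ℝ) : EReal)) atTop =
      -liminf (fun l => (f x l : EReal)) atTop := fun x => by
    rw [← EReal.limsup_neg]
    rfl
  simp only [e] at h
  refine ⟨fun x hx => ?_, ?_⟩
  · have := h.1 x hx
    simp only [ne_eq, EReal.neg_eq_bot_iff, EReal.neg_eq_top_iff] at this
    exact ⟨this.2, this.1⟩
  · have := uniformContinuous_neg.comp_uniformContinuousOn h.2
    simpa [Function.comp_def, EReal.toReal_neg_eq] using this

theorem ratio_estimates {d : ℕ} {K : ℝ} (hK : 0 ≤ K)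
    (A : (ℝ →ᵇ PhaseMatrix d) → ℝ → PhaseMatrix d) (Γ : (ℝ →ᵇ PhaseMatrix d) → ℝ → PhaseMatrix d)
    (hA : ∀ B, Continuous (A B))
    (hs : ∀ B ∈ boundedSystems d K, ∀ t, (A B t).IsSymm)
    (hb : ∀ B ∈ boundedSystems d K, ∀ t, ‖A B t‖ ≤ K)
    (hd : ∀ B B' t, ‖A B t - A B' t‖ ≤ dist B B')
    (hΓ : ∀ B ∈ boundedSystems d K, IsFundamentalSolution (A B) (Γ B)) :
    (∀ B ∈ boundedSystems d K, ∃ C, ∀ᶠ l : ℝ in atTop, |(maslovIndex (Γ B) l : ℝ) / l| ≤ C) ∧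
    ∀ η > 0, ∃ δ > 0, ∀ B ∈ boundedSystems d K, ∀ B' ∈ boundedSystems d K, dist B B' ≤ δ →
      ∀ᶠ l : ℝ in atTop, |(maslovIndex (Γ B) l : ℝ) / l - maslovIndex (Γ B') l / l| ≤ η := by
  constructor
  · intro B hB
    obtain ⟨C, hC⟩ := exists_abs_maslovIndex_le d hK
    refine ⟨C, (eventually_ge_atTop 1).mono fun l hl => ?_⟩
    have hl0 : 0 < l := one_pos.trans_le hl
    rw [abs_div, abs_of_pos hl0, div_le_iff₀ hl0]
    exact hC _ _ (hA B) (hs B hB) (hb B hB) (hΓ B hB) l hl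
  · intro η hη
    obtain ⟨δ, hδ, H⟩ := exists_abs_maslovIndex_sub_le d hK (half_pos hη)
    refine ⟨δ, hδ, fun B hB B' hB' hdist => ?_⟩
    -- From this `l` on, the additive constant 18d + 1 is at most (η/2)l.
    filter_upwards [eventually_gt_atTop 0, eventually_ge_atTop ((18 * d + 1) / (η / 2))]
      with l hl hl'
    rw [div_le_iff₀ (half_pos hη)] at hl'
    have := H _ _ _ _ (hA B) (hA B') (hs B hB) (hs B' hB') (hb B hB) (hb B' hB')
      (fun t => (hd B B' t).trans hdist) (hΓ B hB) (hΓ B' hB') l hl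
    rw [← sub_div, abs_div, abs_of_pos hl, div_le_iff₀ hl]
    linarith

end

theorem theorem1p1 (d : ℕ) (K : ℝ) (hK : 0 < K) :
    IsFiniteUniformlyContinuousOn upperMeanIndex (boundedSystems d K) ∧
    IsFiniteUniformlyContinuousOn lowerMeanIndex (boundedSystems d K) ∧
    IsFiniteUniformlyContinuousOn upperMeanIndexNeg (boundedSystems d K) ∧
    IsFiniteUniformlyContinuousOn lowerMeanIndexNeg (boundedSystems d K) := by
  have hd : ∀ (B B' : ℝ →ᵇ PhaseMatrix d) t, ‖B t - B' t‖ ≤ dist B B' := fun B B' t => by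
    rw [← dist_eq_norm]
    exact BoundedContinuousFunction.dist_coe_le_dist t
  have hb : ∀ B ∈ boundedSystems d K, ∀ t, ‖B t‖ ≤ K := fun B hB t =>
    (B.norm_coe_le_norm t).trans hB.2
  have hΓ : ∀ B ∈ boundedSystems d K, IsFundamentalSolution B (fundamentalSolution B) :=
    fun B hB => fundamentalSolution_spec B.continuous (hb B hB)
  obtain ⟨h1, h2⟩ := ratio_estimates hK.le (fun B t => B t) (fun B => fundamentalSolution B)
    (fun B => B.continuous) (fun B hB => hB.1) hb hd hΓ
  obtain ⟨h3, h4⟩ := ratio_estimates hK.le (fun B t => -B (-t))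
    (fun B t => fundamentalSolution B (-t))
    (fun B => (B.continuous.comp continuous_neg).neg) (fun B hB t => (hB.1 (-t)).neg)
    (fun B hB t => by rw [norm_neg]; exact hb B hB (-t))
    (fun B B' t => by rw [neg_sub_neg, norm_sub_rev]; exact hd B B' (-t))
    (fun B hB => (hΓ B hB).comp_neg)
  -- Dividing by -l instead of l only changes signs, which the absolute values ignore.
  have h3' : ∀ B ∈ boundedSystems d K, ∃ C, ∀ᶠ l in atTop, |backwardRatio B l| ≤ C := by
    simpa only [backwardRatio, div_neg, abs_neg] using h3
  have h4' : ∀ η > 0, ∃ δ > 0, ∀ B ∈ boundedSystems d K, ∀ B' ∈ boundedSystems d K,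
      dist B B' ≤ δ → ∀ᶠ l in atTop, |backwardRatio B l - backwardRatio B' l| ≤ η := by
    simpa only [backwardRatio, div_neg, neg_sub_neg, ← neg_sub', abs_neg, abs_sub_comm] using h4
  exact ⟨isFiniteUniformlyContinuousOn_limsup h1 h2, isFiniteUniformlyContinuousOn_liminf h1 h2,
    isFiniteUniformlyContinuousOn_limsup h3' h4', isFiniteUniformlyContinuousOn_liminf h3' h4'⟩
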